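/- Conventions. $\mathbb P(V)$ denotes the space of lines of a vector space (or vector bundle) $V$. A Fano manifold is a compact connected complex manifold $M$ whose anticanonical bundle $-K_M=\det T_M$ is ample, and its pseudo-index is $i_M=\min\{-K_M\cdot C\mid C\subset M \text{ a rational curve}\}$. Let $n=2m$ be an even integer, let $\mathcal E=\mathcal O_{\mathbb P^m}^{\oplus m}\oplus\mathcal O_{\mathbb P^m}(1)$ over the complex projective space $\mathbb P^m$, and let $Y_n=\mathbb P(\mathcal E)$, a complex manifold of dimension $n$. Let $Z_m=\mathbb P(\mathcal O_{\mathbb P^m}(1))\subset Y_n$ be the locus of the lines of $\mathcal E$ on which the projection to the trivial summand $\mathcal O_{\mathbb P^m}^{\oplus m}$ vanishes. Then $Z_m$ is a closed submanifold of $Y_n$, mapped isomorphically to $\mathbb P^m$ by the bundle projection $Y_n\to\mathbb P^m$, with normal bundle $N_{Z_m/Y_n}\simeq\mathcal O_{\mathbb P^m}(-1)^{\oplus m}$. Let $\pi_n:X_n\to Y_n$ be the blow-up of $Y_n$ along $Z_m$. Then: 1. if $n\ge 4$, then $Y_n$ and $X_n$ are Fano manifolds of dimension $n$, and $i_{Y_n}=1$;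 2. $i_{X_4}=1$, and $i_{X_n}=2$ for $n\ge 6$. In particular, for every even $n\ge 6$, $\pi_n$ is a blow-up with smooth connected centre between Fano manifolds of dimension $n$ such that $2\dim Z_m=n=n+i_{Y_n}-1$ and $i_{X_n}>i_{Y_n}$. So, in the theorem that $i_X\le i_Y$ for every blow-up $X\to Y$ of Fano manifolds of dimension $n$ with smooth connected centre $Z$ such that $2\dim Z<n+i_Y-1$ (in particular whenever $\dim Z<n/2$), neither strict inequality can be replaced by a weak one. -/

import Mathlib

open scoped Manifold ContDiff Topology LinearAlgebra.Projectivization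

noncomputable section

namespace FanoBlowUp

/-! ### Complex manifolds given by an atlas of bijections onto subsets of a vector space -/

section Atlas

variable {E M ι : Type} [NormedAddCommGroup E] [NormedSpace ℂ E]

/-- A holomorphic atlas on a bare set `M`: coordinate systems that cover `M`, with values in the
vector space `E`, such that the changes of coordinates are holomorphic on open sets. -/
structure HolAtlas (E M ι : Type) [NormedAddCommGroup E] [NormedSpace ℂ E] where
  chart : ι → PartialEquiv M E
  idx : M → ι
  mem_idx : ∀ x, x ∈ (chart (idx x)).source
  isOpen_overlap : ∀ i j, IsOpen ((chart i).symm.trans (chart j)).source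
  holo : ∀ i j, ContDiffOn ℂ ω ((chart i).symm.trans (chart j))
    ((chart i).symm.trans (chart j)).source

/-- The charted space core of a holomorphic atlas. -/
def HolAtlas.core (A : HolAtlas E M ι) : ChartedSpaceCore E M where
  atlas := Set.range A.chart
  chartAt x := A.chart (A.idx x)
  mem_chart_source := A.mem_idx
  chart_mem_atlas _ := Set.mem_range_self _
  open_source := by
    rintro _ _ ⟨i, rfl⟩ ⟨j, rfl⟩
    exact A.isOpen_overlap i j
  continuousOn_toFun := by
    rintro _ _ ⟨i, rfl⟩ ⟨j, rfl⟩
    exact (A.holo i j).continuousOn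

theorem HolAtlas.isManifold (A : HolAtlas E M ι) :
    letI := A.core.toTopologicalSpace
    letI := A.core.toChartedSpace
    IsManifold 𝓘(ℂ, E) ω M := by
  let := A.core.toTopologicalSpace
  let := A.core.toChartedSpace
  apply isManifold_of_contDiffOn
  intro e e' he he'
  obtain ⟨f, hf, hfe⟩ := Set.mem_iUnion₂.1 he
  obtain ⟨f', hf', hfe'⟩ := Set.mem_iUnion₂.1 he'
  obtain rfl := Set.mem_singleton_iff.1 hfe
  obtain rfl := Set.mem_singleton_iff.1 hfe'
  obtain ⟨i, rfl⟩ := hf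
  obtain ⟨j, rfl⟩ := hf'
  simpa using! A.holo i j

theorem HolAtlas.isOpen_source (A : HolAtlas E M ι) (i : ι) :
    IsOpen[A.core.toTopologicalSpace] (A.chart i).source :=
  A.core.open_source' (Set.mem_range_self i)

theorem HolAtlas.contMDiffOn_chart (A : HolAtlas E M ι) (i : ι) :
    letI := A.core.toTopologicalSpace
    letI := A.core.toChartedSpace
    ContMDiffOn 𝓘(ℂ, E) 𝓘(ℂ, E) ω (A.chart i) (A.chart i).source := by
  let := A.core.toTopologicalSpace
  let := A.core.toChartedSpace
  have := A.isManifold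
  exact contMDiffOn_of_mem_maximalAtlas (I := 𝓘(ℂ, E)) (n := ω)
    (e := A.core.openPartialHomeomorph (A.chart i) (Set.mem_range_self i))
    (IsManifold.subset_maximalAtlas (Set.mem_iUnion₂.2 ⟨_, Set.mem_range_self i, rfl⟩))

end Atlas

/-! ### Complex projective space -/

/-- The projective space of lines of `ℂ ^ (N + 1)`. -/
abbrev CP (N : ℕ) : Type := ℙ ℂ (Fin (N + 1) → ℂ)

theorem insertNth_ne_zero {N : ℕ} (i : Fin (N + 1)) (z : Fin N → ℂ) :
    (i.insertNth (1 : ℂ) z : Fin (N + 1) → ℂ) ≠ 0 := fun h => by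
  simpa using congrFun h i

theorem rep_mk_ratio {N : ℕ} (v : Fin (N + 1) → ℂ) (hv : v ≠ 0) (a b : Fin (N + 1)) :
    (Projectivization.mk ℂ v hv).rep a / (Projectivization.mk ℂ v hv).rep b = v a / v b := by
  obtain ⟨c, hc⟩ := Projectivization.exists_smul_eq_mk_rep ℂ v hv
  rw [← hc]
  simp only [Pi.smul_apply, Units.smul_def, smul_eq_mul]
  exact mul_div_mul_left _ _ c.ne_zero

theorem rep_mk_ne_zero_iff {N : ℕ} (v : Fin (N + 1) → ℂ) (hv : v ≠ 0) (a : Fin (N + 1)) :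
    (Projectivization.mk ℂ v hv).rep a ≠ 0 ↔ v a ≠ 0 := by
  obtain ⟨c, hc⟩ := Projectivization.exists_smul_eq_mk_rep ℂ v hv
  rw [← hc]
  simp [Units.smul_def]

theorem exists_rep_ne_zero {N : ℕ} (p : CP N) : ∃ i, p.rep i ≠ 0 := by
  by_contra! h
  exact p.rep_nonzero (funext h)

theorem insertNth_div {N : ℕ} (i : Fin (N + 1)) (v : Fin (N + 1) → ℂ) (hi : v i ≠ 0) :
    (i.insertNth (1 : ℂ) (fun k => v (i.succAbove k) / v i) : Fin (N + 1) → ℂ) =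
      (v i)⁻¹ • v := by
  funext a
  refine Fin.succAboveCases i ?_ (fun k => ?_) a
  · simp [hi]
  · simp [div_eq_inv_mul]

/-- The affine coordinates `x_k / x_i` on the open set `x_i ≠ 0` of projective space. -/
def CP.chart (N : ℕ) (i : Fin (N + 1)) : PartialEquiv (CP N) (Fin N → ℂ) where
  source := {p | p.rep i ≠ 0}
  target := Set.univ
  toFun p := fun k => p.rep (i.succAbove k) / p.rep i
  invFun z := Projectivization.mk ℂ (i.insertNth (1 : ℂ) z) (insertNth_ne_zero i z)
  map_source' _ _ := Set.mem_univ _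
  map_target' z _ := (rep_mk_ne_zero_iff _ _ _).2 (by simp)
  left_inv' p hp := by
    conv_rhs => rw [← p.mk_rep]
    rw [Projectivization.mk_eq_mk_iff']
    exact ⟨(p.rep i)⁻¹, (insertNth_div i p.rep hp).symm⟩
  right_inv' z _ := by
    funext k
    rw [rep_mk_ratio]
    simp

theorem contDiff_insertNth {N : ℕ} (i a : Fin (N + 1)) :
    ContDiff ℂ ω (fun z : Fin N → ℂ => (i.insertNth (1 : ℂ) z : Fin (N + 1) → ℂ) a) := by
  refine Fin.succAboveCases i ?_ (fun k => ?_) a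
  · simpa using contDiff_const
  · simpa using contDiff_apply ℂ ℂ k

/-- The standard holomorphic atlas of projective space. -/
def CP.holAtlas (N : ℕ) : HolAtlas (Fin N → ℂ) (CP N) (Fin (N + 1)) where
  chart := CP.chart N
  idx p := (exists_rep_ne_zero p).choose
  mem_idx p := (exists_rep_ne_zero p).choose_spec
  isOpen_overlap i j := by
    have : ((CP.chart N i).symm.trans (CP.chart N j)).source =
        {z | (i.insertNth (1 : ℂ) z : Fin (N + 1) → ℂ) j ≠ 0} := by
      ext z
      simp [CP.chart, PartialEquiv.trans_source, rep_mk_ne_zero_iff]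
    rw [this]
    exact isOpen_ne_fun (contDiff_insertNth i j).continuous continuous_const
  holo i j := by
    have hs : ((CP.chart N i).symm.trans (CP.chart N j)).source =
        {z | (i.insertNth (1 : ℂ) z : Fin (N + 1) → ℂ) j ≠ 0} := by
      ext z
      simp [CP.chart, PartialEquiv.trans_source, rep_mk_ne_zero_iff]
    rw [hs]
    have hf : ⇑((CP.chart N i).symm.trans (CP.chart N j)) =
        fun z => fun k => (i.insertNth (1 : ℂ) z : Fin (N + 1) → ℂ) (j.succAbove k) /
          (i.insertNth (1 : ℂ) z : Fin (N + 1) → ℂ) j := by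
      funext z k
      exact rep_mk_ratio _ _ _ _
    rw [hf, contDiffOn_pi]
    intro k
    exact (contDiff_insertNth i _).contDiffOn.div (contDiff_insertNth i _).contDiffOn
      (fun z hz => hz)

instance (N : ℕ) : TopologicalSpace (CP N) := (CP.holAtlas N).core.toTopologicalSpace

instance (N : ℕ) : ChartedSpace (Fin N → ℂ) (CP N) := (CP.holAtlas N).core.toChartedSpace

instance (N : ℕ) : IsManifold 𝓘(ℂ, Fin N → ℂ) ω (CP N) := (CP.holAtlas N).isManifold

theorem CP.isOpen_source {N : ℕ} (i : Fin (N + 1)) : IsOpen {p : CP N | p.rep i ≠ 0} :=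
  (CP.holAtlas N).isOpen_source i

theorem CP.contMDiffOn_ratio {N : ℕ} (a i : Fin (N + 1)) :
    ContMDiffOn 𝓘(ℂ, Fin N → ℂ) 𝓘(ℂ) ω (fun p : CP N => p.rep a / p.rep i)
      {p | p.rep i ≠ 0} := by
  have h := (CP.holAtlas N).contMDiffOn_chart i
  refine Fin.succAboveCases i ?_ (fun k => ?_) a
  · exact (contMDiffOn_const (c := (1 : ℂ))).congr fun p hp => div_self hp
  · exact (contDiff_apply ℂ ℂ k).contMDiff.comp_contMDiffOn h

/-! ### Holomorphic line bundles -/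

section LineBundles

variable {E E' M M' : Type} [NormedAddCommGroup E] [NormedSpace ℂ E]
  [NormedAddCommGroup E'] [NormedSpace ℂ E']
  [TopologicalSpace M] [ChartedSpace E M] [TopologicalSpace M'] [ChartedSpace E' M']

/-- A holomorphic line bundle on the complex manifold `M` (modelled on `E`), given by a
trivializing open cover `U i` and transition functions: a vector with coordinate `c` over `U i`
has the coordinate `g i j x * c` over `U j`. -/
structure LineBundle (E M : Type) [NormedAddCommGroup E] [NormedSpace ℂ E]
    [TopologicalSpace M] [ChartedSpace E M] where
  ι : Type
  U : ι → Set M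
  isOpen_U : ∀ i, IsOpen (U i)
  cover : ∀ x, ∃ i, x ∈ U i
  g : ι → ι → M → ℂ
  holo : ∀ i j, ContMDiffOn 𝓘(ℂ, E) 𝓘(ℂ) ω (g i j) (U i ∩ U j)
  g_self : ∀ i, ∀ x ∈ U i, g i i x = 1
  cocycle : ∀ i j k, ∀ x ∈ U i ∩ U j ∩ U k, g j k x * g i j x = g i k x

namespace LineBundle

/-- The tensor power `L ^ ⊗ k`. -/
def pow (L : LineBundle E M) (k : ℕ) : LineBundle E M where
  ι := L.ι
  U := L.U
  isOpen_U := L.isOpen_U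
  cover := L.cover
  g i j x := L.g i j x ^ k
  holo i j := (L.holo i j).pow k
  g_self i x hx := by simp [L.g_self i x hx]
  cocycle i j l x hx := by rw [← mul_pow, L.cocycle i j l x hx]

/-- The pull-back of a line bundle by a holomorphic map. -/
def pullback (L : LineBundle E M) (f : M' → M) (hf : ContMDiff 𝓘(ℂ, E') 𝓘(ℂ, E) ω f) :
    LineBundle E' M' where
  ι := L.ι
  U i := f ⁻¹' L.U i
  isOpen_U i := (L.isOpen_U i).preimage hf.continuous
  cover x := L.cover (f x)
  g i j x := L.g i j (f x)
  holo i j := (L.holo i j).comp hf.contMDiffOn fun _ hx => hx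
  g_self i x hx := L.g_self i (f x) hx
  cocycle i j k x hx := L.cocycle i j k (f x) hx

/-- `s` is a global holomorphic section of `L`, given by its coordinates `s i` over `U i`. -/
def IsSection (L : LineBundle E M) (s : L.ι → M → ℂ) : Prop :=
  (∀ i, ContMDiffOn 𝓘(ℂ, E) 𝓘(ℂ) ω (s i) (L.U i)) ∧
    ∀ i j, ∀ x ∈ L.U i ∩ L.U j, s j x = L.g i j x * s i x

/-- Holomorphic line bundles `L`, `L'` on `M` are isomorphic. -/
def IsIso (L L' : LineBundle E M) : Prop :=
  ∃ t : L.ι → L'.ι → M → ℂ,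
    (∀ i a, ContMDiffOn 𝓘(ℂ, E) 𝓘(ℂ) ω (t i a) (L.U i ∩ L'.U a)) ∧
    (∀ i a, ∀ x ∈ L.U i ∩ L'.U a, t i a x ≠ 0) ∧
    ∀ i j a b, ∀ x ∈ (L.U i ∩ L.U j) ∩ (L'.U a ∩ L'.U b),
      t j b x * L.g i j x = L'.g a b x * t i a x

end LineBundle

/-- `φ` is a holomorphic embedding onto a closed complex submanifold. -/
structure IsHolEmbedding (E E' : Type) [NormedAddCommGroup E] [NormedSpace ℂ E]
    [NormedAddCommGroup E'] [NormedSpace ℂ E'] {M M' : Type}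
    [TopologicalSpace M] [ChartedSpace E M] [TopologicalSpace M'] [ChartedSpace E' M']
    (φ : M → M') : Prop where
  holo : ContMDiff 𝓘(ℂ, E) 𝓘(ℂ, E') ω φ
  isClosedEmbedding : Topology.IsClosedEmbedding φ
  immersion : ∀ x, Function.Injective (mfderiv 𝓘(ℂ, E) 𝓘(ℂ, E') φ x)

/-- `L` is very ample: finitely many global sections `s 0, …, s N` of `L` without common zero
define an embedding `x ↦ [s 0 x : … : s N x]` into projective space. -/
def LineBundle.IsVeryAmple (L : LineBundle E M) : Prop :=
  ∃ (N : ℕ) (s : Fin (N + 1) → L.ι → M → ℂ) (φ : M → CP N),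
    (∀ a, L.IsSection (s a)) ∧
    (∀ i, ∀ x ∈ L.U i, ∃ h : (fun a => s a i x) ≠ 0,
      φ x = Projectivization.mk ℂ (fun a => s a i x) h) ∧
    IsHolEmbedding E (Fin N → ℂ) φ

/-- `L` is ample: some positive tensor power is very ample. -/
def LineBundle.IsAmple (L : LineBundle E M) : Prop := ∃ k : ℕ, 0 < k ∧ (L.pow k).IsVeryAmple

/-- The line bundle `𝒪(d)` on projective space: the coordinate over `x_i ≠ 0` of a homogeneous
form `F` of degree `d` is `F / x_i ^ d`. -/
def CP.twist (N : ℕ) (d : ℤ) : LineBundle (Fin N → ℂ) (CP N) where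
  ι := Fin (N + 1)
  U i := {p | p.rep i ≠ 0}
  isOpen_U := CP.isOpen_source
  cover := exists_rep_ne_zero
  g i j p := (p.rep i / p.rep j) ^ d
  holo i j := by
    have key : ∀ (a b : Fin (N + 1)) (n : ℕ), ContMDiffOn 𝓘(ℂ, Fin N → ℂ) 𝓘(ℂ) ω
        (fun p : CP N => (p.rep a / p.rep b) ^ n) {p | p.rep b ≠ 0} :=
      fun a b n => (CP.contMDiffOn_ratio a b).pow n
    obtain ⟨n, rfl | rfl⟩ := d.eq_nat_or_neg
    · simpa using (key i j n).mono Set.inter_subset_right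
    · refine ((key j i n).mono Set.inter_subset_left).congr fun p _ => ?_
      rw [zpow_neg, zpow_natCast, ← inv_pow, inv_div]
  g_self i p hp := by
    have : p.rep i ≠ 0 := hp
    simp [this]
  cocycle i j k p hp := by
    have hj : p.rep j ≠ 0 := hp.1.2
    rw [← mul_zpow, div_mul_div_comm, mul_comm (p.rep j), mul_div_mul_right _ _ hj]

/-! ### The anticanonical bundle, Fano manifolds and the pseudo-index -/

theorem contDiff_clm_det [FiniteDimensional ℂ E] :
    ContDiff ℂ ω (fun A : E →L[ℂ] E => A.det) := by
  classical
  let b := Module.finBasis ℂ E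
  have h : (fun A : E →L[ℂ] E => A.det) = fun A : E →L[ℂ] E =>
      ∑ σ : Equiv.Perm (Fin (Module.finrank ℂ E)), ((Equiv.Perm.sign σ : ℤ) : ℂ) *
        ∏ i, b.repr (A (b i)) (σ i) := by
    funext A
    change LinearMap.det (A : E →ₗ[ℂ] E) = _
    rw [← LinearMap.det_toMatrix b, Matrix.det_apply]
    refine Finset.sum_congr rfl fun σ _ => ?_
    simp [LinearMap.toMatrix_apply, Units.smul_def]
  rw [h]
  refine ContDiff.sum fun σ _ => contDiff_const.mul (contDiff_prod fun i _ => ?_)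
  let l : (E →L[ℂ] E) →ₗ[ℂ] ℂ :=
    (b.coord (σ i)) ∘ₗ (ContinuousLinearMap.apply ℂ E (b i) : (E →L[ℂ] E) →L[ℂ] E)
  exact (LinearMap.toContinuousLinearMap l).contDiff

variable (E M) in
/-- The anticanonical bundle `-K_M`: the determinant line bundle of the tangent bundle. -/
def anticanonical [FiniteDimensional ℂ E] [IsManifold 𝓘(ℂ, E) ω M] : LineBundle E M where
  ι := atlas E M
  U e := e.1.source
  isOpen_U e := e.1.open_source
  cover x := ⟨achart E x, mem_chart_source E x⟩
  g e e' x := ((tangentBundleCore 𝓘(ℂ, E) M).coordChange e e' x).det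
  holo e e' := by
    have : IsManifold 𝓘(ℂ, E) (ω + 1) M := inferInstance
    have : (tangentBundleCore 𝓘(ℂ, E) M).IsContMDiff 𝓘(ℂ, E) ω := tangentBundleCore.isContMDiff
    have h := (tangentBundleCore 𝓘(ℂ, E) M).contMDiffOn_coordChange (n := ω) 𝓘(ℂ, E) e e'
    exact contDiff_clm_det.contMDiff.comp_contMDiffOn h
  g_self e x hx := by
    have : (tangentBundleCore 𝓘(ℂ, E) M).coordChange e e x = ContinuousLinearMap.id ℂ E :=
      ContinuousLinearMap.ext fun v => (tangentBundleCore 𝓘(ℂ, E) M).coordChange_self e x hx v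
    rw [this]
    exact LinearMap.det_id
  cocycle i j k x hx := by
    have : ((tangentBundleCore 𝓘(ℂ, E) M).coordChange j k x).comp
        ((tangentBundleCore 𝓘(ℂ, E) M).coordChange i j x) =
          (tangentBundleCore 𝓘(ℂ, E) M).coordChange i k x :=
      ContinuousLinearMap.ext fun v => (tangentBundleCore 𝓘(ℂ, E) M).coordChange_comp i j k x hx v
    rw [← this]
    exact (LinearMap.det_comp _ _).symm

variable (E M) in
/-- `M` is a Fano manifold: a compact connected complex manifold with ample anticanonical
bundle. -/
structure IsFano [FiniteDimensional ℂ E] [IsManifold 𝓘(ℂ, E) ω M] : Prop where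
  t2 : T2Space M
  compact : CompactSpace M
  connected : ConnectedSpace M
  ample : (anticanonical E M).IsAmple

/-- The line bundle `L` on `ℙ¹` has degree `d`. -/
def HasDegree (L : LineBundle (Fin 1 → ℂ) (CP 1)) (d : ℤ) : Prop := L.IsIso (CP.twist 1 d)

variable (E M) in
/-- The set of the anticanonical degrees `-K_M · C` of the rational curves `C` of `M`. A rational
curve is the image of a holomorphic map `f : ℙ¹ → M` that is birational onto its image (that is,
injective outside a finite set), and `L · C` is the degree of `f^* L`. -/
def rationalCurveDegrees [FiniteDimensional ℂ E] [IsManifold 𝓘(ℂ, E) ω M] : Set ℤ :=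
  {d | ∃ (f : CP 1 → M) (hf : ContMDiff 𝓘(ℂ, Fin 1 → ℂ) 𝓘(ℂ, E) ω f),
    (∃ S : Set (CP 1), S.Finite ∧ Set.InjOn f Sᶜ) ∧
      HasDegree ((anticanonical E M).pullback f hf) d}

variable (E M) in
/-- `i` is the pseudo-index of `M`: the minimum of `-K_M · C` over the rational curves `C`. -/
def HasPseudoIndex [FiniteDimensional ℂ E] [IsManifold 𝓘(ℂ, E) ω M] (i : ℤ) : Prop :=
  IsLeast (rationalCurveDegrees E M) i

end LineBundles

/-! ### Blow-ups -/

section BlowUps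

variable {E F : Type} [NormedAddCommGroup E] [NormedSpace ℂ E] [NormedAddCommGroup F]
  [NormedSpace ℂ F] {X Y : Type} [TopologicalSpace X] [ChartedSpace F X]
  [TopologicalSpace Y] [ChartedSpace E Y]

variable (E) in
/-- The (representatives of) germs at `y` of holomorphic functions on `Y` that vanish on `Z`:
the stalk at `y` of the ideal sheaf of `Z`. -/
def idealAt (Z : Set Y) (y : Y) : Set (Y → ℂ) :=
  {h | ContMDiffAt 𝓘(ℂ, E) 𝓘(ℂ) ω h y ∧ ∀ᶠ y' in 𝓝 y, y' ∈ Z → h y' = 0}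

variable (E F) in
/-- The inverse image ideal sheaf `g⁻¹ I_Z · 𝒪_X` is invertible: near every point it is generated
by one function which is not a zero divisor. (An ideal of a local ring that is principal and
generated by a set is generated by one element of the set.) -/
def PullsBackToDivisor (Z : Set Y) (g : X → Y) : Prop :=
  ∀ x, ∃ h₀ ∈ idealAt E Z (g x), (¬ ∀ᶠ x' in 𝓝 x, h₀ (g x') = 0) ∧
    ∀ h ∈ idealAt E Z (g x), ∃ a : X → ℂ, ContMDiffAt 𝓘(ℂ, F) 𝓘(ℂ) ω a x ∧
      ∀ᶠ x' in 𝓝 x, h (g x') = a x' * h₀ (g x')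

variable (E F) in
/-- `π : X → Y` is the blow-up of the complex manifold `Y` along `Z`, by the universal property:
`π` pulls back `Z` to a Cartier divisor, and it is universal among the holomorphic maps to `Y`
from complex manifolds with this property. -/
structure IsBlowUp (Z : Set Y) (π : X → Y) : Prop where
  holo : ContMDiff 𝓘(ℂ, F) 𝓘(ℂ, E) ω π
  divisor : PullsBackToDivisor E F Z π
  universal : ∀ (G W : Type) [NormedAddCommGroup G] [NormedSpace ℂ G] [FiniteDimensional ℂ G]
    [TopologicalSpace W] [T2Space W] [ChartedSpace G W] [IsManifold 𝓘(ℂ, G) ω W] (g : W → Y),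
    ContMDiff 𝓘(ℂ, G) 𝓘(ℂ, E) ω g → PullsBackToDivisor E G Z g →
      ∃! g' : W → X, ContMDiff 𝓘(ℂ, G) 𝓘(ℂ, F) ω g' ∧ π ∘ g' = g

end BlowUps

/-! ### The projective bundle `Y = ℙ(𝒪^m ⊕ 𝒪(1))` over `ℙ^m` -/

/-- The fibre at `p` of the vector bundle `𝒪^m ⊕ 𝒪(1)` on `ℙ^m`: the fibre of `𝒪(1)` at a line `p`
of `ℂ ^ (m + 1)` is the dual of this line. -/
abbrev Fibre (m : ℕ) (p : CP m) : Type := (Fin m → ℂ) × Module.Dual ℂ p.submodule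

/-- The points of `ℙ(𝒪^m ⊕ 𝒪(1))`: a point `base` of `ℙ^m` and a line in the fibre there. -/
structure YSpace (m : ℕ) : Type where
  base : CP m
  line : ℙ ℂ (Fibre m base)

namespace YSpace

variable {m : ℕ}

theorem rep_mem (p : CP m) : p.rep ∈ p.submodule := by
  rw [Projectivization.submodule_eq]
  exact Submodule.mem_span_singleton_self _

/-- The vector of the line `p` whose `i`-th coordinate is `1` (for `p` in the set `x_i ≠ 0`). -/
def unitVec (i : Fin (m + 1)) (p : CP m) : p.submodule :=
  ⟨(p.rep i)⁻¹ • p.rep, p.submodule.smul_mem _ (rep_mem p)⟩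

/-- The trivialization of `𝒪^m ⊕ 𝒪(1)` over `x_i ≠ 0`: the last coordinate of `(v, ξ)` is the value
of `ξ` at `unitVec i p`. -/
def triv (i : Fin (m + 1)) (p : CP m) : Fibre m p →ₗ[ℂ] (Fin (m + 1) → ℂ) :=
  LinearMap.pi (Fin.snoc
    (fun k => (LinearMap.proj k).comp (LinearMap.fst ℂ (Fin m → ℂ) (Module.Dual ℂ p.submodule)))
    ((Module.Dual.eval ℂ p.submodule (unitVec i p)).comp
      (LinearMap.snd ℂ (Fin m → ℂ) (Module.Dual ℂ p.submodule))) :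
        Fin (m + 1) → (Fibre m p →ₗ[ℂ] ℂ))

/-- The inverse of `triv i p` (for `p` in the set `x_i ≠ 0`). -/
def untriv (i : Fin (m + 1)) (p : CP m) (c : Fin (m + 1) → ℂ) : Fibre m p :=
  (fun k => c k.castSucc, c (Fin.last m) • (LinearMap.proj i).comp p.submodule.subtype)

@[simp]
theorem triv_castSucc (i : Fin (m + 1)) (p : CP m) (v : Fibre m p) (k : Fin m) :
    triv i p v k.castSucc = v.1 k := by
  simp [triv]

@[simp]
theorem triv_last (i : Fin (m + 1)) (p : CP m) (v : Fibre m p) :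
    triv i p v (Fin.last m) = v.2 (unitVec i p) := by
  simp [triv]

theorem triv_untriv_last (i i' : Fin (m + 1)) (p : CP m) (c : Fin (m + 1) → ℂ) :
    triv i' p (untriv i p c) (Fin.last m) = c (Fin.last m) * (p.rep i / p.rep i') := by
  simp [untriv, unitVec, div_eq_inv_mul]

theorem triv_untriv (i : Fin (m + 1)) (p : CP m) (hp : p.rep i ≠ 0) (c : Fin (m + 1) → ℂ) :
    triv i p (untriv i p c) = c := by
  funext a
  refine Fin.lastCases ?_ (fun k => ?_) a
  · rw [triv_untriv_last, div_self hp, mul_one]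
  · simp [untriv]

theorem untriv_triv (i : Fin (m + 1)) (p : CP m) (hp : p.rep i ≠ 0) (v : Fibre m p) :
    untriv i p (triv i p v) = v := by
  refine Prod.ext (by simp [untriv]) (LinearMap.ext fun x => ?_)
  obtain ⟨x, hx⟩ := x
  obtain ⟨a, rfl⟩ := Submodule.mem_span_singleton.1 (p.submodule_eq ▸ hx)
  have : (⟨a • p.rep, hx⟩ : p.submodule) = (a * p.rep i) • unitVec i p := by
    ext k
    simp [unitVec, mul_assoc, hp]
  rw [this, map_smul, map_smul]
  simp [untriv, unitVec, hp]

theorem untriv_ne_zero (i : Fin (m + 1)) (p : CP m) (hp : p.rep i ≠ 0) (c : Fin (m + 1) → ℂ)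
    (hc : c ≠ 0) : untriv i p c ≠ 0 := fun h => hc (by
  rw [← triv_untriv i p hp c, h, map_zero])

/-- The point of `ℙ(𝒪^m ⊕ 𝒪(1))` over `p` with homogeneous coordinates `c` in the `i`-th
trivialization. -/
def ofCoord (i : Fin (m + 1)) (p : CP m) (hp : p.rep i ≠ 0) (c : Fin (m + 1) → ℂ) (hc : c ≠ 0) :
    YSpace m :=
  ⟨p, Projectivization.mk ℂ (untriv i p c) (untriv_ne_zero i p hp c hc)⟩

theorem ofCoord_congr (i : Fin (m + 1)) {p p' : CP m} (hp : p.rep i ≠ 0) (hp' : p'.rep i ≠ 0)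
    {c c' : Fin (m + 1) → ℂ} (hc : c ≠ 0) (hc' : c' ≠ 0) (h : p = p') (a : ℂ) (h' : a • c' = c) :
    ofCoord i p hp c hc = ofCoord i p' hp' c' hc' := by
  subst h h'
  unfold ofCoord
  congr 1
  rw [Projectivization.mk_eq_mk_iff']
  exact ⟨a, by ext <;> simp [untriv, mul_assoc]⟩

/-- The homogeneous coordinates of a point in the `i`-th trivialization. -/
def coord (i : Fin (m + 1)) (y : YSpace m) : Fin (m + 1) → ℂ := triv i y.base y.line.rep

theorem coord_ne_zero (i : Fin (m + 1)) (y : YSpace m) (hp : y.base.rep i ≠ 0) :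
    coord i y ≠ 0 := fun h => y.line.rep_nonzero (by
  rw [← untriv_triv i y.base hp y.line.rep]
  change untriv i y.base (coord i y) = 0
  rw [h]
  ext <;> simp [untriv])

theorem ofCoord_coord (i : Fin (m + 1)) (y : YSpace m) (hp : y.base.rep i ≠ 0) :
    ofCoord i y.base hp (coord i y) (coord_ne_zero i y hp) = y := by
  obtain ⟨p, l⟩ := y
  unfold ofCoord
  congr 1
  conv_rhs => rw [← l.mk_rep]
  congr 1
  exact untriv_triv i p hp l.rep

theorem coord_ofCoord (i i' : Fin (m + 1)) (p : CP m) (hp : p.rep i ≠ 0) (c : Fin (m + 1) → ℂ)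
    (hc : c ≠ 0) : ∃ a : ℂˣ, coord i' (ofCoord i p hp c hc) =
      (a : ℂ) • triv i' p (untriv i p c) := by
  obtain ⟨a, ha⟩ := Projectivization.exists_smul_eq_mk_rep ℂ (untriv i p c)
    (untriv_ne_zero i p hp c hc)
  refine ⟨a, ?_⟩
  rw [← map_smul]
  exact congrArg (triv i' p) ha.symm

/-- The coordinates on `Y` over the set `x_i ≠ 0` of `ℙ^m` where the `j`-th homogeneous coordinate
in the `i`-th trivialization does not vanish: the affine coordinates on `ℙ^m`, and the affine
coordinates in the fibre. -/
def chart (m : ℕ) (ij : Fin (m + 1) × Fin (m + 1)) :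
    PartialEquiv (YSpace m) ((Fin m → ℂ) × (Fin m → ℂ)) where
  source := {y | y.base.rep ij.1 ≠ 0 ∧ coord ij.1 y ij.2 ≠ 0}
  target := Set.univ
  toFun y := (CP.chart m ij.1 y.base,
    fun k => coord ij.1 y (ij.2.succAbove k) / coord ij.1 y ij.2)
  invFun zw := ofCoord ij.1 ((CP.chart m ij.1).symm zw.1)
    ((CP.chart m ij.1).map_target (Set.mem_univ _)) (ij.2.insertNth (1 : ℂ) zw.2)
    (insertNth_ne_zero _ _)
  map_source' _ _ := Set.mem_univ _
  map_target' zw _ := by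
    have hp := (CP.chart m ij.1).map_target (Set.mem_univ zw.1)
    refine ⟨hp, ?_⟩
    obtain ⟨a, ha⟩ := coord_ofCoord ij.1 ij.1 _ hp _ (insertNth_ne_zero ij.2 zw.2)
    rw [ha, triv_untriv _ _ hp]
    simp
  left_inv' y hy := by
    conv_rhs => rw [← ofCoord_coord ij.1 y hy.1]
    exact ofCoord_congr ij.1 _ _ _ _ ((CP.chart m ij.1).left_inv hy.1) _
      (insertNth_div ij.2 _ hy.2).symm
  right_inv' zw _ := by
    have hp := (CP.chart m ij.1).map_target (Set.mem_univ zw.1)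
    obtain ⟨a, ha⟩ := coord_ofCoord ij.1 ij.1 _ hp _ (insertNth_ne_zero ij.2 zw.2)
    refine Prod.ext ((CP.chart m ij.1).right_inv (Set.mem_univ _)) (funext fun k => ?_)
    simp only
    rw [ha, triv_untriv _ _ hp]
    simp

/-- The change of trivializations of `𝒪^m ⊕ 𝒪(1)` in coordinates. -/
def coordChange (i i' j : Fin (m + 1)) (zw : (Fin m → ℂ) × (Fin m → ℂ)) : Fin (m + 1) → ℂ :=
  Fin.snoc (fun k : Fin m => (j.insertNth (1 : ℂ) zw.2 : Fin (m + 1) → ℂ) k.castSucc)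
    ((j.insertNth (1 : ℂ) zw.2 : Fin (m + 1) → ℂ) (Fin.last m) /
      (i.insertNth (1 : ℂ) zw.1 : Fin (m + 1) → ℂ) i')

theorem triv_untriv_eq (i i' j : Fin (m + 1)) (zw : (Fin m → ℂ) × (Fin m → ℂ)) :
    triv i' ((CP.chart m i).symm zw.1)
      (untriv i ((CP.chart m i).symm zw.1) (j.insertNth (1 : ℂ) zw.2)) =
        coordChange i i' j zw := by
  funext a
  refine Fin.lastCases ?_ (fun k => ?_) a
  · rw [triv_untriv_last, coordChange, Fin.snoc_last]
    have := rep_mk_ratio _ (insertNth_ne_zero i zw.1) i i'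
    rw [Fin.insertNth_apply_same] at this
    exact (congrArg _ this).trans (mul_one_div _ _)
  · simp [coordChange, untriv]

theorem contDiffOn_coordChange (i i' j a : Fin (m + 1)) :
    ContDiffOn ℂ ω (fun zw => coordChange i i' j zw a)
      {zw : (Fin m → ℂ) × (Fin m → ℂ) | (i.insertNth (1 : ℂ) zw.1 : Fin (m + 1) → ℂ) i' ≠ 0} := by
  refine Fin.lastCases ?_ (fun k => ?_) a
  · simp only [coordChange, Fin.snoc_last]
    exact ((contDiff_insertNth j _).comp contDiff_snd).contDiffOn.div
      ((contDiff_insertNth i _).comp contDiff_fst).contDiffOn fun _ h => h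
  · simp only [coordChange, Fin.snoc_castSucc]
    exact ((contDiff_insertNth j _).comp contDiff_snd).contDiffOn

theorem chart_trans_source (ij ij' : Fin (m + 1) × Fin (m + 1)) :
    ((chart m ij).symm.trans (chart m ij')).source =
      {zw | (ij.1.insertNth (1 : ℂ) zw.1 : Fin (m + 1) → ℂ) ij'.1 ≠ 0} ∩
        (fun zw => coordChange ij.1 ij'.1 ij.2 zw ij'.2) ⁻¹' {0}ᶜ := by
  ext zw
  have hp := (CP.chart m ij.1).map_target (Set.mem_univ zw.1)
  obtain ⟨a, ha⟩ := coord_ofCoord ij.1 ij'.1 _ hp _ (insertNth_ne_zero ij.2 zw.2)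
  rw [triv_untriv_eq] at ha
  rw [PartialEquiv.trans_source]
  change (zw ∈ Set.univ ∧ (_ ≠ 0 ∧ coord ij'.1 (ofCoord ij.1 _ hp _ (insertNth_ne_zero ij.2 zw.2)) ij'.2 ≠ 0)) ↔ _
  rw [ha]
  have := rep_mk_ne_zero_iff _ (insertNth_ne_zero ij.1 zw.1) ij'.1
  simp only [Set.mem_univ, true_and, Set.mem_inter_iff, Set.mem_preimage, Set.mem_compl_iff,
    Set.mem_singleton_iff, Set.mem_ofPred_eq, Pi.smul_apply, smul_eq_mul, ne_eq, mul_eq_zero,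
    Units.ne_zero, false_or]
  exact and_congr_left' this

/-- The holomorphic atlas of `ℙ(𝒪^m ⊕ 𝒪(1))`. -/
def holAtlas (m : ℕ) :
    HolAtlas ((Fin m → ℂ) × (Fin m → ℂ)) (YSpace m) (Fin (m + 1) × Fin (m + 1)) where
  chart := chart m
  idx y := ((exists_rep_ne_zero y.base).choose,
    (Function.ne_iff.1 (coord_ne_zero _ y (exists_rep_ne_zero y.base).choose_spec)).choose)
  mem_idx y := ⟨(exists_rep_ne_zero y.base).choose_spec,
    (Function.ne_iff.1 (coord_ne_zero _ y (exists_rep_ne_zero y.base).choose_spec)).choose_spec⟩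
  isOpen_overlap ij ij' := by
    rw [chart_trans_source]
    refine (contDiffOn_coordChange _ _ _ _).continuousOn.isOpen_inter_preimage ?_
      isOpen_compl_singleton
    exact isOpen_ne_fun ((contDiff_insertNth _ _).continuous.comp continuous_fst) continuous_const
  holo ij ij' := by
    rw [chart_trans_source]
    have hf : ⇑((chart m ij).symm.trans (chart m ij')) = fun zw =>
        ((CP.chart m ij.1).symm.trans (CP.chart m ij'.1) zw.1,
          fun k => coordChange ij.1 ij'.1 ij.2 zw (ij'.2.succAbove k) /
            coordChange ij.1 ij'.1 ij.2 zw ij'.2) := by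
      funext zw
      have hp := (CP.chart m ij.1).map_target (Set.mem_univ zw.1)
      obtain ⟨a, ha⟩ := coord_ofCoord ij.1 ij'.1 _ hp _ (insertNth_ne_zero ij.2 zw.2)
      rw [triv_untriv_eq] at ha
      refine Prod.ext rfl (funext fun k => ?_)
      change coord ij'.1 (ofCoord ij.1 _ hp _ (insertNth_ne_zero ij.2 zw.2)) _ /
        coord ij'.1 (ofCoord ij.1 _ hp _ (insertNth_ne_zero ij.2 zw.2)) _ = _
      rw [ha]
      exact mul_div_mul_left _ _ a.ne_zero
    rw [hf]
    refine ContDiffOn.prodMk ?_ (contDiffOn_pi.2 fun k => ?_)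
    · refine ((CP.holAtlas m).holo ij.1 ij'.1).comp contDiff_fst.contDiffOn fun zw hzw => ?_
      change zw.1 ∈ ((CP.chart m ij.1).symm.trans (CP.chart m ij'.1)).source
      rw [PartialEquiv.trans_source]
      exact ⟨Set.mem_univ _, (rep_mk_ne_zero_iff _ _ _).2 hzw.1⟩
    · exact ((contDiffOn_coordChange _ _ _ _).mono Set.inter_subset_left).div
        ((contDiffOn_coordChange _ _ _ _).mono Set.inter_subset_left) fun _ h => h.2

end YSpace

/-- The model vector space of `Y`, of dimension `2 * m`. -/
abbrev YModel (m : ℕ) : Type := (Fin m → ℂ) × (Fin m → ℂ)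

instance (m : ℕ) : TopologicalSpace (YSpace m) := (YSpace.holAtlas m).core.toTopologicalSpace

instance (m : ℕ) : ChartedSpace (YModel m) (YSpace m) := (YSpace.holAtlas m).core.toChartedSpace

instance (m : ℕ) : IsManifold 𝓘(ℂ, YModel m) ω (YSpace m) := (YSpace.holAtlas m).isManifold

/-! ### The centre `Z = ℙ(𝒪(1))` of the blow-up -/

/-- The submanifold `Z = ℙ(𝒪(1))` of `Y`: the lines of `𝒪^m ⊕ 𝒪(1)` contained in the summand `𝒪(1)`,
that is, on which the projection to the trivial summand `𝒪^m` vanishes. -/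
def center (m : ℕ) : Set (YSpace m) := {y | ∀ v ∈ y.line.submodule, v.1 = 0}

/-- The normal bundle of the embedding `σ : ℙ^m → Y` is isomorphic to `𝒪(-1)^m`, where `𝒪(-1)` is
the tautological subbundle of the trivial bundle with fibre `ℂ ^ (m + 1)`: there is a surjective
morphism of holomorphic vector bundles `σ^* T_Y → 𝒪(-1)^m` with kernel the tangent bundle of
`ℙ^m`. -/
def NormalBundleIsTautSum {E Y : Type} [NormedAddCommGroup E] [NormedSpace ℂ E]
    [TopologicalSpace Y] [ChartedSpace E Y] [IsManifold 𝓘(ℂ, E) ω Y] {m : ℕ}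
    (σ : CP m → Y) : Prop :=
  ∃ Θ : ∀ p : CP m, TangentSpace 𝓘(ℂ, E) (σ p) →L[ℂ] (Fin m → Fin (m + 1) → ℂ),
    (∀ p, Set.range (Θ p) = {A | ∀ k, A k ∈ p.submodule}) ∧
    (∀ p v, Θ p v = 0 ↔ ∃ u, mfderiv 𝓘(ℂ, Fin m → ℂ) 𝓘(ℂ, E) σ p u = v) ∧
    ∀ p₀, ContMDiffAt 𝓘(ℂ, Fin m → ℂ) 𝓘(ℂ, E →L[ℂ] (Fin m → Fin (m + 1) → ℂ)) ω
      (inTangentCoordinates 𝓘(ℂ, E) 𝓘(ℂ, Fin m → Fin (m + 1) → ℂ) σ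
        (fun _ => (0 : Fin m → Fin (m + 1) → ℂ)) Θ p₀) p₀

end FanoBlowUp

end

open FanoBlowUp

open scoped Manifold ContDiff Topology LinearAlgebra.Projectivization

noncomputable section

namespace FanoBlowUp

/-! ### Spaces covered by monomial coordinate systems -/

/-! Both `Y` and its blow-up are smooth projective toric varieties, and everything needed about them
is read off from Cox-type homogeneous coordinates. `ToricCover` records this: affine charts, and
families of homogeneous coordinates whose entries are monomials in each chart. For `Y` the families
are `x_a` (base) and `t, x_a v_k` (fibre). The blow-up is modelled by `XSpace`, the incidence
variety of pairs of a point of `Y` and a line of `ℂ ^ m` containing its projection `v`. It has one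
more family, the coordinates `q_k` of this line.

A multidegree `n` defines a line bundle, `ToricCover.bundle`. If all `n r` are positive, its
monomials give a Segre–Veronese embedding (`isAmple_of_isIso`). Chart changes are multiplicative, so
their Jacobians are determined by the values at the unit of the torus and by the product of the
coordinates. Hence the anticanonical bundle is the bundle of that multidegree for which the
logarithmic volume form is balanced (`anticanonical_isIso`). The degrees are 1 in `x_a` and `m + 1`
in the fibre family on `Y`. On the blow-up they are `m - 1` in `q_k`, `m` in `x_a` and 2 in the
fibre family. This gives the Fano property.

The pseudo-index is bounded below by one section, the product of the powers `s_r ^ (n r)` of the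
coordinates distinguished by a chart that meets the curve. Pulled back to `ℙ¹` it is a non-zero
section of `𝒪(d)`. If `d ≤ 0` it has no zeros, so the curve lies in an affine chart and is constant
(`one_le_degree`). If every `n r` is at least 2, all its zeros are multiple, which excludes `d = 1`
(`two_le_degree`). Torus-invariant curves attain the bounds (`mem_rationalCurveDegrees`): the lines
in `Z` for `Y`, the fibres over `ℙ^m × ℙ^(m-1)` for `m ≥ 3`, and for `m = 2` a line in a fibre of
the exceptional divisor.

It remains to see that `XSpace` satisfies the universal property (`isBlowUp_pt`), since then every
blow-up is biholomorphic to it (`IsBlowUp.exists_equiv`). Where the ideal of `Z` pulls back to an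
ideal generated by `h₀`, the fibre coordinates are `a_l * h₀`. The functions `a_l` have no common
zero because `h₀` is bounded by the fibre coordinates, so `[a]` supplies the missing direction. For
the projection itself, a function vanishing on `Z` pulls back to one vanishing on a coordinate
hyperplane, and is divisible by that coordinate.

The normal bundle is computed from the functions `x_a v_k / t`. They vanish on `Z`, and their
differentials there take values in the tautological line. -/

/-- A set `M` covered by copies `χ i` of `ℂ ^ κ`, together with homogeneous coordinate vectors
`s r x`, well defined up to a scalar, whose entries are monomials on each `χ i`, the entry `β i r`
being normalized to `1`. The coordinates of `χ i` are quotients of homogeneous coordinates. -/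
structure ToricCover (M ι κ R : Type) (B : R → Type) [Fintype κ] where
  s : ∀ r, M → B r → ℂ
  β : ι → ∀ r, B r
  χ : ι → (κ → ℂ) → M
  mon : ι → ∀ r, B r → (κ → ℂ) → ℂ
  contDiff_mon : ∀ i r b, ContDiff ℂ ω (mon i r b)
  mon_mul : ∀ i r b z z', mon i r b (z * z') = mon i r b z * mon i r b z'
  mon_one : ∀ i r b, mon i r b 1 = 1
  mon_β : ∀ i r z, mon i r (β i r) z = 1
  s_χ : ∀ i z r, ∃ c : ℂ, c ≠ 0 ∧ ∀ b, s r (χ i z) b = c * mon i r b z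
  num : ι → κ → Σ r, B r
  mon_num : ∀ i c z, mon i (num i c).1 (num i c).2 z = z c
  surj : ∀ i x, (∀ r, s r x (β i r) ≠ 0) → ∃ z, χ i z = x
  cover : ∀ x, ∃ i z, χ i z = x ∧ ‖z‖ ≤ 1

namespace ToricCover

variable {M ι κ R : Type} {B : R → Type} [Fintype κ] (D : ToricCover M ι κ R B)

/-- The image of the `i`-th coordinate system. -/
def U (i : ι) : Set M := {x | ∀ r, D.s r x (D.β i r) ≠ 0}

/-- The coordinates on `U i`. -/
def ψ (i : ι) (x : M) : κ → ℂ := fun c =>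
  D.s (D.num i c).1 x (D.num i c).2 / D.s (D.num i c).1 x (D.β i (D.num i c).1)

theorem s_χ_div (i : ι) (z : κ → ℂ) (r : R) (b b' : B r) :
    D.s r (D.χ i z) b / D.s r (D.χ i z) b' = D.mon i r b z / D.mon i r b' z := by
  obtain ⟨c, hc, h⟩ := D.s_χ i z r
  rw [h, h, mul_div_mul_left _ _ hc]

theorem s_χ_ne_zero_iff (i : ι) (z : κ → ℂ) (r : R) (b : B r) :
    D.s r (D.χ i z) b ≠ 0 ↔ D.mon i r b z ≠ 0 := by
  obtain ⟨c, hc, h⟩ := D.s_χ i z r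
  simp [h, hc]

theorem χ_mem (i : ι) (z : κ → ℂ) : D.χ i z ∈ D.U i := fun r => by
  rw [s_χ_ne_zero_iff, D.mon_β]
  exact one_ne_zero

theorem ψ_χ' (i j : ι) (z : κ → ℂ) (c : κ) : D.ψ j (D.χ i z) c =
    D.mon i (D.num j c).1 (D.num j c).2 z / D.mon i (D.num j c).1 (D.β j (D.num j c).1) z :=
  D.s_χ_div _ _ _ _ _

@[simp]
theorem ψ_χ (i : ι) (z : κ → ℂ) : D.ψ i (D.χ i z) = z := by
  funext c
  rw [ψ_χ', D.mon_num, D.mon_β, div_one]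

theorem χ_ψ {i : ι} {x : M} (hx : x ∈ D.U i) : D.χ i (D.ψ i x) = x := by
  obtain ⟨z, rfl⟩ := D.surj i x hx
  rw [ψ_χ]

theorem s_div {i : ι} {x : M} (hx : x ∈ D.U i) (r : R) (b b' : B r) :
    D.s r x b / D.s r x b' = D.mon i r b (D.ψ i x) / D.mon i r b' (D.ψ i x) := by
  obtain ⟨z, rfl⟩ := D.surj i x hx
  rw [s_χ_div, ψ_χ]

theorem s_ne_zero_iff {i : ι} {x : M} (hx : x ∈ D.U i) (r : R) (b : B r) :
    D.s r x b ≠ 0 ↔ D.mon i r b (D.ψ i x) ≠ 0 := by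
  obtain ⟨z, rfl⟩ := D.surj i x hx
  rw [s_χ_ne_zero_iff, ψ_χ]

theorem exists_mem_U (x : M) : ∃ i, x ∈ D.U i := by
  obtain ⟨i, z, rfl, -⟩ := D.cover x
  exact ⟨i, D.χ_mem i z⟩

theorem ext_of_ratio {x y : M} {i : ι} (hx : x ∈ D.U i) (hy : y ∈ D.U i)
    (h : ∀ r b, D.s r x b / D.s r x (D.β i r) = D.s r y b / D.s r y (D.β i r)) : x = y := by
  rw [← D.χ_ψ hx, ← D.χ_ψ hy]
  congr 1
  funext c
  exact h _ _

/-- Homogeneous coordinates separate points. The scalars need not be assumed non-zero: a zero scalar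
would kill the distinguished entry in a chart containing `x`. -/
theorem ext_of_smul {x y : M} (h : ∀ r, ∃ c : ℂ, ∀ b, D.s r x b = c * D.s r y b) : x = y := by
  obtain ⟨i, hx⟩ := D.exists_mem_U x
  choose c hc using h
  have hc0 : ∀ r, c r ≠ 0 := fun r h0 => hx r (by rw [hc, h0, zero_mul])
  have hy : y ∈ D.U i := fun r h0 => hx r (by rw [hc, h0, mul_zero])
  refine D.ext_of_ratio hx hy fun r b => ?_
  rw [hc, hc, mul_div_mul_left _ _ (hc0 r)]

/-- A chart change is a quotient of monomials, hence multiplicative. This holds even outside the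
overlap, since division by zero gives zero on both sides. -/
theorem ψ_χ_mul (i j : ι) (z z' : κ → ℂ) :
    D.ψ j (D.χ i (z * z')) = D.ψ j (D.χ i z) * D.ψ j (D.χ i z') := by
  funext c
  simp only [Pi.mul_apply, ψ_χ', D.mon_mul, mul_div_mul_comm]

/-- Every monomial is 1 at the point `(1, …, 1)`, so the charts share the unit of the torus. It
makes `M` connected, and it is the base point at which Jacobians are compared. -/
theorem χ_one_eq (i j : ι) : D.χ i 1 = D.χ j 1 := by
  refine D.ext_of_smul fun r => ?_
  obtain ⟨c, hc, h⟩ := D.s_χ i 1 r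
  obtain ⟨c', hc', h'⟩ := D.s_χ j 1 r
  exact ⟨c / c', fun b => by rw [h, h', D.mon_one, D.mon_one]; field_simp⟩

/-- The `i`-th coordinate system as a partial equivalence with the model space `E`. -/
def chart {E : Type} [NormedAddCommGroup E] [NormedSpace ℂ E] (l : E ≃L[ℂ] (κ → ℂ)) (i : ι) :
    PartialEquiv M E where
  source := D.U i
  target := Set.univ
  toFun x := l.symm (D.ψ i x)
  invFun z := D.χ i (l z)
  map_source' _ _ := Set.mem_univ _
  map_target' z _ := D.χ_mem i (l z)
  left_inv' x hx := by rw [l.apply_symm_apply, D.χ_ψ hx]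
  right_inv' z _ := by rw [ψ_χ, l.symm_apply_apply]

theorem chart_trans_source [Finite R] {E : Type} [NormedAddCommGroup E] [NormedSpace ℂ E]
    (l : E ≃L[ℂ] (κ → ℂ)) (i j : ι) :
    ((D.chart l i).symm.trans (D.chart l j)).source =
      ⋂ r, {z | D.mon i r (D.β j r) (l z) ≠ 0} := by
  ext z
  rw [PartialEquiv.trans_source]
  simp only [chart, PartialEquiv.symm_source, Set.univ_inter, Set.mem_preimage, Set.mem_iInter,
    PartialEquiv.coe_symm_mk, U, Set.mem_ofPred_eq]
  exact forall_congr' fun r => D.s_χ_ne_zero_iff _ _ _ _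

/-- The holomorphic atlas given by a cover by monomial coordinate systems. -/
def holAtlas [Finite R] {E : Type} [NormedAddCommGroup E] [NormedSpace ℂ E]
    (l : E ≃L[ℂ] (κ → ℂ)) : HolAtlas E M ι where
  chart := D.chart l
  idx x := (D.exists_mem_U x).choose
  mem_idx x := (D.exists_mem_U x).choose_spec
  isOpen_overlap i j := by
    rw [chart_trans_source]
    exact isOpen_iInter_of_finite fun r =>
      isOpen_ne_fun ((D.contDiff_mon i r _).continuous.comp l.continuous) continuous_const
  holo i j := by
    rw [chart_trans_source]
    have hf : ⇑((D.chart l i).symm.trans (D.chart l j)) = fun z => l.symm fun c =>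
        D.mon i (D.num j c).1 (D.num j c).2 (l z) /
          D.mon i (D.num j c).1 (D.β j (D.num j c).1) (l z) := by
      funext z
      exact congrArg l.symm (funext fun c => D.ψ_χ' _ _ _ _)
    rw [hf]
    refine l.symm.contDiff.comp_contDiffOn (contDiffOn_pi.2 fun c => ?_)
    exact ((D.contDiff_mon _ _ _).comp l.contDiff).contDiffOn.div
      ((D.contDiff_mon _ _ _).comp l.contDiff).contDiffOn fun z hz => Set.mem_iInter.1 hz _

/-! ### Covers by holomorphic coordinate systems -/

/-- The coordinate systems `χ i` and the quotients of homogeneous coordinates are holomorphic. -/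
structure IsHolo (F : Type) [NormedAddCommGroup F] [NormedSpace ℂ F] [TopologicalSpace M]
    [ChartedSpace F M] : Prop where
  contMDiff_χ : ∀ i, ContMDiff 𝓘(ℂ, κ → ℂ) 𝓘(ℂ, F) ω (D.χ i)
  isOpen_ne : ∀ r b, IsOpen {x | D.s r x b ≠ 0}
  contMDiffOn_ratio : ∀ r b b', ContMDiffOn 𝓘(ℂ, F) 𝓘(ℂ) ω (fun x => D.s r x b / D.s r x b')
    {x | D.s r x b' ≠ 0}

theorem _root_.FanoBlowUp.HolAtlas.contMDiffOn_chart_symm {E M ι : Type} [NormedAddCommGroup E]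
    [NormedSpace ℂ E] (A : HolAtlas E M ι) (i : ι) :
    letI := A.core.toTopologicalSpace
    letI := A.core.toChartedSpace
    ContMDiffOn 𝓘(ℂ, E) 𝓘(ℂ, E) ω (A.chart i).symm (A.chart i).target := by
  let := A.core.toTopologicalSpace
  let := A.core.toChartedSpace
  have := A.isManifold
  exact contMDiffOn_symm_of_mem_maximalAtlas (I := 𝓘(ℂ, E)) (n := ω)
    (e := A.core.openPartialHomeomorph (A.chart i) (Set.mem_range_self i))
    (IsManifold.subset_maximalAtlas (Set.mem_iUnion₂.2 ⟨_, Set.mem_range_self i, rfl⟩))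

/-- Formulated for an arbitrary atlas with the same charts, so that it also covers projective space
and `Y`, whose manifold structures were not built from a `ToricCover`. -/
theorem isHolo_of_holAtlas [Finite R] {E : Type} [NormedAddCommGroup E] [NormedSpace ℂ E]
    (A : HolAtlas E M ι) (l : E ≃L[ℂ] (κ → ℂ)) (hsource : ∀ i, (A.chart i).source = D.U i)
    (htarget : ∀ i, (A.chart i).target = Set.univ)
    (hsymm : ∀ i z, (A.chart i).symm z = D.χ i (l z)) :
    letI := A.core.toTopologicalSpace
    letI := A.core.toChartedSpace
    D.IsHolo E := by
  let := A.core.toTopologicalSpace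
  let := A.core.toChartedSpace
  have hU : ∀ i, IsOpen (D.U i) := fun i => hsource i ▸ A.isOpen_source i
  have hψ : ∀ i, ContMDiffOn 𝓘(ℂ, E) 𝓘(ℂ, κ → ℂ) ω (D.ψ i) (D.U i) := by
    intro i
    have h := l.contDiff.contMDiff.comp_contMDiffOn (A.contMDiffOn_chart i)
    rw [hsource i] at h
    refine h.congr fun x hx => ?_
    have hx' : x ∈ (A.chart i).source := by rwa [hsource i]
    have := (A.chart i).left_inv hx'
    rw [hsymm] at this
    conv_lhs => rw [← this]
    rw [ψ_χ]
    rfl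
  -- Vanishing of a homogeneous coordinate is independent of the scalar, so it can be tested on the
  -- monomial in any chart.
  have hopen : ∀ r b, IsOpen {x | D.s r x b ≠ 0} := by
    intro r b
    have : {x | D.s r x b ≠ 0} = ⋃ i, D.U i ∩ (D.ψ i) ⁻¹' {z | D.mon i r b z ≠ 0} := by
      ext x
      simp only [Set.mem_iUnion, Set.mem_inter_iff, Set.mem_preimage, Set.mem_ofPred_eq]
      constructor
      · intro h
        obtain ⟨i, hi⟩ := D.exists_mem_U x
        exact ⟨i, hi, (D.s_ne_zero_iff hi r b).1 h⟩
      · rintro ⟨i, hi, h⟩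
        exact (D.s_ne_zero_iff hi r b).2 h
    rw [this]
    exact isOpen_iUnion fun i => (hψ i).continuousOn.isOpen_inter_preimage (hU i)
      (isOpen_ne_fun (D.contDiff_mon i r b).continuous continuous_const)
  refine ⟨fun i => ?_, hopen, fun r b b' => ?_⟩
  · have h := A.contMDiffOn_chart_symm i
    rw [htarget, contMDiffOn_univ] at h
    have h' := h.comp l.symm.contDiff.contMDiff
    convert! h' using 1
    funext z
    simp [hsymm]
  · intro x hx
    obtain ⟨i, hi⟩ := D.exists_mem_U x
    have h : ContMDiffOn 𝓘(ℂ, E) 𝓘(ℂ) ω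
        (fun x => D.mon i r b (D.ψ i x) / D.mon i r b' (D.ψ i x))
        (D.U i ∩ {x | D.s r x b' ≠ 0}) := by
      refine ContMDiffOn.div₀ ?_ ?_ ?_
      · exact ((D.contDiff_mon i r b).contMDiff.comp_contMDiffOn (hψ i)).mono Set.inter_subset_left
      · exact ((D.contDiff_mon i r b').contMDiff.comp_contMDiffOn (hψ i)).mono Set.inter_subset_left
      · exact fun x hx => (D.s_ne_zero_iff hx.1 r b').1 hx.2
    have h' := (h.congr fun x hx => D.s_div hx.1 r b b') x ⟨hi, hx⟩
    exact (h'.contMDiffAt (((hU i).inter (hopen r b')).mem_nhds ⟨hi, hx⟩)).contMDiffWithinAt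

theorem isHolo [Finite R] {E : Type} [NormedAddCommGroup E] [NormedSpace ℂ E]
    (l : E ≃L[ℂ] (κ → ℂ)) :
    letI := (D.holAtlas l).core.toTopologicalSpace
    letI := (D.holAtlas l).core.toChartedSpace
    D.IsHolo E :=
  D.isHolo_of_holAtlas (D.holAtlas l) l (fun _ => rfl) (fun _ => rfl) fun _ _ => rfl

namespace IsHolo

variable {D} {F : Type} [NormedAddCommGroup F] [NormedSpace ℂ F] [TopologicalSpace M]
  [ChartedSpace F M] (h : D.IsHolo F)
include h

theorem isOpen_U [Finite R] (i : ι) : IsOpen (D.U i) := by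
  have : D.U i = ⋂ r, {x | D.s r x (D.β i r) ≠ 0} := by ext; simp [U]
  rw [this]
  exact isOpen_iInter_of_finite fun r => h.isOpen_ne _ _

theorem contMDiffOn_ψ (i : ι) : ContMDiffOn 𝓘(ℂ, F) 𝓘(ℂ, κ → ℂ) ω (D.ψ i) (D.U i) :=
  contMDiffOn_pi_space.2 fun _ => (h.contMDiffOn_ratio _ _ _).mono fun _ hx => hx _

theorem contMDiffAt_ψ [Finite R] {i : ι} {x : M} (hx : x ∈ D.U i) :
    ContMDiffAt 𝓘(ℂ, F) 𝓘(ℂ, κ → ℂ) ω (D.ψ i) x :=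
  (h.contMDiffOn_ψ i).contMDiffAt ((h.isOpen_U i).mem_nhds hx)

theorem contMDiffAt_ratio {r : R} {b b' : B r} {x : M} (hx : D.s r x b' ≠ 0) :
    ContMDiffAt 𝓘(ℂ, F) 𝓘(ℂ) ω (fun x => D.s r x b / D.s r x b') x :=
  (h.contMDiffOn_ratio r b b').contMDiffAt ((h.isOpen_ne r b').mem_nhds hx)

/-- A map is holomorphic if the quotients of homogeneous coordinates are. -/
theorem contMDiffAt_of_ratio {G W : Type} [NormedAddCommGroup G] [NormedSpace ℂ G]
    [TopologicalSpace W] [ChartedSpace G W] {f : W → M} {w : W} (i : ι)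
    (hU : ∀ᶠ w' in 𝓝 w, f w' ∈ D.U i)
    (hr : ∀ r b, ContMDiffAt 𝓘(ℂ, G) 𝓘(ℂ) ω (fun w' => D.s r (f w') b / D.s r (f w') (D.β i r)) w) :
    ContMDiffAt 𝓘(ℂ, G) 𝓘(ℂ, F) ω f w := by
  have h1 : ContMDiffAt 𝓘(ℂ, G) 𝓘(ℂ, κ → ℂ) ω (fun w' => D.ψ i (f w')) w :=
    contMDiffAt_pi_space.2 fun c => hr _ _
  refine ((h.contMDiff_χ i).contMDiffAt.comp w h1).congr_of_eventuallyEq ?_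
  filter_upwards [hU] with w' hw'
  exact (D.χ_ψ hw').symm

theorem contDiffOn_ψ_symm [IsManifold 𝓘(ℂ, F) ω M] (e : OpenPartialHomeomorph M F)
    (he : e ∈ atlas F M) (i : ι) :
    ContDiffOn ℂ ω (D.ψ i ∘ e.symm) (e.target ∩ e.symm ⁻¹' D.U i) :=
  contMDiffOn_iff_contDiffOn.1 <| (h.contMDiffOn_ψ i).comp ((contMDiffOn_symm_of_mem_maximalAtlas
    (IsManifold.subset_maximalAtlas he)).mono Set.inter_subset_left) fun _ hz => hz.2

/-! ### Compactness, connectedness and the Hausdorff property -/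

theorem compactSpace [Finite ι] : CompactSpace M := by
  refine ⟨?_⟩
  have : (Set.univ : Set M) = ⋃ i, D.χ i '' Metric.closedBall 0 1 := by
    symm
    rw [Set.eq_univ_iff_forall]
    intro x
    obtain ⟨i, z, hz, hz'⟩ := D.cover x
    exact Set.mem_iUnion.2 ⟨i, z, by simpa using hz', hz⟩
  rw [this]
  -- The bound `‖z‖ ≤ 1` in the field `cover` is there for this: finitely many closed polydiscs
  -- cover `M`.
  exact isCompact_iUnion fun i =>
    (isCompact_closedBall _ _).image (h.contMDiff_χ i).continuous

theorem connectedSpace (i₀ : ι) : ConnectedSpace M := by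
  refine connectedSpace_iff_univ.2 ⟨⟨D.χ i₀ 1, trivial⟩, ?_⟩
  have : (Set.univ : Set M) = ⋃ i, Set.range (D.χ i) := by
    symm
    rw [Set.eq_univ_iff_forall]
    intro x
    obtain ⟨i, z, hz, -⟩ := D.cover x
    exact Set.mem_iUnion.2 ⟨i, z, hz⟩
  rw [this]
  refine isPreconnected_iUnion ⟨D.χ i₀ 1, Set.mem_iInter.2 fun i => ?_⟩ fun i =>
    isPreconnected_range (h.contMDiff_χ i).continuous
  exact ⟨1, D.χ_one_eq i i₀⟩

/-- Each vector of homogeneous coordinates is replaced by the matrix of the orthogonal projection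
onto the line that it spans. The matrix does not depend on the scalar and determines the line, so it
gives a continuous injection into a Hausdorff space. -/
theorem t2Space [Finite R] [∀ r, Fintype (B r)] : T2Space M := by
  let f : M → ∀ r, B r → B r → ℂ := fun x r b b' =>
    D.s r x b * star (D.s r x b') / ∑ a, D.s r x a * star (D.s r x a)
  have hsum : ∀ x r, ∑ a, D.s r x a * star (D.s r x a) ≠ 0 := by
    intro x r
    obtain ⟨i, hi⟩ := D.exists_mem_U x
    have h1 : ∑ a, D.s r x a * star (D.s r x a) = ((∑ a, ‖D.s r x a‖ ^ 2 : ℝ) : ℂ) := by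
      push_cast
      exact Finset.sum_congr rfl fun a _ => Complex.mul_conj' _
    rw [h1, Complex.ofReal_ne_zero]
    refine (Finset.sum_pos' (fun _ _ => by positivity) ⟨D.β i r, Finset.mem_univ _, ?_⟩).ne'
    have := hi r
    positivity
  refine T2Space.of_injective_continuous (f := f) ?_ ?_
  · intro x y hxy
    refine D.ext_of_smul fun r => ?_
    obtain ⟨i, hi⟩ := D.exists_mem_U x
    refine ⟨(∑ a, D.s r x a * star (D.s r x a)) / (∑ a, D.s r y a * star (D.s r y a)) *
      star (D.s r y (D.β i r)) / star (D.s r x (D.β i r)), fun b => ?_⟩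
    have e := congrFun (congrFun (congrFun hxy r) b) (D.β i r)
    have h1 := hsum x r
    have h2 := hsum y r
    have h3 : star (D.s r x (D.β i r)) ≠ 0 := star_ne_zero.2 (hi r)
    simp only [f] at e
    rw [div_eq_div_iff h1 h2] at e
    rw [div_mul_eq_mul_div, eq_div_iff h3, div_mul_eq_mul_div, div_mul_eq_mul_div, eq_div_iff h2]
    linear_combination e
  · rw [continuous_iff_continuousAt]
    intro x
    obtain ⟨i, hi⟩ := D.exists_mem_U x
    refine continuousAt_pi.2 fun r => continuousAt_pi.2 fun b => continuousAt_pi.2 fun b' => ?_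
    have hc : ∀ b, ContinuousAt (fun x => D.s r x b / D.s r x (D.β i r)) x := fun b =>
      (h.contMDiffAt_ratio (hi r)).continuousAt
    -- The vector `s r` itself need not vary continuously with the point. Dividing by the
    -- distinguished entry leaves the projection unchanged and makes every ingredient continuous.
    have key : ∀ x', D.s r x' (D.β i r) ≠ 0 → f x' r b b' =
        (D.s r x' b / D.s r x' (D.β i r)) * star (D.s r x' b' / D.s r x' (D.β i r)) /
        ∑ a, (D.s r x' a / D.s r x' (D.β i r)) * star (D.s r x' a / D.s r x' (D.β i r)) := by
      intro x' hx'
      have h3 : star (D.s r x' (D.β i r)) ≠ 0 := star_ne_zero.2 hx'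
      simp only [f, star_div₀, div_mul_div_comm]
      rw [← Finset.sum_div, div_div_div_cancel_right₀ (mul_ne_zero hx' h3)]
    refine ContinuousAt.congr ?_ (Filter.Eventually.mono
      ((h.isOpen_ne r (D.β i r)).mem_nhds (hi r)) fun x' hx' => (key x' hx').symm)
    refine ((hc b).mul (hc b').star).div (tendsto_finsetSum _ fun a _ => (hc a).mul (hc a).star) ?_
    intro h0
    have h3 : star (D.s r x (D.β i r)) ≠ 0 := star_ne_zero.2 (hi r)
    simp only [star_div₀, div_mul_div_comm] at h0
    rw [← Finset.sum_div, div_eq_zero_iff] at h0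
    exact h0.elim (hsum x r) (mul_ne_zero (hi r) h3)

end IsHolo

end ToricCover

/-! ### Isomorphisms of line bundles -/

namespace LineBundle

variable {E E' M M' : Type} [NormedAddCommGroup E] [NormedSpace ℂ E]
  [NormedAddCommGroup E'] [NormedSpace ℂ E']
  [TopologicalSpace M] [ChartedSpace E M] [TopologicalSpace M'] [ChartedSpace E' M']
  {L L' L'' : LineBundle E M}

theorem g_ne_zero (L : LineBundle E M) {i j : L.ι} {x : M} (hi : x ∈ L.U i) (hj : x ∈ L.U j) :
    L.g i j x ≠ 0 := fun h0 => by
  have := L.cocycle i j i x ⟨⟨hi, hj⟩, hi⟩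
  rw [h0, mul_zero, L.g_self i x hi] at this
  exact zero_ne_one this

theorem IsIso.symm (h : L.IsIso L') : L'.IsIso L := by
  obtain ⟨t, ht, h0, hc⟩ := h
  refine ⟨fun a i x => (t i a x)⁻¹, fun a i => ?_, fun a i x hx => inv_ne_zero (h0 i a x hx.symm),
    fun a b i j x hx => ?_⟩
  · rw [Set.inter_comm]
    exact (ht i a).inv₀ (h0 i a)
  · have h1 := h0 i a x ⟨hx.2.1, hx.1.1⟩
    have h2 := h0 j b x ⟨hx.2.2, hx.1.2⟩
    have := hc i j a b x hx.symm
    field_simp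
    linear_combination -this

/-- The two isomorphisms are composed through a trivialization of `L'` chosen separately at each
point. The choice is not continuous, but `key` shows that the product does not depend on it, and
holomorphy follows by fixing the choice locally. -/
theorem IsIso.trans (h : L.IsIso L') (h' : L'.IsIso L'') : L.IsIso L'' := by
  obtain ⟨t, ht, h0, hc⟩ := h
  obtain ⟨t', ht', h0', hc'⟩ := h'
  choose α hα using L'.cover
  have key : ∀ i c a x, x ∈ L.U i ∩ L''.U c → x ∈ L'.U a →
      t' (α x) c x * t i (α x) x = t' a c x * t i a x := by
    intro i c a x hx ha
    have h1 := hc i i (α x) a x ⟨⟨hx.1, hx.1⟩, hα x, ha⟩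
    have h2 := hc' (α x) a c c x ⟨⟨hα x, ha⟩, hx.2, hx.2⟩
    rw [L.g_self i x hx.1, mul_one] at h1
    rw [L''.g_self c x hx.2, one_mul] at h2
    rw [h1, ← h2]
    ring
  refine ⟨fun i c x => t' (α x) c x * t i (α x) x, fun i c x hx => ?_, fun i c x hx =>
    mul_ne_zero (h0' _ _ _ ⟨hα x, hx.2⟩) (h0 _ _ _ ⟨hx.1, hα x⟩), fun i j b d x hx => ?_⟩
  · have hopen : IsOpen (L.U i ∩ L''.U c ∩ L'.U (α x)) :=
      ((L.isOpen_U i).inter (L''.isOpen_U c)).inter (L'.isOpen_U _)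
    have h1 : ContMDiffOn 𝓘(ℂ, E) 𝓘(ℂ) ω (fun x' => t' (α x) c x' * t i (α x) x')
        (L.U i ∩ L''.U c ∩ L'.U (α x)) :=
      ((ht' _ _).mono fun y hy => ⟨hy.2, hy.1.2⟩).mul ((ht _ _).mono fun y hy => ⟨hy.1.1, hy.2⟩)
    have h2 := h1.congr fun y hy => key i c (α x) y hy.1 hy.2
    exact (h2.contMDiffAt (hopen.mem_nhds ⟨hx, hα x⟩)).contMDiffWithinAt
  · have h1 := hc i j (α x) (α x) x ⟨hx.1, hα x, hα x⟩
    have h2 := hc' (α x) (α x) b d x ⟨⟨hα x, hα x⟩, hx.2⟩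
    rw [L'.g_self _ x (hα x)] at h1 h2
    rw [mul_assoc, h1, one_mul, ← mul_assoc, ← h2, mul_one]

theorem IsIso.pullback (h : L.IsIso L') (f : M' → M) (hf : ContMDiff 𝓘(ℂ, E') 𝓘(ℂ, E) ω f) :
    (L.pullback f hf).IsIso (L'.pullback f hf) := by
  obtain ⟨t, ht, h0, hc⟩ := h
  exact ⟨fun i a x => t i a (f x), fun i a => (ht i a).comp hf.contMDiffOn fun _ hx => hx,
    fun i a x hx => h0 i a (f x) hx, fun i j a b x hx => hc i j a b (f x) hx⟩

/-- Sections of isomorphic line bundles correspond to each other. -/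
theorem IsIso.exists_transfer (h : L.IsIso L') :
    ∃ u : L.ι → L'.ι → M → ℂ,
      (∀ i a, ContMDiffOn 𝓘(ℂ, E) 𝓘(ℂ) ω (u i a) (L.U i ∩ L'.U a)) ∧
      (∀ i a, ∀ x ∈ L.U i ∩ L'.U a, u i a x ≠ 0) ∧
      ∀ s', L'.IsSection s' → ∃ s, L.IsSection s ∧
        ∀ i a, ∀ x ∈ L.U i ∩ L'.U a, s i x = u i a x * s' a x := by
  obtain ⟨t, ht, h0, hc⟩ := h.symm
  choose α hα using L'.cover
  refine ⟨fun i a => t a i, fun i a => by rw [Set.inter_comm]; exact ht a i,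
    fun i a x hx => h0 a i x hx.symm, fun s' hs' => ?_⟩
  have key : ∀ i a x, x ∈ L.U i → x ∈ L'.U a →
      t (α x) i x * s' (α x) x = t a i x * s' a x := by
    intro i a x hx ha
    have h1 := hc (α x) a i i x ⟨⟨hα x, ha⟩, hx, hx⟩
    rw [L.g_self i x hx, one_mul] at h1
    rw [hs'.2 (α x) a x ⟨hα x, ha⟩, ← h1]
    ring
  refine ⟨fun i x => t (α x) i x * s' (α x) x, ⟨fun i x hx => ?_, fun i j x hx => ?_⟩,
    fun i a x hx => key i a x hx.1 hx.2⟩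
  · have h1 : ContMDiffOn 𝓘(ℂ, E) 𝓘(ℂ) ω (fun x' => t (α x) i x' * s' (α x) x')
        (L.U i ∩ L'.U (α x)) :=
      ((ht _ _).mono fun y hy => ⟨hy.2, hy.1⟩).mul ((hs'.1 _).mono fun y hy => hy.2)
    have h2 := h1.congr fun y hy => key i (α x) y hy.1 hy.2
    exact (h2.contMDiffAt (((L.isOpen_U i).inter (L'.isOpen_U _)).mem_nhds
      ⟨hx, hα x⟩)).contMDiffWithinAt
  · have h1 := hc (α x) (α x) i j x ⟨⟨hα x, hα x⟩, hx⟩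
    rw [L'.g_self _ x (hα x), mul_one] at h1
    simp only [h1, mul_assoc]

end LineBundle

/-! ### Projective space -/

/-- The standard cover of projective space by affine spaces. -/
def CP.toricCover (N : ℕ) :
    ToricCover (CP N) (Fin (N + 1)) (Fin N) Unit (fun _ => Fin (N + 1)) where
  s _ p := p.rep
  β i _ := i
  χ i z := (CP.chart N i).symm z
  mon i _ b z := (i.insertNth (1 : ℂ) z : Fin (N + 1) → ℂ) b
  contDiff_mon i _ b := contDiff_insertNth i b
  mon_mul i _ b z z' := by
    refine Fin.succAboveCases i ?_ (fun k => ?_) b <;> simp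
  mon_one i _ b := by
    refine Fin.succAboveCases i ?_ (fun k => ?_) b <;> simp
  mon_β i _ z := by simp
  s_χ i z _ := by
    obtain ⟨c, hc⟩ := Projectivization.exists_smul_eq_mk_rep ℂ _ (insertNth_ne_zero i z)
    exact ⟨c, c.ne_zero, fun b => (congrFun hc b).symm⟩
  num i c := ⟨(), i.succAbove c⟩
  mon_num i c z := by simp
  surj i p hp := ⟨CP.chart N i p, (CP.chart N i).left_inv (hp ())⟩
  cover p := by
    obtain ⟨i, hi⟩ := Finite.exists_max fun i => ‖p.rep i‖
    have h0 : p.rep i ≠ 0 := by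
      obtain ⟨j, hj⟩ := exists_rep_ne_zero p
      exact norm_pos_iff.1 ((norm_pos_iff.2 hj).trans_le (hi j))
    refine ⟨i, CP.chart N i p, (CP.chart N i).left_inv h0,
      (pi_norm_le_iff_of_nonneg zero_le_one).2 fun c => ?_⟩
    change ‖p.rep (i.succAbove c) / p.rep i‖ ≤ 1
    rw [norm_div]
    exact div_le_one_of_le₀ (hi _) (norm_nonneg _)

theorem CP.isHolo (N : ℕ) : (CP.toricCover N).IsHolo (Fin N → ℂ) :=
  (CP.toricCover N).isHolo_of_holAtlas (CP.holAtlas N) (ContinuousLinearEquiv.refl ℂ _)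
    (fun i => by ext p; simp [CP.holAtlas, CP.chart, ToricCover.U, CP.toricCover])
    (fun _ => rfl) (fun _ _ => rfl)

instance (N : ℕ) : T2Space (CP N) := (CP.isHolo N).t2Space

instance (N : ℕ) : CompactSpace (CP N) := (CP.isHolo N).compactSpace

/-- A map to projective space is holomorphic if the quotients of its homogeneous coordinates
are. -/
theorem CP.contMDiffAt_of_ratio {G W : Type} [NormedAddCommGroup G] [NormedSpace ℂ G]
    [TopologicalSpace W] [ChartedSpace G W] {N : ℕ} {f : W → CP N} {v : W → Fin (N + 1) → ℂ}
    {hv : ∀ w, v w ≠ 0} (hf : ∀ w, f w = Projectivization.mk ℂ (v w) (hv w)) {w : W}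
    (i : Fin (N + 1)) (h0 : ∀ᶠ w' in 𝓝 w, v w' i ≠ 0)
    (hr : ∀ a, ContMDiffAt 𝓘(ℂ, G) 𝓘(ℂ) ω (fun w' => v w' a / v w' i) w) :
    ContMDiffAt 𝓘(ℂ, G) 𝓘(ℂ, Fin N → ℂ) ω f w := by
  refine (CP.isHolo N).contMDiffAt_of_ratio i ?_ fun _ a => ?_
  · filter_upwards [h0] with w' hw' _
    change (f w').rep i ≠ 0
    rwa [hf, rep_mk_ne_zero_iff]
  · refine (hr a).congr_of_eventuallyEq (Filter.Eventually.of_forall fun w' => ?_)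
    change (f w').rep a / (f w').rep i = _
    rw [hf, rep_mk_ratio]

/-! ### Line bundles given by homogeneous coordinates -/

namespace ToricCover

variable {M ι κ R : Type} {B : R → Type} [Fintype κ] [Fintype R] (D : ToricCover M ι κ R B)

/-- The homogeneous monomial with factors `s r (J r l)`. -/
def form {n : R → ℕ} (J : ∀ r, Fin (n r) → B r) (x : M) : ℂ := ∏ r, ∏ l, D.s r x (J r l)

theorem form_div (n : R → ℕ) (J : ∀ r, Fin (n r) → B r) (i : ι) (x : M) :
    ∏ r, ∏ l, D.s r x (J r l) / D.s r x (D.β i r) =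
      ((D.form fun r (_ : Fin (n r)) => D.β i r) x)⁻¹ * D.form J x := by
  rw [inv_mul_eq_div, form, form, ← Finset.prod_div_distrib]
  refine Finset.prod_congr rfl fun r _ => ?_
  rw [← Finset.prod_div_distrib]

theorem form_β_ne_zero_iff {n : R → ℕ} (hn : ∀ r, 0 < n r) (i : ι) (x : M) :
    (D.form fun r (_ : Fin (n r)) => D.β i r) x ≠ 0 ↔ x ∈ D.U i := by
  simp only [form, Finset.prod_const, Finset.card_univ, Fintype.card_fin]
  rw [Finset.prod_ne_zero_iff]
  exact ⟨fun h r => (pow_ne_zero_iff (hn r).ne').1 (h r (Finset.mem_univ r)),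
    fun h r _ => pow_ne_zero _ (h r)⟩

-- The coordinate is a quotient of two entries of one family. Padding numerator and denominator with
-- distinguished entries makes both monomials of multidegree `n`; positivity of `n r` leaves room
-- for the replaced factor.
open Classical in
theorem ψ_eq_form_div {n : R → ℕ} (hn : ∀ r, 0 < n r) {i : ι} {x : M} (hx : x ∈ D.U i) (c : κ) :
    D.ψ i x c = D.form (fun r => Function.update (fun _ : Fin (n r) => D.β i r) ⟨0, hn r⟩
      (if hr : (D.num i c).1 = r then hr ▸ (D.num i c).2 else D.β i r)) x /
      (D.form fun r (_ : Fin (n r)) => D.β i r) x := by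
  rw [div_eq_inv_mul, ← form_div]
  rw [Finset.prod_eq_single (D.num i c).1]
  · rw [Finset.prod_eq_single ⟨0, hn _⟩]
    · simp [ψ]
    · intro l _ hl
      rw [Function.update_of_ne hl, div_self (hx _)]
    · simp
  · intro r _ hr
    refine Finset.prod_eq_one fun l _ => ?_
    rw [dif_neg hr.symm, Function.update_eq_self_iff.2 rfl, div_self (hx _)]
  · simp

variable {F : Type} [NormedAddCommGroup F] [NormedSpace ℂ F] [TopologicalSpace M] [ChartedSpace F M]

/-- The line bundle whose sections are the homogeneous forms of degree `n r` in the coordinates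
`s r`. -/
def bundle (h : D.IsHolo F) (n : R → ℕ) : LineBundle F M where
  ι := ι
  U := D.U
  isOpen_U := h.isOpen_U
  cover := D.exists_mem_U
  g i j x := ∏ r, (D.s r x (D.β i r) / D.s r x (D.β j r)) ^ n r
  holo i j := contMDiffOn_finsetProd fun r _ =>
    ((h.contMDiffOn_ratio r _ _).mono fun x hx => hx.2 r).pow _
  g_self i x hx := Finset.prod_eq_one fun r _ => by rw [div_self (hx r), one_pow]
  cocycle i j k x hx := by
    rw [← Finset.prod_mul_distrib]
    refine Finset.prod_congr rfl fun r _ => ?_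
    rw [← mul_pow, mul_comm, div_mul_div_cancel₀ (hx.1.2 r)]

theorem isSection_form (h : D.IsHolo F) {n : R → ℕ} (J : ∀ r, Fin (n r) → B r) :
    (D.bundle h n).IsSection
      (fun i x => ∏ r, ∏ l, D.s r x (J r l) / D.s r x (D.β i r)) := by
  refine ⟨fun i => contMDiffOn_finsetProd fun r _ => contMDiffOn_finsetProd fun l _ =>
    (h.contMDiffOn_ratio r _ _).mono fun x hx => hx r, fun i j x hx => ?_⟩
  change _ = (∏ r, (D.s r x (D.β i r) / D.s r x (D.β j r)) ^ n r) * _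
  rw [← Finset.prod_mul_distrib]
  refine Finset.prod_congr rfl fun r _ => ?_
  have : (D.s r x (D.β i r) / D.s r x (D.β j r)) ^ n r =
      ∏ _l : Fin (n r), (D.s r x (D.β i r) / D.s r x (D.β j r)) := by
    rw [Finset.prod_const, Finset.card_univ, Fintype.card_fin]
  rw [this, ← Finset.prod_mul_distrib]
  refine Finset.prod_congr rfl fun l _ => ?_
  rw [mul_comm, div_mul_div_cancel₀ (hx.1 r)]

/-- The map given by all monomials of multidegree `n` is a Segre–Veronese embedding. On the preimage
of a standard affine set of projective space the chart coordinates of `M` are recovered as ratios of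
monomials, which gives injectivity and a holomorphic left inverse near each image point. -/
theorem isAmple_of_isIso [Finite ι] [∀ r, Fintype (B r)] (h : D.IsHolo F) {n : R → ℕ}
    (hn : ∀ r, 0 < n r) (i₀ : ι) {L : LineBundle F M} (hL : L.IsIso (D.bundle h n)) :
    L.IsAmple := by
  classical
  let J := ∀ r, Fin (n r) → B r
  have : Nonempty J := ⟨fun r _ => D.β i₀ r⟩
  obtain ⟨N, hN⟩ := Nat.exists_eq_succ_of_ne_zero (Fintype.card_ne_zero (α := J))
  let eJ : Fin (N + 1) ≃ J := (Fintype.equivFinOfCardEq hN).symm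
  have := h.compactSpace
  obtain ⟨u, -, hu0, hu⟩ := hL.exists_transfer
  choose s hs hsu using fun a => hu _ (D.isSection_form h (eJ a))
  let v : M → Fin (N + 1) → ℂ := fun x a => D.form (eJ a) x
  have hvβ : ∀ i x, v x (eJ.symm fun r _ => D.β i r) =
      (D.form fun r (_ : Fin (n r)) => D.β i r) x := fun i x => by simp [v]
  have hv : ∀ x, v x ≠ 0 := fun x h0 => by
    obtain ⟨i, hi⟩ := D.exists_mem_U x
    exact (D.form_β_ne_zero_iff hn i x).2 hi (by rw [← hvβ, h0]; rfl)
  let φ : M → CP N := fun x => Projectivization.mk ℂ (v x) (hv x)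
  have hφ : ContMDiff 𝓘(ℂ, F) 𝓘(ℂ, Fin N → ℂ) ω φ := fun x => by
    obtain ⟨i, hi⟩ := D.exists_mem_U x
    refine CP.contMDiffAt_of_ratio (v := v) (hv := hv) (fun _ => rfl)
      (eJ.symm fun r _ => D.β i r) ?_ fun a => ?_
    · filter_upwards [(h.isOpen_U i).mem_nhds hi] with x' hx'
      rw [hvβ]
      exact (D.form_β_ne_zero_iff hn i x').2 hx'
    · have h1 := ((D.isSection_form h (eJ a)).1 i).contMDiffAt ((h.isOpen_U i).mem_nhds hi)
      refine h1.congr_of_eventuallyEq (Filter.Eventually.of_forall fun x' => ?_)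
      simp only [hvβ]
      rw [form_div, div_eq_inv_mul]
  -- the coordinates of `M` as functions on projective space
  have hcoord : ∀ i, ∃ G : CP N → κ → ℂ, (∀ p, p.rep (eJ.symm fun r _ => D.β i r) ≠ 0 →
      ContMDiffAt 𝓘(ℂ, Fin N → ℂ) 𝓘(ℂ, κ → ℂ) ω G p) ∧ ∀ x ∈ D.U i, G (φ x) = D.ψ i x := by
    intro i
    refine ⟨fun p c => p.rep (eJ.symm (fun r => Function.update (fun _ : Fin (n r) => D.β i r)
      ⟨0, hn r⟩ (if hr : (D.num i c).1 = r then hr ▸ (D.num i c).2 else D.β i r))) /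
      p.rep (eJ.symm fun r _ => D.β i r), fun p hp => contMDiffAt_pi_space.2 fun c =>
      (CP.contMDiffOn_ratio _ _).contMDiffAt ((CP.isOpen_source _).mem_nhds hp), fun x hx => ?_⟩
    funext c
    rw [D.ψ_eq_form_div hn hx]
    simp only [φ]
    rw [rep_mk_ratio, hvβ]
    simp [v]
  have hrep : ∀ i x, (φ x).rep (eJ.symm fun r _ => D.β i r) ≠ 0 ↔ x ∈ D.U i := fun i x => by
    rw [rep_mk_ne_zero_iff, hvβ, D.form_β_ne_zero_iff hn]
  -- The bundle is already very ample, so the first tensor power serves.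
  refine ⟨1, one_pos, N, s, φ, fun a => ⟨(hs a).1, fun i j x hx => ?_⟩, fun i x hx => ?_, hφ,
    ?_, fun x => ?_⟩
  · change _ = L.g i j x ^ 1 * _
    rw [pow_one]
    exact (hs a).2 i j x hx
  · obtain ⟨j, hj⟩ := D.exists_mem_U x
    have hc : u i j x * ((D.form fun r (_ : Fin (n r)) => D.β j r) x)⁻¹ ≠ 0 :=
      mul_ne_zero (hu0 i j x ⟨hx, hj⟩) (inv_ne_zero ((D.form_β_ne_zero_iff hn j x).2 hj))
    have hsv : (fun a => s a i x) =
        (u i j x * ((D.form fun r (_ : Fin (n r)) => D.β j r) x)⁻¹) • v x := by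
      funext a
      rw [hsu a i j x ⟨hx, hj⟩, form_div, ← mul_assoc]
      rfl
    refine ⟨by rw [hsv]; exact smul_ne_zero hc (hv x), ?_⟩
    rw [Projectivization.mk_eq_mk_iff']
    refine ⟨(u i j x * ((D.form fun r (_ : Fin (n r)) => D.β j r) x)⁻¹)⁻¹, ?_⟩
    rw [hsv, smul_smul, inv_mul_cancel₀ hc, one_smul]
  -- The source is compact and the target Hausdorff, so only injectivity has to be checked.
  · refine hφ.continuous.isClosedEmbedding fun x y hxy => ?_
    obtain ⟨i, hi⟩ := D.exists_mem_U x
    obtain ⟨G, -, hG⟩ := hcoord i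
    have hy : y ∈ D.U i := (hrep i y).1 (hxy ▸ (hrep i x).2 hi)
    rw [← D.χ_ψ hi, ← D.χ_ψ hy, ← hG x hi, ← hG y hy, hxy]
  · obtain ⟨i, hi⟩ := D.exists_mem_U x
    obtain ⟨G, hG, hGφ⟩ := hcoord i
    have h1 : ContMDiffAt 𝓘(ℂ, Fin N → ℂ) 𝓘(ℂ, F) ω (D.χ i ∘ G) (φ x) :=
      (h.contMDiff_χ i).contMDiffAt.comp _ (hG _ ((hrep i x).2 hi))
    -- A holomorphic left inverse near `φ x` makes the differential injective.
    have h2 : (D.χ i ∘ G) ∘ φ =ᶠ[𝓝 x] id := by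
      filter_upwards [(h.isOpen_U i).mem_nhds hi] with y hy
      simp only [Function.comp_apply, hGφ y hy, D.χ_ψ hy, id]
    have h3 := mfderiv_comp x (h1.mdifferentiableAt (by simp)) ((hφ x).mdifferentiableAt (by simp))
    rw [h2.mfderiv_eq, mfderiv_id] at h3
    intro v w hvw
    have := congrArg (mfderiv 𝓘(ℂ, Fin N → ℂ) 𝓘(ℂ, F) (D.χ i ∘ G) (φ x)) hvw
    have e : ∀ v, (mfderiv 𝓘(ℂ, Fin N → ℂ) 𝓘(ℂ, F) (D.χ i ∘ G) (φ x))
        (mfderiv 𝓘(ℂ, F) 𝓘(ℂ, Fin N → ℂ) φ x v) = v := fun v =>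
      (DFunLike.congr_fun h3 v).symm
    rwa [e, e] at this

end ToricCover

/-! ### The anticanonical bundle in monomial coordinates -/

/-- Multiplication by `a` on each coordinate. -/
def diagCLM {κ : Type} [Fintype κ] (a : κ → ℂ) : (κ → ℂ) →L[ℂ] (κ → ℂ) :=
  ContinuousLinearMap.pi fun c => a c • ContinuousLinearMap.proj c

theorem diagCLM_apply {κ : Type} [Fintype κ] (a z : κ → ℂ) : diagCLM a z = a * z := by
  funext c
  simp [diagCLM]

theorem det_diagCLM {κ : Type} [Fintype κ] (a : κ → ℂ) : (diagCLM a).det = ∏ c, a c := by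
  classical
  rw [← Matrix.det_diagonal, ← LinearMap.det_toLin']
  change LinearMap.det _ = LinearMap.det _
  congr 1
  refine LinearMap.ext fun z => ?_
  change diagCLM a z = _
  rw [diagCLM_apply, Matrix.toLin'_apply]
  funext c
  simp [Matrix.mulVec_diagonal]

theorem clm_det_comp {V : Type} [NormedAddCommGroup V] [NormedSpace ℂ V] (A A' : V →L[ℂ] V) :
    (A.comp A').det = A.det * A'.det :=
  LinearMap.det_comp _ _

/-- The Jacobian determinant of a multiplicative map. -/
theorem det_fderiv_mul_prod {κ : Type} [Fintype κ] {f : (κ → ℂ) → κ → ℂ}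
    (hmul : ∀ z z', f (z * z') = f z * f z') {a : κ → ℂ} (ha : DifferentiableAt ℂ f a)
    (h1 : DifferentiableAt ℂ f 1) :
    (fderiv ℂ f a).det * ∏ c, a c = (∏ c, f a c) * (fderiv ℂ f 1).det := by
  -- The function `z ↦ f (a * z) = f a * f z` is differentiated at `1` in two ways, and the
  -- determinants are compared.
  have hl : HasFDerivAt (fun z => f (a * z)) ((fderiv ℂ f a).comp (diagCLM a)) 1 := by
    have e : (fun z => f (a * z)) = f ∘ diagCLM a := by
      funext z
      simp [diagCLM_apply]
    rw [e]
    refine HasFDerivAt.comp 1 ?_ (diagCLM a).hasFDerivAt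
    rw [diagCLM_apply, mul_one]
    exact ha.hasFDerivAt
  have hr : HasFDerivAt (fun z => f (a * z)) ((diagCLM (f a)).comp (fderiv ℂ f 1)) 1 := by
    have e : (fun z => f (a * z)) = diagCLM (f a) ∘ f := by
      funext z
      simp [diagCLM_apply, hmul]
    rw [e]
    exact (diagCLM (f a)).hasFDerivAt.comp 1 h1.hasFDerivAt
  have := congrArg ContinuousLinearMap.det (hl.unique hr)
  rwa [clm_det_comp, clm_det_comp, det_diagCLM, det_diagCLM] at this

theorem dense_forall_ne_zero (κ : Type) : Dense {z : κ → ℂ | ∀ c, z c ≠ 0} := by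
  have : {z : κ → ℂ | ∀ c, z c ≠ 0} = Set.pi Set.univ fun _ => {0}ᶜ := by
    ext z
    simp
  rw [this]
  exact dense_pi _ fun c _ => dense_compl_singleton 0

namespace ToricCover

variable {M ι κ R : Type} {B : R → Type} [Fintype κ] {D : ToricCover M ι κ R B}

theorem contDiffAt_transition {i j : ι} {z : κ → ℂ} (hz : D.χ i z ∈ D.U j) :
    ContDiffAt ℂ ω (fun z => D.ψ j (D.χ i z)) z := by
  refine contDiffAt_pi.2 fun c => ?_
  simp only [ψ_χ']
  exact (D.contDiff_mon _ _ _).contDiffAt.div (D.contDiff_mon _ _ _).contDiffAt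
    ((D.s_χ_ne_zero_iff _ _ _ _).1 (hz _))

variable [Fintype R]

/-- The identity that makes the logarithmic volume form a section of the dual of the
anticanonical bundle with values in the forms of degree `n`. -/
def IsAnticanonicalDegree (D : ToricCover M ι κ R B) (n : R → ℕ) : Prop :=
  ∀ i j, ∀ x ∈ D.U i ∩ D.U j, (∏ c, D.ψ i x c) * ∏ r, D.s r x (D.β i r) ^ n r =
    (∏ c, D.ψ j x c) * ∏ r, D.s r x (D.β j r) ^ n r

/-- On the torus, multiplicativity reduces the Jacobian to its value at the unit times a ratio of
coordinate products, and the volume identity converts that ratio into the cocycle of degree `n`.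
Both sides are continuous on the overlap and the torus is dense in it. -/
theorem det_transition {n : R → ℕ} (hvol : D.IsAnticanonicalDegree n) {i j : ι} {z : κ → ℂ}
    (hz : D.χ i z ∈ D.U j) :
    (fderiv ℂ (fun z => D.ψ j (D.χ i z)) z).det =
      (fderiv ℂ (fun z => D.ψ j (D.χ i z)) 1).det *
        ∏ r, (D.s r (D.χ i z) (D.β i r) / D.s r (D.χ i z) (D.β j r)) ^ n r := by
  have hU : ∀ z, D.χ i z ∈ D.U j ↔ ∀ r, D.mon i r (D.β j r) z ≠ 0 := fun z =>
    forall_congr' fun r => D.s_χ_ne_zero_iff _ _ _ _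
  have hopen : IsOpen {z | D.χ i z ∈ D.U j} := by
    have : {z | D.χ i z ∈ D.U j} = ⋂ r, {z | D.mon i r (D.β j r) z ≠ 0} := by
      ext z
      simp [hU]
    rw [this]
    exact isOpen_iInter_of_finite fun r =>
      isOpen_ne_fun (D.contDiff_mon i r _).continuous continuous_const
  have hsmooth : ContDiffOn ℂ ω (fun z => D.ψ j (D.χ i z)) {z | D.χ i z ∈ D.U j} :=
    fun z hz => (contDiffAt_transition hz).contDiffWithinAt
  have hone : D.χ i 1 ∈ D.U j := D.χ_one_eq i j ▸ D.χ_mem j 1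
  have hleft : ContinuousOn (fun z => (fderiv ℂ (fun z => D.ψ j (D.χ i z)) z).det)
      {z | D.χ i z ∈ D.U j} :=
    contDiff_clm_det.continuous.comp_continuousOn
      (hsmooth.continuousOn_fderiv_of_isOpen hopen (by simp))
  have hright : ContinuousOn (fun z => (fderiv ℂ (fun z => D.ψ j (D.χ i z)) 1).det *
        ∏ r, (D.s r (D.χ i z) (D.β i r) / D.s r (D.χ i z) (D.β j r)) ^ n r)
      {z | D.χ i z ∈ D.U j} := by
    refine continuousOn_const.mul (continuousOn_finsetProd _ fun r _ => ContinuousOn.pow ?_ _)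
    simp only [s_χ_div]
    exact (D.contDiff_mon _ _ _).continuous.continuousOn.div
      (D.contDiff_mon _ _ _).continuous.continuousOn fun z hz => (hU z).1 hz r
  have heq : Set.EqOn (fun z => (fderiv ℂ (fun z => D.ψ j (D.χ i z)) z).det)
      (fun z => (fderiv ℂ (fun z => D.ψ j (D.χ i z)) 1).det *
        ∏ r, (D.s r (D.χ i z) (D.β i r) / D.s r (D.χ i z) (D.β j r)) ^ n r)
      ({z | D.χ i z ∈ D.U j} ∩ {z | ∀ c, z c ≠ 0}) := by
    rintro z ⟨hz, hz0⟩
    have h1 := det_fderiv_mul_prod (D.ψ_χ_mul i j)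
      ((contDiffAt_transition hz).differentiableAt (by simp))
      ((contDiffAt_transition hone).differentiableAt (by simp))
    have h2 := hvol i j (D.χ i z) ⟨D.χ_mem i z, hz⟩
    have h3 : ∏ c, z c ≠ 0 := Finset.prod_ne_zero_iff.2 fun c _ => hz0 c
    have h4 : ∏ r, D.s r (D.χ i z) (D.β j r) ^ n r ≠ 0 :=
      Finset.prod_ne_zero_iff.2 fun r _ => pow_ne_zero _ (hz r)
    rw [ψ_χ] at h2
    simp only [div_pow, Finset.prod_div_distrib]
    rw [mul_div_assoc', eq_div_iff h4]
    refine mul_right_cancel₀ h3 ?_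
    linear_combination (∏ r, D.s r (D.χ i z) (D.β j r) ^ n r) * h1 -
      (fderiv ℂ (fun z => D.ψ j (D.χ i z)) 1).det * h2
  exact heq.of_subset_closure hleft hright Set.inter_subset_left
    ((dense_forall_ne_zero κ).open_subset_closure_inter hopen) hz

namespace IsHolo

variable {F : Type} [NormedAddCommGroup F] [NormedSpace ℂ F] [TopologicalSpace M]
  [ChartedSpace F M] (h : D.IsHolo F)
include h

/-- The model space `F` is arbitrary, because a blow-up is allowed any model. The differential of a
chart at the unit identifies it with `κ → ℂ`, so that Jacobians become determinants of
endomorphisms. -/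
theorem exists_continuousLinearEquiv (i : ι) : Nonempty ((κ → ℂ) ≃L[ℂ] F) := by
  have hψ : MDifferentiableAt 𝓘(ℂ, F) 𝓘(ℂ, κ → ℂ) (D.ψ i) (D.χ i 1) :=
    (h.contMDiffAt_ψ (D.χ_mem i 1)).mdifferentiableAt (by simp)
  have hχ : MDifferentiableAt 𝓘(ℂ, κ → ℂ) 𝓘(ℂ, F) (D.χ i) 1 :=
    (h.contMDiff_χ i 1).mdifferentiableAt (by simp)
  have h1 : D.ψ i ∘ D.χ i = id := funext fun z => D.ψ_χ i z
  have h2 : D.χ i ∘ D.ψ i =ᶠ[𝓝 (D.χ i 1)] id := by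
    filter_upwards [(h.isOpen_U i).mem_nhds (D.χ_mem i 1)] with x hx
    exact D.χ_ψ hx
  have e1 := mfderiv_comp 1 hψ hχ
  have hχ' : MDifferentiableAt 𝓘(ℂ, κ → ℂ) 𝓘(ℂ, F) (D.χ i) (D.ψ i (D.χ i 1)) := by rwa [ψ_χ]
  have e2 := mfderiv_comp (D.χ i 1) hχ' hψ
  rw [h1, mfderiv_id] at e1
  rw [h2.mfderiv_eq, mfderiv_id] at e2
  let a : (κ → ℂ) →L[ℂ] F := mfderiv 𝓘(ℂ, κ → ℂ) 𝓘(ℂ, F) (D.χ i) 1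
  let b : F →L[ℂ] (κ → ℂ) := mfderiv 𝓘(ℂ, F) 𝓘(ℂ, κ → ℂ) (D.ψ i) (D.χ i 1)
  have e2' : ∀ v : F, a (b v) = v := by
    have e3 : ∀ w, w = 1 → ∀ v, (mfderiv 𝓘(ℂ, κ → ℂ) 𝓘(ℂ, F) (D.χ i) w : (κ → ℂ) →L[ℂ] F) v =
        a v := by
      rintro _ rfl v
      rfl
    exact fun v => (e3 _ (D.ψ_χ i 1) _).symm.trans (DFunLike.congr_fun e2 v).symm
  exact ⟨ContinuousLinearEquiv.equivOfInverse a b (fun v => (DFunLike.congr_fun e1 v).symm) e2'⟩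

theorem isOpen_ψ_symm (e : OpenPartialHomeomorph M F) (i : ι) :
    IsOpen (e.target ∩ e.symm ⁻¹' D.U i) :=
  e.symm.continuousOn.isOpen_inter_preimage e.open_target (h.isOpen_U i)

variable [FiniteDimensional ℂ F] [IsManifold 𝓘(ℂ, F) ω M]

/-- The anticanonical bundle is the bundle of forms of the anticanonical degree. -/
theorem anticanonical_isIso {n : R → ℕ} (hvol : D.IsAnticanonicalDegree n) (i₀ : ι) :
    (anticanonical F M).IsIso (D.bundle h n) := by
  obtain ⟨A⟩ := h.exists_continuousLinearEquiv i₀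
  let dψ : atlas F M → ι → M → F →L[ℂ] (κ → ℂ) := fun e i x =>
    fderiv ℂ (D.ψ i ∘ e.1.symm) (e.1 x)
  -- The Jacobians of the chart changes at the unit are constants in the cocycle of the
  -- anticanonical bundle. Comparison with the reference chart `i₀` writes them as a coboundary,
  -- which is absorbed into the isomorphism.
  let ε : ι → ℂ := fun i => (fderiv ℂ (fun z => D.ψ i₀ (D.χ i z)) 1).det
  have hmem : ∀ (e : atlas F M) i x, x ∈ e.1.source → x ∈ D.U i →
      e.1 x ∈ e.1.target ∩ e.1.symm ⁻¹' D.U i := fun e i x hx hi =>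
    ⟨e.1.map_source hx, by simpa [e.1.left_inv hx] using hi⟩
  have hdiff : ∀ (e : atlas F M) i x, x ∈ e.1.source → x ∈ D.U i →
      DifferentiableAt ℂ (D.ψ i ∘ e.1.symm) (e.1 x) := fun e i x hx hi =>
    ((h.contDiffOn_ψ_symm e.1 e.2 i).contDiffAt ((h.isOpen_ψ_symm e.1 i).mem_nhds
      (hmem e i x hx hi))).differentiableAt (by simp)
  -- change of the coordinate system of the cover
  have hchain : ∀ (e : atlas F M) i j x, x ∈ e.1.source → x ∈ D.U i → x ∈ D.U j →
      dψ e j x = (fderiv ℂ (fun z => D.ψ j (D.χ i z)) (D.ψ i x)).comp (dψ e i x) := by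
    intro e i j x hx hi hj
    have hz : D.χ i (D.ψ i x) ∈ D.U j := by rwa [D.χ_ψ hi]
    have hd : DifferentiableAt ℂ (fun z => D.ψ j (D.χ i z)) ((D.ψ i ∘ e.1.symm) (e.1 x)) := by
      rw [Function.comp_apply, e.1.left_inv hx]
      exact (contDiffAt_transition hz).differentiableAt (by simp)
    have h1 := fderiv_comp (e.1 x) hd (hdiff e i x hx hi)
    rw [Function.comp_apply, e.1.left_inv hx] at h1
    rw [← h1]
    refine Filter.EventuallyEq.fderiv_eq ?_
    filter_upwards [(h.isOpen_ψ_symm e.1 i).mem_nhds (hmem e i x hx hi)] with z hz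
    simp only [Function.comp_apply, D.χ_ψ hz.2]
  -- change of the chart of the manifold
  have hchart : ∀ (e e' : atlas F M) i x, x ∈ e.1.source → x ∈ e'.1.source → x ∈ D.U i →
      (dψ e' i x).comp ((tangentBundleCore 𝓘(ℂ, F) M).coordChange e e' x) = dψ e i x := by
    intro e e' i x hx hx' hi
    have hg : (tangentBundleCore 𝓘(ℂ, F) M).coordChange e e' x =
        fderiv ℂ (e'.1 ∘ e.1.symm) (e.1 x) := by
      simp [tangentBundleCore_coordChange, mfld_simps]
    have hmem' : e.1 x ∈ e.1.target ∩ e.1.symm ⁻¹' e'.1.source :=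
      ⟨e.1.map_source hx, by simpa [e.1.left_inv hx] using hx'⟩
    have hopen' : IsOpen (e.1.target ∩ e.1.symm ⁻¹' e'.1.source) :=
      e.1.symm.continuousOn.isOpen_inter_preimage e.1.open_target e'.1.open_source
    have hd' : DifferentiableAt ℂ (e'.1 ∘ e.1.symm) (e.1 x) := by
      have h1 : ContMDiffOn 𝓘(ℂ, F) 𝓘(ℂ, F) ω (e'.1 ∘ e.1.symm)
          (e.1.target ∩ e.1.symm ⁻¹' e'.1.source) :=
        (contMDiffOn_of_mem_maximalAtlas (IsManifold.subset_maximalAtlas e'.2)).comp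
          ((contMDiffOn_symm_of_mem_maximalAtlas
          (IsManifold.subset_maximalAtlas e.2)).mono Set.inter_subset_left) fun _ hz => hz.2
      exact ((contMDiffOn_iff_contDiffOn.1 h1).contDiffAt
        (hopen'.mem_nhds hmem')).differentiableAt (by simp)
    have hd : DifferentiableAt ℂ (D.ψ i ∘ e'.1.symm) ((e'.1 ∘ e.1.symm) (e.1 x)) := by
      rw [Function.comp_apply, e.1.left_inv hx]
      exact hdiff e' i x hx' hi
    have h1 := fderiv_comp (e.1 x) hd hd'
    rw [Function.comp_apply, e.1.left_inv hx] at h1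
    rw [hg]
    refine h1.symm.trans (Filter.EventuallyEq.fderiv_eq ?_)
    filter_upwards [hopen'.mem_nhds hmem'] with z hz
    simp only [Function.comp_apply, e'.1.left_inv hz.2]
  have hε : ∀ i j, ε j * (fderiv ℂ (fun z => D.ψ j (D.χ i z)) 1).det = ε i := by
    intro i j
    have h1 : D.ψ j (D.χ i 1) = 1 := by rw [D.χ_one_eq i j, ψ_χ]
    have hm : ∀ i j, D.χ i 1 ∈ D.U j := fun i j => D.χ_one_eq i j ▸ D.χ_mem j 1
    have hd : DifferentiableAt ℂ (fun z => D.ψ i₀ (D.χ j z)) (D.ψ j (D.χ i 1)) := by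
      rw [h1]
      exact (contDiffAt_transition (hm j i₀)).differentiableAt (by simp)
    have hd' : DifferentiableAt ℂ (fun z => D.ψ j (D.χ i z)) 1 :=
      (contDiffAt_transition (hm i j)).differentiableAt (by simp)
    have h2 := fderiv_comp (1 : κ → ℂ) hd hd'
    have h3 : (fun z => D.ψ i₀ (D.χ j z)) ∘ (fun z => D.ψ j (D.χ i z)) =ᶠ[𝓝 1]
        fun z => D.ψ i₀ (D.χ i z) := by
      have : ∀ᶠ z in 𝓝 (1 : κ → ℂ), D.χ i z ∈ D.U j :=
        (h.contMDiff_χ i).continuous.continuousAt.eventually ((h.isOpen_U j).mem_nhds (hm i j))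
      filter_upwards [this] with z hz
      simp only [Function.comp_apply, D.χ_ψ hz]
    rw [h3.fderiv_eq, h1] at h2
    change (fderiv ℂ (fun z => D.ψ i₀ (D.χ j z)) 1).det * _ = (fderiv ℂ _ 1).det
    rw [h2, clm_det_comp]
  have hε0 : ∀ i, ε i ≠ 0 := fun i h0 => by
    have h1 := hε i₀ i
    have h2 : ε i₀ = 1 := by
      have : (fun z => D.ψ i₀ (D.χ i₀ z)) = id := funext fun z => D.ψ_χ i₀ z
      simp only [ε, this, fderiv_id]
      exact LinearMap.det_id
    rw [h0, zero_mul, h2] at h1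
    exact zero_ne_one h1
  refine ⟨fun e i x => ε i * ((A : (κ → ℂ) →L[ℂ] F).comp (dψ e i x)).det, fun e i => ?_,
    fun e i x hx => mul_ne_zero (hε0 i) ?_, fun e e' i j x hx => ?_⟩
  · have h1 : ContDiffOn ℂ ω (fun z => (A : (κ → ℂ) →L[ℂ] F).comp
        (fderiv ℂ (D.ψ i ∘ e.1.symm) z)) (e.1.target ∩ e.1.symm ⁻¹' D.U i) :=
      contDiffOn_const.clm_comp
        ((h.contDiffOn_ψ_symm e.1 e.2 i).fderiv_of_isOpen (h.isOpen_ψ_symm e.1 i) (by simp))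
    have h2 := (contDiff_clm_det.comp_contDiffOn h1).contMDiffOn
    have h3 := h2.comp ((contMDiffOn_of_mem_maximalAtlas (I := 𝓘(ℂ, F)) (n := ω)
      (IsManifold.subset_maximalAtlas e.2)).mono Set.inter_subset_left)
      (fun x (hx : x ∈ e.1.source ∩ D.U i) => hmem e i x hx.1 hx.2)
    exact contMDiffOn_const.mul h3
  · intro h0
    have hx' : D.χ i (D.ψ i x) = x := D.χ_ψ hx.2
    -- The differential of the inverse coordinate change is a left inverse of `dψ e i x`, so the
    -- determinant cannot vanish.
    have hd : DifferentiableAt ℂ (e.1 ∘ D.χ i) ((D.ψ i ∘ e.1.symm) (e.1 x)) := by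
      rw [Function.comp_apply, e.1.left_inv hx.1]
      have h1 : ContMDiffAt 𝓘(ℂ, F) 𝓘(ℂ, F) ω e.1 (D.χ i (D.ψ i x)) := by
        rw [hx']
        exact contMDiffAt_of_mem_maximalAtlas (IsManifold.subset_maximalAtlas e.2) hx.1
      exact (contMDiffAt_iff_contDiffAt.1 (h1.comp _ (h.contMDiff_χ i _))).differentiableAt
        (by simp)
    have h1 := fderiv_comp (e.1 x) hd (hdiff e i x hx.1 hx.2)
    have h2 : (e.1 ∘ D.χ i) ∘ D.ψ i ∘ e.1.symm =ᶠ[𝓝 (e.1 x)] id := by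
      filter_upwards [(h.isOpen_ψ_symm e.1 i).mem_nhds (hmem e i x hx.1 hx.2)] with z hz
      simp only [Function.comp_apply, D.χ_ψ hz.2, e.1.right_inv hz.1, id]
    rw [h2.fderiv_eq, fderiv_id] at h1
    have h3 := congrArg ContinuousLinearMap.det
      (show ((fderiv ℂ (e.1 ∘ D.χ i) ((D.ψ i ∘ e.1.symm) (e.1 x))).comp
        (A.symm : F →L[ℂ] (κ → ℂ))).comp ((A : (κ → ℂ) →L[ℂ] F).comp (dψ e i x)) =
          ContinuousLinearMap.id ℂ F by
        rw [h1]
        ext v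
        simp [dψ])
    rw [clm_det_comp, h0, mul_zero] at h3
    exact zero_ne_one (h3.trans LinearMap.det_id)
  · obtain ⟨⟨hx1, hx2⟩, hi, hj⟩ := hx
    change ε j * _ * ((tangentBundleCore 𝓘(ℂ, F) M).coordChange e e' x).det =
      (∏ r, (D.s r x (D.β i r) / D.s r x (D.β j r)) ^ n r) * (ε i * _)
    rw [mul_assoc, ← clm_det_comp, ContinuousLinearMap.comp_assoc, hchart e e' j x hx1 hx2 hj,
      hchain e i j x hx1 hi hj]
    -- Conjugation by `A` turns the differential of a chart change into an endomorphism of `F`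
    -- without changing its determinant.
    have hconj : (A : (κ → ℂ) →L[ℂ] F).comp ((fderiv ℂ (fun z => D.ψ j (D.χ i z))
        (D.ψ i x)).comp (dψ e i x)) = ((A : (κ → ℂ) →L[ℂ] F).comp ((fderiv ℂ
        (fun z => D.ψ j (D.χ i z)) (D.ψ i x)).comp (A.symm : F →L[ℂ] (κ → ℂ)))).comp
        ((A : (κ → ℂ) →L[ℂ] F).comp (dψ e i x)) := by
      ext v
      simp
    have hdet : ((A : (κ → ℂ) →L[ℂ] F).comp ((fderiv ℂ
        (fun z => D.ψ j (D.χ i z)) (D.ψ i x)).comp (A.symm : F →L[ℂ] (κ → ℂ)))).det =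
        (fderiv ℂ (fun z => D.ψ j (D.χ i z)) (D.ψ i x)).det :=
      LinearMap.det_conj (fderiv ℂ (fun z => D.ψ j (D.χ i z)) (D.ψ i x) : (κ → ℂ) →ₗ[ℂ] (κ → ℂ))
        A.toLinearEquiv
    have hz : D.χ i (D.ψ i x) ∈ D.U j := by rwa [D.χ_ψ hi]
    rw [hconj, clm_det_comp, hdet, det_transition hvol hz, D.χ_ψ hi, ← hε i j]
    ring

end IsHolo

end ToricCover

/-! ### Sections of line bundles on the projective line -/

theorem tendsto_inv_cocompact : Filter.Tendsto (fun z : ℂ => z⁻¹) (Filter.cocompact ℂ) (𝓝 0) := by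
  rw [← Metric.cobounded_eq_cocompact]
  exact Filter.tendsto_inv₀_cobounded

theorem eventually_ne_zero_cocompact : ∀ᶠ z : ℂ in Filter.cocompact ℂ, z ≠ 0 := by
  rw [← Metric.cobounded_eq_cocompact]
  exact Bornology.eventually_ne_cobounded 0

/-- The pair is a section of `𝒪(-e)` in the two affine charts. The gluing gives `h₀` a finite limit
at infinity, so it is constant by Liouville. For `e > 0` the limit is 0 and the section vanishes;
for `e = 0` both functions equal the same constant. -/
theorem entire_eq_zero_or_ne_zero {h₀ h₁ : ℂ → ℂ} (e : ℕ) (d₀ : Differentiable ℂ h₀)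
    (d₁ : Differentiable ℂ h₁) (hglue : ∀ z, z ≠ 0 → h₀ z = z⁻¹ ^ e * h₁ z⁻¹) :
    (∀ z, h₀ z = 0 ∧ h₁ z = 0) ∨ ∀ z, h₀ z ≠ 0 ∧ h₁ z ≠ 0 := by
  have hlim : Filter.Tendsto h₀ (Filter.cocompact ℂ) (𝓝 (0 ^ e * h₁ 0)) := by
    have h1 : Filter.Tendsto (fun w : ℂ => w ^ e * h₁ w) (𝓝 0) (𝓝 (0 ^ e * h₁ 0)) :=
      ((continuous_id.pow e).mul d₁.continuous).tendsto 0
    refine (h1.comp tendsto_inv_cocompact).congr' ?_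
    filter_upwards [eventually_ne_zero_cocompact] with z hz
    exact (hglue z hz).symm
  have hconst := d₀.eq_const_of_tendsto_cocompact hlim
  have h0 : ∀ z, h₀ z = 0 ^ e * h₁ 0 := fun z => congrFun hconst z
  have h1 : ∀ w, w ≠ 0 → w ^ e * h₁ w = 0 ^ e * h₁ 0 := fun w hw => by
    rw [← h0 w⁻¹, hglue _ (inv_ne_zero hw), inv_inv]
  have h1' : ∀ w, w ^ e * h₁ w = 0 ^ e * h₁ 0 := fun w => by
    by_cases hw : w = 0
    · rw [hw]
    · exact h1 w hw
  by_cases he : e = 0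
  · subst he
    simp only [pow_zero, one_mul] at h0 h1'
    by_cases hz : h₁ 0 = 0
    · exact Or.inl fun z => ⟨(h0 z).trans hz, (h1' z).trans hz⟩
    · exact Or.inr fun z => ⟨fun h => hz ((h0 z).symm.trans h), fun h => hz ((h1' z).symm.trans h)⟩
  · left
    have hz : ∀ w, w ≠ 0 → h₁ w = 0 := fun w hw => by
      have := h1' w
      rw [zero_pow he, zero_mul] at this
      exact (mul_eq_zero.1 this).resolve_left (pow_ne_zero _ hw)
    have hz' : h₁ = fun _ => 0 :=
      Continuous.ext_on (dense_compl_singleton 0) d₁.continuous continuous_const hz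
    exact fun z => ⟨by rw [h0, zero_pow he, zero_mul], congrFun hz' z⟩

/-- The pair is a section of `𝒪(1)`. The slope of `h₀` at 0 is entire with a limit at infinity,
hence constant, and so `h₀` is affine. A non-constant affine function has a simple zero, and a
non-zero constant one gives a section with a simple zero at infinity. -/
theorem entire_eq_zero_of_double_zeros {h₀ h₁ : ℂ → ℂ} (d₀ : Differentiable ℂ h₀)
    (d₁ : Differentiable ℂ h₁) (hglue : ∀ z, z ≠ 0 → h₀ z = z * h₁ z⁻¹)
    (hd₀ : ∀ z, h₀ z = 0 → deriv h₀ z = 0) (hd₁ : ∀ z, h₁ z = 0 → deriv h₁ z = 0) (z : ℂ) :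
    h₀ z = 0 ∧ h₁ z = 0 := by
  have hslope : Differentiable ℂ (dslope h₀ 0) :=
    differentiableOn_univ.1 ((Complex.differentiableOn_dslope Filter.univ_mem).2 d₀.differentiableOn)
  have hlim : Filter.Tendsto (dslope h₀ 0) (Filter.cocompact ℂ) (𝓝 (h₁ 0)) := by
    have h1 : Filter.Tendsto (fun w : ℂ => h₁ w - w * h₀ 0) (𝓝 0) (𝓝 (h₁ 0 - 0 * h₀ 0)) :=
      (d₁.continuous.sub (continuous_id.mul continuous_const)).tendsto 0
    rw [zero_mul, sub_zero] at h1
    refine (h1.comp tendsto_inv_cocompact).congr' ?_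
    filter_upwards [eventually_ne_zero_cocompact] with z hz
    rw [dslope_of_ne _ hz, slope_def_field, hglue z hz, Function.comp_apply]
    field_simp
    ring
  have hconst := hslope.eq_const_of_tendsto_cocompact hlim
  have h0 : ∀ z, h₀ z = h₀ 0 + h₁ 0 * z := fun z => by
    have h2 := sub_smul_dslope h₀ 0 z
    rw [hconst, Function.const_apply, smul_eq_mul] at h2
    linear_combination -h2
  have hder : ∀ z, deriv h₀ z = h₁ 0 := fun z => by
    have : h₀ = fun z => h₀ 0 + h₁ 0 * z := funext h0
    rw [this]
    simp
  have e1 : h₁ 0 = 0 := by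
    by_contra hne
    refine hne ?_
    -- The derivative is evaluated at the root of the affine function `h₀`.
    rw [← hder (-h₀ 0 / h₁ 0)]
    refine hd₀ _ ?_
    rw [h0]
    field_simp
    ring
  have h1 : h₁ = fun w => h₀ 0 * w := by
    refine Continuous.ext_on (dense_compl_singleton 0) d₁.continuous (by fun_prop) fun w hw => ?_
    have hw' : w ≠ 0 := hw
    have h2 := hglue w⁻¹ (inv_ne_zero hw')
    rw [h0, e1, inv_inv] at h2
    field_simp at h2
    change h₁ w = h₀ 0 * w
    linear_combination -h2
  have e0 : h₀ 0 = 0 := by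
    have h2 := hd₁ 0 e1
    rw [h1] at h2
    simpa using h2
  exact ⟨by rw [h0, e0, e1]; simp, by rw [h1, e0]; simp⟩

theorem deriv_eq_zero_of_double_zero {h q k : ℂ → ℂ} {z : ℂ}
    (hh : h =ᶠ[𝓝 z] fun w => q w * (q w * k w)) (hq : DifferentiableAt ℂ q z)
    (hk : DifferentiableAt ℂ k z) (h0 : q z = 0) : deriv h z = 0 := by
  rw [hh.deriv_eq]
  have := (hq.hasDerivAt.mul (hq.hasDerivAt.mul hk.hasDerivAt)).deriv
  exact this.trans (by simp [h0])

/-- The affine lines in the projective line. -/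
def CP.line (a : Fin 2) (z : ℂ) : CP 1 := (CP.toricCover 1).χ a fun _ => z

theorem CP.contMDiff_line (a : Fin 2) :
    ContMDiff 𝓘(ℂ) 𝓘(ℂ, Fin 1 → ℂ) ω (CP.line a) :=
  ((CP.isHolo 1).contMDiff_χ a).comp (contDiff_pi.2 fun _ => contDiff_id).contMDiff

theorem CP.line_mem (a : Fin 2) (z : ℂ) : (CP.line a z).rep a ≠ 0 :=
  (CP.toricCover 1).χ_mem a (fun _ => z) ()

theorem CP.exists_line_eq (p : CP 1) : ∃ a z, CP.line a z = p := by
  obtain ⟨a, z, h, -⟩ := (CP.toricCover 1).cover p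
  refine ⟨a, z 0, ?_⟩
  rw [CP.line, ← h]
  congr 1
  funext c
  rw [Subsingleton.elim c 0]

theorem CP.line_ratio (z : ℂ) : (CP.line 0 z).rep 0 / (CP.line 0 z).rep 1 = z⁻¹ := by
  refine ((CP.toricCover 1).s_χ_div 0 (fun _ => z) () 0 1).trans ?_
  have h1 : (1 : Fin 2) = Fin.succAbove 0 0 := rfl
  simp only [CP.toricCover, h1]
  rw [Fin.insertNth_apply_same, Fin.insertNth_apply_succAbove, one_div]

theorem CP.line_zero_eq {z : ℂ} (hz : z ≠ 0) : CP.line 0 z = CP.line 1 z⁻¹ := by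
  have h1 : (CP.line 0 z).rep 1 ≠ 0 := fun h => by
    have := CP.line_ratio z
    rw [h, div_zero] at this
    exact hz (inv_eq_zero.1 this.symm)
  have hU : CP.line 0 z ∈ (CP.toricCover 1).U 1 := fun _ => h1
  rw [← (CP.toricCover 1).χ_ψ hU, CP.line]
  congr 1
  funext c
  rw [Subsingleton.elim c 0]
  exact CP.line_ratio z

theorem CP.line_injective (a : Fin 2) : Function.Injective (CP.line a) := fun z z' h => by
  have := congrArg ((CP.toricCover 1).ψ a) h
  rw [CP.line, CP.line, ToricCover.ψ_χ, ToricCover.ψ_χ] at this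
  exact congrFun this 0

instance : Infinite (CP 1) := Infinite.of_injective _ (CP.line_injective 0)

instance (N : ℕ) : ConnectedSpace (CP N) := (CP.isHolo N).connectedSpace 0

theorem CP.differentiable_section {d : ℤ} {τ : Fin 2 → CP 1 → ℂ} (hτ : (CP.twist 1 d).IsSection τ)
    (a : Fin 2) : Differentiable ℂ fun z => τ a (CP.line a z) := fun z => by
  have h1 := ((hτ.1 a).contMDiffAt ((CP.isOpen_source a).mem_nhds (CP.line_mem a z))).comp z
    (CP.contMDiff_line a z)
  exact (contMDiffAt_iff_contDiffAt.1 h1).differentiableAt (by simp)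

theorem CP.section_glue {d : ℤ} {τ : Fin 2 → CP 1 → ℂ} (hτ : (CP.twist 1 d).IsSection τ)
    {z : ℂ} (hz : z ≠ 0) : τ 1 (CP.line 1 z⁻¹) = z⁻¹ ^ d * τ 0 (CP.line 0 z) := by
  rw [← CP.line_zero_eq hz]
  have hm : CP.line 0 z ∈ (CP.twist 1 d).U (0 : Fin 2) ∩ (CP.twist 1 d).U (1 : Fin 2) :=
    ⟨CP.line_mem 0 z, by rw [CP.line_zero_eq hz]; exact CP.line_mem 1 z⁻¹⟩
  rw [hτ.2 (0 : Fin 2) (1 : Fin 2) _ hm]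
  change ((CP.line 0 z).rep 0 / (CP.line 0 z).rep 1) ^ d * _ = _
  rw [CP.line_ratio]

/-- A non-zero section of a line bundle of degree `d ≤ 0` on the projective line has no zeros. -/
theorem CP.section_ne_zero {d : ℤ} (hd : d ≤ 0) {τ : Fin 2 → CP 1 → ℂ}
    (hτ : (CP.twist 1 d).IsSection τ) {a : Fin 2} {z : ℂ} (h0 : τ a (CP.line a z) ≠ 0)
    (b : Fin 2) (w : ℂ) : τ b (CP.line b w) ≠ 0 := by
  obtain ⟨e, rfl⟩ : ∃ e : ℕ, d = -(e : ℤ) := ⟨d.natAbs, by omega⟩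
  have key := entire_eq_zero_or_ne_zero e (CP.differentiable_section hτ 0)
    (CP.differentiable_section hτ 1) fun z hz => by
      rw [CP.section_glue hτ hz, ← mul_assoc, zpow_neg, zpow_natCast,
        mul_inv_cancel₀ (pow_ne_zero _ (inv_ne_zero hz)), one_mul]
  rcases key with key | key
  · refine absurd ?_ h0
    match a with
    | 0 => exact (key z).1
    | 1 => exact (key z).2
  · match b with
    | 0 => exact (key w).1
    | 1 => exact (key w).2

/-- A section of a line bundle of degree `1` on the projective line without simple zeros is
zero. -/
theorem CP.section_eq_zero {τ : Fin 2 → CP 1 → ℂ} (hτ : (CP.twist 1 1).IsSection τ)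
    (hd : ∀ a z, τ a (CP.line a z) = 0 → deriv (fun z => τ a (CP.line a z)) z = 0)
    (a : Fin 2) (z : ℂ) : τ a (CP.line a z) = 0 := by
  have key := entire_eq_zero_of_double_zeros (CP.differentiable_section hτ 0)
    (CP.differentiable_section hτ 1) (fun z hz => by
      rw [CP.section_glue hτ hz, zpow_one, ← mul_assoc, mul_inv_cancel₀ hz, one_mul])
    (hd 0) (hd 1) z
  match a with
  | 0 => exact key.1
  | 1 => exact key.2

/-! ### Degrees of rational curves -/

namespace ToricCover.IsHolo

variable {M ι κ R : Type} {B : R → Type} [Fintype κ] [Fintype R] {D : ToricCover M ι κ R B}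
  {F : Type} [NormedAddCommGroup F] [NormedSpace ℂ F] [TopologicalSpace M]
  [ChartedSpace F M] (h : D.IsHolo F)
include h

/-- The power product of the distinguished coordinates on `U i` as a section of `𝒪(d)`. -/
theorem exists_section_of_hasDegree {n : R → ℕ} {f : CP 1 → M}
    (hf : ContMDiff 𝓘(ℂ, Fin 1 → ℂ) 𝓘(ℂ, F) ω f) {d : ℤ}
    (hd : HasDegree ((D.bundle h n).pullback f hf) d) (i : ι) :
    ∃ (τ : Fin 2 → CP 1 → ℂ) (u : Fin 2 → ι → CP 1 → ℂ), (CP.twist 1 d).IsSection τ ∧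
      (∀ a j p, p.rep a ≠ 0 → f p ∈ D.U j →
        ContMDiffAt 𝓘(ℂ, Fin 1 → ℂ) 𝓘(ℂ) ω (u a j) p ∧ u a j p ≠ 0 ∧
        τ a p = u a j p * ∏ r, (D.s r (f p) (D.β i r) / D.s r (f p) (D.β j r)) ^ n r) := by
  obtain ⟨u, hu, hu0, hs⟩ := (LineBundle.IsIso.symm hd).exists_transfer
  have hsec := D.isSection_form h (n := n) fun r _ => D.β i r
  have hsec' : ((D.bundle h n).pullback f hf).IsSection
      (fun j p => ∏ r, ∏ _l : Fin (n r), D.s r (f p) (D.β i r) / D.s r (f p) (D.β j r)) :=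
    ⟨fun j => (hsec.1 j).comp hf.contMDiffOn fun _ hx => hx, fun j k p hp => hsec.2 j k (f p) hp⟩
  obtain ⟨τ, hτ, hτu⟩ := hs _ hsec'
  refine ⟨τ, u, hτ, fun a j p hp hj => ⟨?_, hu0 a j p ⟨hp, hj⟩, ?_⟩⟩
  · exact (hu a j).contMDiffAt (((CP.isOpen_source a).inter
      ((h.isOpen_U j).preimage hf.continuous)).mem_nhds ⟨hp, hj⟩)
  · rw [hτu a j p ⟨hp, hj⟩]
    simp only [Finset.prod_const, Finset.card_univ, Fintype.card_fin]

/-- If `d ≤ 0`, the section attached to a chart around one point of the curve has no zeros. As all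
exponents are positive, none of the distinguished coordinates vanishes on the curve, which therefore
lies in one affine chart; a compact curve in affine space is a point. -/
theorem one_le_degree {n : R → ℕ} (hn : ∀ r, 0 < n r) {f : CP 1 → M}
    (hf : ContMDiff 𝓘(ℂ, Fin 1 → ℂ) 𝓘(ℂ, F) ω f) (hinj : ∃ S : Set (CP 1), S.Finite ∧ Set.InjOn f Sᶜ)
    {d : ℤ} (hd : HasDegree ((D.bundle h n).pullback f hf) d) : 1 ≤ d := by
  by_contra! hlt
  obtain ⟨i, hi⟩ := D.exists_mem_U (f (CP.line 0 0))
  obtain ⟨τ, u, hτ, hu⟩ := h.exists_section_of_hasDegree hf hd i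
  have h0 : τ 0 (CP.line 0 0) ≠ 0 := by
    obtain ⟨-, hu0, hτu⟩ := hu 0 i _ (CP.line_mem 0 0) hi
    rw [hτu]
    refine mul_ne_zero hu0 (Finset.prod_ne_zero_iff.2 fun r _ => ?_)
    rw [div_self (hi r), one_pow]
    exact one_ne_zero
  have hU : ∀ p, f p ∈ D.U i := by
    intro p r hr
    obtain ⟨a, z, rfl⟩ := CP.exists_line_eq p
    obtain ⟨j, hj⟩ := D.exists_mem_U (f (CP.line a z))
    refine CP.section_ne_zero (Int.lt_add_one_iff.1 hlt) hτ h0 a z ?_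
    obtain ⟨-, -, hτu⟩ := hu a j _ (CP.line_mem a z) hj
    rw [hτu, Finset.prod_eq_zero (Finset.mem_univ r), mul_zero]
    rw [hr, zero_div, zero_pow (hn r).ne']
  have hconst : ∀ p q, f p = f q := by
    intro p q
    have h1 : ContMDiff 𝓘(ℂ, Fin 1 → ℂ) 𝓘(ℂ, κ → ℂ) ω fun p => D.ψ i (f p) := fun p =>
      (h.contMDiffAt_ψ (hU p)).comp p (hf p)
    have h2 := (h1.mdifferentiable (by simp)).apply_eq_of_compactSpace p q
    rw [← D.χ_ψ (hU p), ← D.χ_ψ (hU q)]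
    exact congrArg _ h2
  obtain ⟨S, hS, hSf⟩ := hinj
  -- A constant map that is injective off a finite set would make `ℙ¹` finite.
  have : Sᶜ.Subsingleton := fun p hp q hq => hSf hp hq (hconst p q)
  exact Set.infinite_univ (α := CP 1) (by
    rw [← Set.union_compl_self S]
    exact hS.union this.finite)

/-- With all exponents at least 2, every zero of the section attached to a chart is multiple. Since
it is non-zero at a point of that chart, this is impossible for a section of `𝒪(1)`. -/
theorem two_le_degree {n : R → ℕ} (hn : ∀ r, 2 ≤ n r) {f : CP 1 → M}
    (hf : ContMDiff 𝓘(ℂ, Fin 1 → ℂ) 𝓘(ℂ, F) ω f) (hinj : ∃ S : Set (CP 1), S.Finite ∧ Set.InjOn f Sᶜ)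
    {d : ℤ} (hd : HasDegree ((D.bundle h n).pullback f hf) d) : 2 ≤ d := by
  have h1 := h.one_le_degree (fun r => two_pos.trans_le (hn r)) hf hinj hd
  by_contra! hlt
  obtain rfl : d = 1 := by omega
  obtain ⟨i, hi⟩ := D.exists_mem_U (f (CP.line 0 0))
  obtain ⟨τ, u, hτ, hu⟩ := h.exists_section_of_hasDegree hf hd i
  have h0 : τ 0 (CP.line 0 0) ≠ 0 := by
    obtain ⟨-, hu0, hτu⟩ := hu 0 i _ (CP.line_mem 0 0) hi
    rw [hτu]
    refine mul_ne_zero hu0 (Finset.prod_ne_zero_iff.2 fun r _ => ?_)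
    rw [div_self (hi r), one_pow]
    exact one_ne_zero
  refine h0 (CP.section_eq_zero hτ (fun a z hz => ?_) 0 0)
  obtain ⟨j, hj⟩ := D.exists_mem_U (f (CP.line a z))
  have hline : ContMDiffAt 𝓘(ℂ) 𝓘(ℂ, Fin 1 → ℂ) ω (CP.line a) z := CP.contMDiff_line a z
  have hq : ∀ r, DifferentiableAt ℂ
      (fun w => D.s r (f (CP.line a w)) (D.β i r) / D.s r (f (CP.line a w)) (D.β j r)) z :=
    fun r => by
      have h2 := ContMDiffAt.comp z (g := fun x => D.s r x (D.β i r) / D.s r x (D.β j r))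
        (f := f ∘ CP.line a) (h.contMDiffAt_ratio (hj r)) ((hf _).comp z hline)
      exact (contMDiffAt_iff_contDiffAt.1 h2).differentiableAt (by simp)
  have hu' : DifferentiableAt ℂ (fun w => u a j (CP.line a w)) z :=
    (contMDiffAt_iff_contDiffAt.1 ((hu a j _ (CP.line_mem a z) hj).1.comp z
      hline)).differentiableAt (by simp)
  -- The square of the product `q` of the distinguished ratios is split off; the hypothesis on `n`
  -- makes the remaining exponents `n r - 2` genuine.
  refine deriv_eq_zero_of_double_zero
    (q := fun w => ∏ r, D.s r (f (CP.line a w)) (D.β i r) / D.s r (f (CP.line a w)) (D.β j r))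
    (k := fun w => u a j (CP.line a w) *
      ∏ r, (D.s r (f (CP.line a w)) (D.β i r) / D.s r (f (CP.line a w)) (D.β j r)) ^ (n r - 2))
    ?_ ?_ ?_ ?_
  · have hev : ∀ᶠ w in 𝓝 z, f (CP.line a w) ∈ D.U j :=
      (hf.continuous.comp (CP.contMDiff_line a).continuous).continuousAt.eventually
        ((h.isOpen_U j).mem_nhds hj)
    filter_upwards [hev] with w hw
    rw [(hu a j _ (CP.line_mem a w) hw).2.2, mul_left_comm _ (u a j (CP.line a w)),
      mul_left_comm _ (u a j (CP.line a w)), ← Finset.prod_mul_distrib, ← Finset.prod_mul_distrib]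
    refine congrArg _ (Finset.prod_congr rfl fun r _ => ?_)
    rw [← mul_assoc, ← sq, ← pow_add, Nat.add_sub_cancel' (hn r)]
  · exact DifferentiableAt.fun_finsetProd fun r _ => hq r
  · exact hu'.mul (DifferentiableAt.fun_finsetProd fun r _ => (hq r).pow _)
  · obtain ⟨-, hu0, hτu⟩ := hu a j _ (CP.line_mem a z) hj
    rw [hτu] at hz
    obtain ⟨r, hr, hr0⟩ := Finset.prod_eq_zero_iff.1 ((mul_eq_zero.1 hz).resolve_left hu0)
    exact Finset.prod_eq_zero hr (pow_eq_zero_iff (by have := hn r; omega) |>.1 hr0)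

/-- A torus-invariant rational curve: in the coordinate systems `i₀` and `i₁` it is a coordinate
axis, and all but one of the families of homogeneous coordinates are constant on it. -/
theorem mem_rationalCurveDegrees [FiniteDimensional ℂ F] [IsManifold 𝓘(ℂ, F) ω M] [DecidableEq κ]
    {n : R → ℕ} (hvol : D.IsAnticanonicalDegree n) (i₀ i₁ : ι) (c₀ c₁ : κ) (r₀ : R)
    (hβ : ∀ r, r ≠ r₀ → D.β i₀ r = D.β i₁ r)
    (h₀ : ∀ u, D.mon i₀ r₀ (D.β i₁ r₀) (Pi.single c₀ u) = u)
    (h₁ : ∀ u, D.mon i₁ r₀ (D.β i₀ r₀) (Pi.single c₁ u) = u)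
    (h₀' : ∀ r b u, (r = r₀ → b ≠ D.β i₁ r) → b ≠ D.β i₀ r → D.mon i₀ r b (Pi.single c₀ u) = 0)
    (h₁' : ∀ r b u, (r = r₀ → b ≠ D.β i₀ r) → b ≠ D.β i₁ r → D.mon i₁ r b (Pi.single c₁ u) = 0) :
    (n r₀ : ℤ) ∈ rationalCurveDegrees F M := by
  classical
  let f₀ : ℂ → M := fun u => D.χ i₀ (Pi.single c₀ u)
  let f₁ : ℂ → M := fun u => D.χ i₁ (Pi.single c₁ u)
  have hglue : ∀ u, u ≠ 0 → f₀ u = f₁ u⁻¹ := by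
    intro u hu
    refine D.ext_of_smul fun r => ?_
    obtain ⟨a, ha, hs⟩ := D.s_χ i₀ (Pi.single c₀ u) r
    obtain ⟨a', ha', hs'⟩ := D.s_χ i₁ (Pi.single c₁ u⁻¹) r
    by_cases hr : r = r₀
    · subst hr
      -- In the family `r₀` only the two distinguished entries survive: they are `(1, u)` in one
      -- chart and `(u⁻¹, 1)` in the other, proportional with factor `u`.
      refine ⟨a / a' * u, fun b => ?_⟩
      rw [hs, hs']
      by_cases hb₀ : b = D.β i₀ r
      · subst hb₀
        rw [D.mon_β, h₁]
        field_simp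
      by_cases hb₁ : b = D.β i₁ r
      · subst hb₁
        rw [D.mon_β, h₀]
        field_simp
      rw [h₀' r b u (fun _ => hb₁) hb₀, h₁' r b u⁻¹ (fun _ => hb₀) hb₁]
      simp
    · refine ⟨a / a', fun b => ?_⟩
      rw [hs, hs']
      by_cases hb₀ : b = D.β i₀ r
      · subst hb₀
        rw [D.mon_β, hβ r hr, D.mon_β]
        field_simp
      · rw [h₀' r b u (fun h => absurd h hr) hb₀,
          h₁' r b u⁻¹ (fun h => absurd h hr) (hβ r hr ▸ hb₀)]
        simp
  let f : CP 1 → M := fun p =>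
    if p.rep 0 ≠ 0 then f₀ (p.rep 1 / p.rep 0) else f₁ (p.rep 0 / p.rep 1)
  have hf₀ : ∀ p : CP 1, p.rep 0 ≠ 0 → f p = f₀ (p.rep 1 / p.rep 0) := fun p hp => if_pos hp
  have hf₁ : ∀ p : CP 1, p.rep 1 ≠ 0 → f p = f₁ (p.rep 0 / p.rep 1) := fun p hp => by
    by_cases hp0 : p.rep 0 ≠ 0
    · rw [hf₀ p hp0, hglue _ (div_ne_zero hp hp0), inv_div]
    · exact if_neg hp0
  have hne : ∀ p : CP 1, p.rep 0 = 0 → p.rep 1 ≠ 0 := fun p h0 h1 => by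
    obtain ⟨i, hi⟩ := exists_rep_ne_zero p
    match i with
    | 0 => exact hi h0
    | 1 => exact hi h1
  have hf : ContMDiff 𝓘(ℂ, Fin 1 → ℂ) 𝓘(ℂ, F) ω f := by
    have hax : ∀ i c, ContMDiff 𝓘(ℂ) 𝓘(ℂ, F) ω fun u : ℂ => D.χ i (Pi.single c u) := fun i c =>
      (h.contMDiff_χ i).comp (ContinuousLinearMap.single ℂ (fun _ : κ => ℂ) c).contDiff.contMDiff
    intro p
    by_cases hp : p.rep 0 = 0
    · have h1 := (hax i₁ c₁).contMDiffAt.comp p ((CP.contMDiffOn_ratio 0 1).contMDiffAt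
        ((CP.isOpen_source 1).mem_nhds (hne p hp)))
      refine h1.congr_of_eventuallyEq ?_
      filter_upwards [(CP.isOpen_source 1).mem_nhds (hne p hp)] with q hq
      exact hf₁ q hq
    · have h1 := (hax i₀ c₀).contMDiffAt.comp p ((CP.contMDiffOn_ratio 1 0).contMDiffAt
        ((CP.isOpen_source 0).mem_nhds hp))
      refine h1.congr_of_eventuallyEq ?_
      filter_upwards [(CP.isOpen_source 0).mem_nhds hp] with q hq
      exact hf₀ q hq
  have hU₀ : ∀ p : CP 1, p.rep 0 ≠ 0 → f p ∈ D.U i₀ := fun p hp => hf₀ p hp ▸ D.χ_mem _ _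
  have hU₁ : ∀ p : CP 1, p.rep 1 ≠ 0 → f p ∈ D.U i₁ := fun p hp => hf₁ p hp ▸ D.χ_mem _ _
  have hU₀' : ∀ p : CP 1, f p ∈ D.U i₀ → p.rep 0 ≠ 0 := fun p hp h0 => by
    have h2 := hp r₀
    rw [hf₁ p (hne p h0), D.s_χ_ne_zero_iff, h₁, h0, zero_div] at h2
    exact h2 rfl
  have hCP : ∀ p q : CP 1, ∀ a : Fin 2, p.rep a ≠ 0 → q.rep a ≠ 0 →
      (∀ b, p.rep b / p.rep a = q.rep b / q.rep a) → p = q := fun p q a hp hq hr =>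
    (CP.toricCover 1).ext_of_ratio (i := a) (fun _ => hp) (fun _ => hq) fun _ => hr
  have hinj : Function.Injective f := by
    intro p q hpq
    by_cases hp : p.rep 0 = 0
    · have hq : q.rep 0 = 0 := by
        by_contra hq
        exact hU₀' p (hpq ▸ hU₀ q hq) hp
      refine hCP p q 1 (hne p hp) (hne q hq) fun b => ?_
      match b with
      | 0 => rw [hp, hq, zero_div, zero_div]
      | 1 => rw [div_self (hne p hp), div_self (hne q hq)]
    · have hq : q.rep 0 ≠ 0 := hU₀' q (hpq ▸ hU₀ p hp)
      refine hCP p q 0 hp hq fun b => ?_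
      match b with
      | 0 => rw [div_self hp, div_self hq]
      | 1 =>
        rw [hf₀ p hp, hf₀ q hq] at hpq
        have := congrArg (D.ψ i₀) hpq
        simp only [f₀, ψ_χ] at this
        exact Pi.single_injective _ this
  refine ⟨f, hf, ⟨∅, Set.finite_empty, hinj.injOn⟩, ?_⟩
  refine ((h.anticanonical_isIso hvol i₀).pullback f hf).trans ?_
  let L := D.bundle h n
  let ia : Fin 2 → ι := ![i₀, i₁]
  have hUa : ∀ a (p : CP 1), p.rep a ≠ 0 → f p ∈ D.U (ia a) := fun a p hp => by
    match a with
    | 0 => exact hU₀ p hp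
    | 1 => exact hU₁ p hp
  -- Families other than `r₀` have the same distinguished entry in both charts and contribute 1, so
  -- the pulled-back cocycle on the two charts is exactly that of `𝒪(n r₀)`.
  have hg : ∀ a b (p : CP 1), p.rep a ≠ 0 → p.rep b ≠ 0 →
      L.g (ia a) (ia b) (f p) = (p.rep a / p.rep b) ^ (n r₀ : ℤ) := by
    intro a b p ha hb
    have key : p.rep 0 ≠ 0 → p.rep 1 ≠ 0 → D.s r₀ (f p) (D.β i₀ r₀) / D.s r₀ (f p) (D.β i₁ r₀) =
        p.rep 0 / p.rep 1 := fun h0 h1 => by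
      rw [hf₀ p h0, D.s_χ_div, D.mon_β, h₀, one_div_div]
    rw [zpow_natCast]
    match a, b with
    | 0, 0 => rw [div_self ha, one_pow]; exact L.g_self _ _ (hUa 0 p ha)
    | 1, 1 => rw [div_self ha, one_pow]; exact L.g_self _ _ (hUa 1 p ha)
    | 0, 1 =>
      change ∏ r, (D.s r (f p) (D.β i₀ r) / D.s r (f p) (D.β i₁ r)) ^ n r = _
      rw [Finset.prod_eq_single r₀, key ha hb]
      · intro r _ hr
        rw [hβ r hr, div_self (hU₁ p hb r), one_pow]
      · simp
    | 1, 0 =>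
      change ∏ r, (D.s r (f p) (D.β i₁ r) / D.s r (f p) (D.β i₀ r)) ^ n r = _
      rw [Finset.prod_eq_single r₀, ← inv_div, key hb ha, inv_div]
      · intro r _ hr
        rw [hβ r hr, div_self (hU₁ p ha r), one_pow]
      · simp
  -- The transition functions from an arbitrary chart to the two charts along the curve form the
  -- isomorphism.
  refine ⟨fun i a p => L.g i (ia a) (f p), fun i a => ?_, fun i a p hp => ?_,
    fun i j a b p hp => ?_⟩
  · exact (L.holo i (ia a)).comp hf.contMDiffOn fun p hp => ⟨hp.1, hUa a p hp.2⟩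
  · exact L.g_ne_zero hp.1 (hUa a p hp.2)
  · change L.g j (ia b) (f p) * L.g i j (f p) = (p.rep a / p.rep b) ^ (n r₀ : ℤ) * _
    have ha := hUa a p hp.2.1
    have hb := hUa b p hp.2.2
    rw [L.cocycle i j (ia b) (f p) ⟨hp.1, hb⟩, ← hg a b p hp.2.1 hp.2.2]
    exact (L.cocycle i (ia a) (ia b) (f p) ⟨⟨hp.1.1, ha⟩, hb⟩).symm

theorem isFano [FiniteDimensional ℂ F] [IsManifold 𝓘(ℂ, F) ω M] [Finite ι] [∀ r, Fintype (B r)]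
    {n : R → ℕ} (hvol : D.IsAnticanonicalDegree n) (hn : ∀ r, 0 < n r) (i₀ : ι) : IsFano F M :=
  ⟨h.t2Space, h.compactSpace, h.connectedSpace i₀,
    D.isAmple_of_isIso h hn i₀ (h.anticanonical_isIso hvol i₀)⟩

theorem hasPseudoIndex_one [FiniteDimensional ℂ F] [IsManifold 𝓘(ℂ, F) ω M] {n : R → ℕ}
    (hvol : D.IsAnticanonicalDegree n) (hn : ∀ r, 0 < n r) (i₀ : ι)
    (h1 : (1 : ℤ) ∈ rationalCurveDegrees F M) : HasPseudoIndex F M 1 := by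
  refine ⟨h1, ?_⟩
  rintro d ⟨f, hf, hinj, hd⟩
  exact h.one_le_degree hn hf hinj
    (((h.anticanonical_isIso hvol i₀).pullback f hf).symm.trans hd)

theorem hasPseudoIndex_two [FiniteDimensional ℂ F] [IsManifold 𝓘(ℂ, F) ω M] {n : R → ℕ}
    (hvol : D.IsAnticanonicalDegree n) (hn : ∀ r, 2 ≤ n r) (i₀ : ι)
    (h2 : (2 : ℤ) ∈ rationalCurveDegrees F M) : HasPseudoIndex F M 2 := by
  refine ⟨h2, ?_⟩
  rintro d ⟨f, hf, hinj, hd⟩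
  exact h.two_le_degree hn hf hinj
    (((h.anticanonical_isIso hvol i₀).pullback f hf).symm.trans hd)

end ToricCover.IsHolo

/-! ### Monomial coordinates on the projective bundle -/

/-- The model of `Y` as a space of functions. -/
def modelEquiv (m : ℕ) : YModel m ≃L[ℂ] (Fin m ⊕ Fin m → ℂ) :=
  (LinearEquiv.sumArrowLequivProdArrow (Fin m) (Fin m) ℂ ℂ).symm.toContinuousLinearEquiv

namespace YSpace

variable {m : ℕ}

/-- The homogeneous coordinates on `Y`: the coordinates `x_a` of the base, and the sections `t`
and `x_a v_k` of the tautological bundle twisted by `𝒪(1)`. -/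
def Index (m : ℕ) : Bool → Type
  | false => Fin (m + 1)
  | true => Option (Fin (m + 1) × Fin m)

instance (m : ℕ) : ∀ r, Fintype (Index m r)
  | false => inferInstanceAs (Fintype (Fin (m + 1)))
  | true => inferInstanceAs (Fintype (Option (Fin (m + 1) × Fin m)))

/-- The value of the linear form of `y` at the chosen vector of the base point. -/
def last (y : YSpace m) : ℂ := y.line.rep.2 ⟨y.base.rep, rep_mem y.base⟩

/-- The homogeneous coordinate vectors of a point of `Y`. -/
def hom (y : YSpace m) : ∀ r, Index m r → ℂ
  | false => y.base.rep
  | true => fun o => Option.elim o (last y) fun ak => y.base.rep ak.1 * y.line.rep.1 ak.2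

/-- The sections that give the coordinates of the fibre in the `i`-th trivialization. -/
def fibreIndex (i : Fin (m + 1)) (j : Fin (m + 1)) : Option (Fin (m + 1) × Fin m) :=
  Fin.lastCases none (fun k => some (i, k)) j

@[simp]
theorem fibreIndex_last (i : Fin (m + 1)) : fibreIndex i (Fin.last m) = none := by
  simp [fibreIndex]

@[simp]
theorem fibreIndex_castSucc (i : Fin (m + 1)) (k : Fin m) :
    fibreIndex i k.castSucc = some (i, k) := by
  simp [fibreIndex]

theorem coord_castSucc (i : Fin (m + 1)) (y : YSpace m) (k : Fin m) :
    coord i y k.castSucc = y.line.rep.1 k :=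
  triv_castSucc _ _ _ _

theorem coord_last {i : Fin (m + 1)} {y : YSpace m} :
    coord i y (Fin.last m) = (y.base.rep i)⁻¹ * last y := by
  rw [coord, triv_last, last]
  have : unitVec i y.base = (y.base.rep i)⁻¹ • ⟨y.base.rep, rep_mem y.base⟩ := rfl
  rw [this, map_smul, smul_eq_mul]

theorem hom_fibreIndex {i : Fin (m + 1)} {y : YSpace m} (hi : y.base.rep i ≠ 0)
    (j : Fin (m + 1)) : hom y true (fibreIndex i j) = y.base.rep i * coord i y j := by
  refine Fin.lastCases ?_ (fun k => ?_) j
  · rw [fibreIndex_last, coord_last, ← mul_assoc, mul_inv_cancel₀ hi, one_mul]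
    rfl
  · rw [fibreIndex_castSucc, coord_castSucc]
    rfl

/-- The monomials in `x` and `c` that give the homogeneous coordinates of the point with base `x`
and coordinates `c` of the line. -/
def homOf (x c : Fin (m + 1) → ℂ) : ∀ r, Index m r → ℂ
  | false => x
  | true => fun o => Option.elim o (c (Fin.last m)) fun ak => x ak.1 * c ak.2.castSucc

/-- The chosen representatives of the base point and of the line differ from the given coordinates
by scalars `a` and `a'`. Evaluating the linear form on the base representative gives `t` the weight
`a * a'`, the same as that of the products `x_a v_k`; hence they form one family. -/
theorem hom_ofCoord (i : Fin (m + 1)) (z : Fin m → ℂ) (hp : ((CP.chart m i).symm z).rep i ≠ 0)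
    (c : Fin (m + 1) → ℂ) (hc : c ≠ 0) (r : Bool) :
    ∃ a : ℂ, a ≠ 0 ∧ ∀ b, hom (ofCoord i ((CP.chart m i).symm z) hp c hc) r b =
      a * homOf (i.insertNth (1 : ℂ) z) c r b := by
  obtain ⟨a, ha⟩ := Projectivization.exists_smul_eq_mk_rep ℂ _ (insertNth_ne_zero i z)
  obtain ⟨a', ha'⟩ := Projectivization.exists_smul_eq_mk_rep ℂ _ (untriv_ne_zero i _ hp c hc)
  have hb : ∀ b, ((CP.chart m i).symm z).rep b =
      (a : ℂ) * (i.insertNth (1 : ℂ) z : Fin (m + 1) → ℂ) b := fun b => (congrFun ha b).symm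
  match r with
  | false => exact ⟨a, a.ne_zero, hb⟩
  | true =>
    refine ⟨a * a', mul_ne_zero a.ne_zero a'.ne_zero, fun o => ?_⟩
    match o with
    | none =>
      change (Projectivization.mk ℂ (untriv i _ c) _).rep.2 _ = _ * c (Fin.last m)
      rw [← ha']
      have h1 := hb i
      rw [Fin.insertNth_apply_same, mul_one] at h1
      change (a' : ℂ) * (c (Fin.last m) * ((CP.chart m i).symm z).rep i) = _
      rw [h1]
      ring
    | some (b, k) =>
      change ((CP.chart m i).symm z).rep b * (Projectivization.mk ℂ (untriv i _ c) _).rep.1 k =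
        _ * ((i.insertNth (1 : ℂ) z : Fin (m + 1) → ℂ) b * c k.castSucc)
      rw [← ha', hb]
      simp only [untriv, Units.smul_def, Prod.smul_fst, Pi.smul_apply, smul_eq_mul]
      ring

theorem contDiff_homOf {E : Type} [NormedAddCommGroup E] [NormedSpace ℂ E]
    {x c : E → Fin (m + 1) → ℂ} (hx : ∀ a, ContDiff ℂ ω fun z => x z a)
    (hc : ∀ a, ContDiff ℂ ω fun z => c z a) :
    ∀ r b, ContDiff ℂ ω fun z => homOf (x z) (c z) r b
  | false, b => hx b
  | true, none => hc _
  | true, some _ => (hx _).mul (hc _)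

theorem homOf_mul (x x' c c' : Fin (m + 1) → ℂ) :
    ∀ r b, homOf (x * x') (c * c') r b = homOf x c r b * homOf x' c' r b
  | false, _ => rfl
  | true, none => rfl
  | true, some _ => mul_mul_mul_comm _ _ _ _

theorem homOf_one : ∀ r b, homOf (1 : Fin (m + 1) → ℂ) 1 r b = 1
  | false, _ => rfl
  | true, none => rfl
  | true, some _ => mul_one _

theorem homOf_fibreIndex {x c : Fin (m + 1) → ℂ} {i : Fin (m + 1)} (hi : x i = 1)
    (j : Fin (m + 1)) : homOf x c true (fibreIndex i j) = c j := by
  refine Fin.lastCases ?_ (fun k => ?_) j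
  · rw [fibreIndex_last]
    rfl
  · rw [fibreIndex_castSucc]
    change x i * _ = _
    rw [hi, one_mul]

theorem insertNth_mul {N : ℕ} (i : Fin (N + 1)) (z z' : Fin N → ℂ) :
    (i.insertNth (1 : ℂ) (z * z') : Fin (N + 1) → ℂ) =
      (i.insertNth (1 : ℂ) z : Fin (N + 1) → ℂ) * i.insertNth (1 : ℂ) z' :=
  funext fun b => (CP.toricCover N).mon_mul i () b z z'

theorem insertNth_one {N : ℕ} (i : Fin (N + 1)) :
    (i.insertNth (1 : ℂ) (1 : Fin N → ℂ) : Fin (N + 1) → ℂ) = 1 :=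
  funext fun b => (CP.toricCover N).mon_one i () b

theorem norm_ratio_le_one {N : ℕ} {v : Fin (N + 1) → ℂ} {i : Fin (N + 1)}
    (hi : ∀ a, ‖v a‖ ≤ ‖v i‖) (a : Fin (N + 1)) : ‖v a / v i‖ ≤ 1 := by
  rw [norm_div]
  exact div_le_one_of_le₀ (hi _) (norm_nonneg _)

theorem exists_norm_max {K : Type} [Finite K] {v : K → ℂ} (hv : v ≠ 0) :
    ∃ i, v i ≠ 0 ∧ ∀ a, ‖v a‖ ≤ ‖v i‖ := by
  obtain ⟨j, hj⟩ := Function.ne_iff.1 hv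
  have : Nonempty K := ⟨j⟩
  obtain ⟨i, hi⟩ := Finite.exists_max fun i => ‖v i‖
  exact ⟨i, norm_pos_iff.1 ((norm_pos_iff.2 hj).trans_le (hi j)), hi⟩

/-- The cover of `Y` by the coordinate systems of its atlas. -/
def cover (m : ℕ) : ToricCover (YSpace m) (Fin (m + 1) × Fin (m + 1)) (Fin m ⊕ Fin m) Bool
    (Index m) where
  s r y := hom y r
  β ij
    | false => ij.1
    | true => fibreIndex ij.1 ij.2
  χ ij z := (chart m ij).symm ((modelEquiv m).symm z)
  mon ij r b z := homOf (ij.1.insertNth (1 : ℂ) fun k => z (Sum.inl k))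
    (ij.2.insertNth (1 : ℂ) fun k => z (Sum.inr k)) r b
  contDiff_mon ij := contDiff_homOf
    (fun a => (contDiff_insertNth _ a).comp (contDiff_pi.2 fun k => contDiff_apply ℂ ℂ _))
    (fun a => (contDiff_insertNth _ a).comp (contDiff_pi.2 fun k => contDiff_apply ℂ ℂ _))
  mon_mul ij r b z z' := by
    rw [← homOf_mul, ← insertNth_mul, ← insertNth_mul]
    rfl
  mon_one ij r b := by
    refine Eq.trans ?_ (homOf_one r b)
    congr 1
    · exact insertNth_one ij.1
    · exact insertNth_one ij.2
  mon_β ij r z := by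
    match r with
    | false => exact Fin.insertNth_apply_same _ _ _
    | true =>
      exact (homOf_fibreIndex (Fin.insertNth_apply_same _ _ _) _).trans
        (Fin.insertNth_apply_same _ _ _)
  s_χ ij z r := hom_ofCoord ij.1 _ ((CP.chart m ij.1).map_target (Set.mem_univ _)) _
    (insertNth_ne_zero _ _) r
  num ij
    | Sum.inl k => ⟨false, ij.1.succAbove k⟩
    | Sum.inr k => ⟨true, fibreIndex ij.1 (ij.2.succAbove k)⟩
  mon_num ij c z := by
    match c with
    | Sum.inl k => exact Fin.insertNth_apply_succAbove _ _ _ _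
    | Sum.inr k =>
      exact (homOf_fibreIndex (Fin.insertNth_apply_same _ _ _) _).trans
        (Fin.insertNth_apply_succAbove _ _ _ _)
  surj ij y hy := by
    have hi : y.base.rep ij.1 ≠ 0 := hy false
    have hj : coord ij.1 y ij.2 ≠ 0 := by
      have := hy true
      simp only [hom_fibreIndex hi] at this
      exact right_ne_zero_of_mul this
    refine ⟨modelEquiv m (chart m ij y), ?_⟩
    rw [ContinuousLinearEquiv.symm_apply_apply]
    exact (chart m ij).left_inv ⟨hi, hj⟩
  cover y := by
    obtain ⟨i, hi, hi'⟩ := exists_norm_max y.base.rep_nonzero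
    obtain ⟨j, hj, hj'⟩ := exists_norm_max (coord_ne_zero i y hi)
    refine ⟨(i, j), modelEquiv m (chart m (i, j) y), ?_,
      (pi_norm_le_iff_of_nonneg zero_le_one).2 fun c => ?_⟩
    · rw [ContinuousLinearEquiv.symm_apply_apply]
      exact (chart m (i, j)).left_inv ⟨hi, hj⟩
    · match c with
      | Sum.inl k => exact norm_ratio_le_one hi' _
      | Sum.inr k => exact norm_ratio_le_one hj' _

theorem mem_U_iff (ij : Fin (m + 1) × Fin (m + 1)) (y : YSpace m) :
    y ∈ (cover m).U ij ↔ y.base.rep ij.1 ≠ 0 ∧ coord ij.1 y ij.2 ≠ 0 := by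
  constructor
  · intro hy
    have hi : y.base.rep ij.1 ≠ 0 := hy false
    have := hy true
    simp only [cover, hom_fibreIndex hi] at this
    exact ⟨hi, right_ne_zero_of_mul this⟩
  · rintro ⟨hi, hj⟩ r
    match r with
    | false => exact hi
    | true =>
      change hom y true (fibreIndex ij.1 ij.2) ≠ 0
      rw [hom_fibreIndex hi]
      exact mul_ne_zero hi hj

theorem isHolo (m : ℕ) : (cover m).IsHolo (YModel m) :=
  (cover m).isHolo_of_holAtlas (holAtlas m) (modelEquiv m)
    (fun ij => by
      ext y
      rw [mem_U_iff]
      rfl) (fun _ => rfl)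
    (fun ij z => by
      change _ = (chart m ij).symm ((modelEquiv m).symm (modelEquiv m z))
      rw [ContinuousLinearEquiv.symm_apply_apply]
      rfl)

/-! ### The anticanonical degree and the pseudo-index of `Y` -/

theorem prod_ratio {N : ℕ} (u : Fin (N + 1) → ℂ) (i : Fin (N + 1)) (hi : u i ≠ 0) :
    (∏ k, u (i.succAbove k) / u i) * u i ^ (N + 1) = ∏ a, u a := by
  rw [Finset.prod_div_distrib, Finset.prod_const, Finset.card_univ, Fintype.card_fin,
    Fin.prod_univ_succAbove u i, pow_succ]
  field_simp

/-- The anticanonical degree of `Y`. -/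
def degree (m : ℕ) : Bool → ℕ
  | false => 1
  | true => m + 1

/-- In every chart the expression equals `∏ x_a * ∏ v_k * t`, which does not involve the chart. The
base ratios absorb `x_i ^ (m + 1)`; the fibre entries `x_i v_k` and `t` have product `x_i ^ m * ∏
v_k * t`. Thus one power of `x_i` remains, and degree `m + 1` in the fibre family. -/
theorem isAnticanonicalDegree (m : ℕ) : (cover m).IsAnticanonicalDegree (degree m) := by
  have key : ∀ ij, ∀ y ∈ (cover m).U ij, (∏ c, (cover m).ψ ij y c) *
      ∏ r, (cover m).s r y ((cover m).β ij r) ^ degree m r =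
        (∏ a, y.base.rep a) * ((∏ k, y.line.rep.1 k) * last y) := by
    intro ij y hy
    have hi : y.base.rep ij.1 ≠ 0 := hy false
    have h1 := prod_ratio y.base.rep ij.1 hi
    have h2 := prod_ratio (fun j => hom y true (fibreIndex ij.1 j)) ij.2 (hy true)
    have h3 : ∏ j, hom y true (fibreIndex ij.1 j) =
        y.base.rep ij.1 ^ m * (∏ k, y.line.rep.1 k) * last y := by
      rw [Fin.prod_univ_castSucc]
      simp only [fibreIndex_castSucc, fibreIndex_last]
      change (∏ k, y.base.rep ij.1 * y.line.rep.1 k) * last y = _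
      rw [Finset.prod_mul_distrib, Finset.prod_const, Finset.card_univ, Fintype.card_fin]
    rw [h3] at h2
    rw [Fintype.prod_sum_type, Fintype.prod_bool]
    change (∏ k, y.base.rep (ij.1.succAbove k) / y.base.rep ij.1) *
      (∏ k, hom y true (fibreIndex ij.1 (ij.2.succAbove k)) / hom y true (fibreIndex ij.1 ij.2)) *
      (hom y true (fibreIndex ij.1 ij.2) ^ (m + 1) * y.base.rep ij.1 ^ 1) = _
    refine mul_right_cancel₀ (pow_ne_zero m hi) ?_
    rw [← h1]
    linear_combination (∏ k, y.base.rep (ij.1.succAbove k) / y.base.rep ij.1) *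
      y.base.rep ij.1 ^ (m + 1) * h2
  exact fun i j y hy => (key i y hy.1).trans (key j y hy.2).symm

theorem insertNth_single_self {N : ℕ} (i : Fin (N + 1)) (k : Fin N) (u : ℂ) :
    (i.insertNth (1 : ℂ) (Pi.single k u : Fin N → ℂ) : Fin (N + 1) → ℂ) (i.succAbove k) = u := by
  rw [Fin.insertNth_apply_succAbove, Pi.single_eq_same]

theorem insertNth_single_ne {N : ℕ} {i : Fin (N + 1)} {k : Fin N} (u : ℂ) {a : Fin (N + 1)}
    (hi : a ≠ i) (hk : a ≠ i.succAbove k) :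
    (i.insertNth (1 : ℂ) (Pi.single k u : Fin N → ℂ) : Fin (N + 1) → ℂ) a = 0 := by
  obtain ⟨l, rfl⟩ := Fin.exists_succAbove_eq hi
  rw [Fin.insertNth_apply_succAbove, Pi.single_eq_of_ne]
  rintro rfl
  exact hk rfl

theorem insertNth_zero_ne {N : ℕ} {i a : Fin (N + 1)} (hi : a ≠ i) :
    (i.insertNth (1 : ℂ) (fun _ => 0 : Fin N → ℂ) : Fin (N + 1) → ℂ) a = 0 := by
  obtain ⟨l, rfl⟩ := Fin.exists_succAbove_eq hi
  rw [Fin.insertNth_apply_succAbove]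

theorem single_inl_comp_inl (k : Fin m) (u : ℂ) :
    (fun l => (Pi.single (Sum.inl k) u : Fin m ⊕ Fin m → ℂ) (Sum.inl l)) = Pi.single k u := by
  funext l
  simp [Pi.single_apply]

theorem single_inl_comp_inr (k : Fin m) (u : ℂ) :
    (fun l => (Pi.single (Sum.inl k) u : Fin m ⊕ Fin m → ℂ) (Sum.inr l)) = fun _ => 0 := by
  funext l
  simp

theorem single_inr_comp_inr (k : Fin m) (u : ℂ) :
    (fun l => (Pi.single (Sum.inr k) u : Fin m ⊕ Fin m → ℂ) (Sum.inr l)) = Pi.single k u := by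
  funext l
  simp [Pi.single_apply]

theorem single_inr_comp_inl (k : Fin m) (u : ℂ) :
    (fun l => (Pi.single (Sum.inr k) u : Fin m ⊕ Fin m → ℂ) (Sum.inl l)) = fun _ => 0 := by
  funext l
  simp

/-- The lines in the section `Z` of `Y` have anticanonical degree `1`. -/
theorem one_mem_rationalCurveDegrees (hm : 0 < m) :
    (1 : ℤ) ∈ rationalCurveDegrees (YModel m) (YSpace m) := by
  obtain ⟨k, rfl⟩ := Nat.exists_eq_succ_of_ne_zero hm.ne'
  -- In the charts where `t` is distinguished, `Z` is given by the vanishing of the fibre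
  -- coordinates, so a base coordinate axis is a line in `Z`. Only the base family varies on it, and
  -- its degree is 1.
  refine (isHolo (k + 1)).mem_rationalCurveDegrees (isAnticanonicalDegree (k + 1))
    (0, Fin.last _) (1, Fin.last _) (Sum.inl 0) (Sum.inl 0) false ?_ ?_ ?_ ?_ ?_
  · intro r hr
    match r with
    | false => exact absurd rfl hr
    | true => exact (fibreIndex_last _).trans (fibreIndex_last _).symm
  · intro u
    simp only [cover, single_inl_comp_inl]
    exact insertNth_single_self 0 0 u
  · intro u
    simp only [cover, single_inl_comp_inl]
    exact insertNth_single_self 1 0 u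
  · intro r b u hb hb'
    simp only [cover, single_inl_comp_inl, single_inl_comp_inr]
    match r, b with
    | false, b => exact insertNth_single_ne (k := 0) u hb' (hb rfl)
    | true, none => exact absurd (fibreIndex_last _).symm hb'
    | true, some (a, l) => exact mul_eq_zero_of_right _ (insertNth_zero_ne (Fin.castSucc_lt_last l).ne)
  · intro r b u hb hb'
    simp only [cover, single_inl_comp_inl, single_inl_comp_inr]
    match r, b with
    | false, b => exact insertNth_single_ne (k := 0) u hb' (hb rfl)
    | true, none => exact absurd (fibreIndex_last _).symm hb'
    | true, some (a, l) => exact mul_eq_zero_of_right _ (insertNth_zero_ne (Fin.castSucc_lt_last l).ne)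

theorem degree_pos (m : ℕ) : ∀ r, 0 < degree m r
  | false => one_pos
  | true => Nat.succ_pos m

theorem isFano (m : ℕ) : IsFano (YModel m) (YSpace m) :=
  (isHolo m).isFano (isAnticanonicalDegree m) (degree_pos m) (0, 0)

theorem hasPseudoIndex (hm : 0 < m) : HasPseudoIndex (YModel m) (YSpace m) 1 :=
  (isHolo m).hasPseudoIndex_one (isAnticanonicalDegree m) (degree_pos m) (0, 0)
    (one_mem_rationalCurveDegrees hm)

end YSpace

/-! ### The blow-up of the projective bundle -/

/-- The blow-up of `Y` along `Z`: the pairs of a point of `Y` and a line in `ℂ ^ m` that contains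
the projection of the point to the trivial summand. -/
structure XSpace (m : ℕ) : Type where
  pt : YSpace m
  dir : ℙ ℂ (Fin m → ℂ)
  mem : pt.line.rep.1 ∈ dir.submodule

namespace XSpace

variable {m : ℕ}

theorem ext_of {x x' : XSpace m} (h : x.pt = x'.pt) (h' : x.dir = x'.dir) : x = x' := by
  obtain ⟨y, q, hx⟩ := x
  obtain ⟨y', q', hx'⟩ := x'
  obtain rfl : y = y' := h
  obtain rfl : q = q' := h'
  rfl

theorem exists_smul (x : XSpace m) : ∃ a : ℂ, ∀ k, x.pt.line.rep.1 k = a * x.dir.rep k := by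
  have := x.mem
  rw [Projectivization.submodule_eq] at this
  obtain ⟨a, ha⟩ := Submodule.mem_span_singleton.1 this
  exact ⟨a, fun k => (congrFun ha k).symm⟩

/-- The homogeneous coordinates of the blow-up: those of `Y` and those of the line. -/
def Index (m : ℕ) : Option Bool → Type
  | none => Fin m
  | some r => YSpace.Index m r

instance (m : ℕ) : ∀ r, Fintype (Index m r)
  | none => inferInstanceAs (Fintype (Fin m))
  | some r => inferInstanceAs (Fintype (YSpace.Index m r))

/-- The homogeneous coordinate vectors of a point of the blow-up. -/
def hom (x : XSpace m) : ∀ r, Index m r → ℂ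
  | none => x.dir.rep
  | some r => YSpace.hom x.pt r

/-- The vector with entry `1` at `k`, and the entries of `w` elsewhere. -/
def dirVec (k : Fin m) (w : Fin m → ℂ) : Fin m → ℂ := Function.update w k 1

@[simp]
theorem dirVec_self (k : Fin m) (w : Fin m → ℂ) : dirVec k w k = 1 := Function.update_self _ _ _

theorem dirVec_of_ne {k l : Fin m} (h : l ≠ k) (w : Fin m → ℂ) : dirVec k w l = w l :=
  Function.update_of_ne h _ _

theorem dirVec_ne_zero (k : Fin m) (w : Fin m → ℂ) : dirVec k w ≠ 0 := fun h => by
  simpa using congrFun h k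

theorem contDiff_dirVec (k l : Fin m) : ContDiff ℂ ω fun w => dirVec k w l := by
  by_cases h : l = k
  · subst h
    simpa using contDiff_const
  · simp only [dirVec_of_ne h]
    exact contDiff_apply ℂ ℂ l

theorem dirVec_mul (k : Fin m) (w w' : Fin m → ℂ) :
    dirVec k (w * w') = dirVec k w * dirVec k w' := by
  funext l
  by_cases h : l = k
  · subst h
    simp
  · simp [dirVec_of_ne h]

theorem dirVec_one (k : Fin m) : dirVec k 1 = 1 := by
  funext l
  by_cases h : l = k
  · subst h
    simp
  · simp [dirVec_of_ne h]

/-- The coordinates of the point of `Y` under the point of the blow-up with coordinates `w`. In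
the coordinate systems with `ε = false` the last coordinate is `1`, and the exceptional divisor is
`w k = 0`; in those with `ε = true` the coordinate `k` is `1`. -/
def fibreVec (k : Fin m) (ε : Bool) (w : Fin m → ℂ) : Fin (m + 1) → ℂ :=
  Fin.snoc (fun l => (if ε then 1 else w k) * dirVec k w l) (if ε then w k else 1)

@[simp]
theorem fibreVec_castSucc (k l : Fin m) (ε : Bool) (w : Fin m → ℂ) :
    fibreVec k ε w l.castSucc = (if ε then 1 else w k) * dirVec k w l := by
  simp [fibreVec]

@[simp]
theorem fibreVec_last (k : Fin m) (ε : Bool) (w : Fin m → ℂ) :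
    fibreVec k ε w (Fin.last m) = if ε then w k else 1 := by
  simp [fibreVec]

theorem fibreVec_ne_zero (k : Fin m) (ε : Bool) (w : Fin m → ℂ) : fibreVec k ε w ≠ 0 := fun h => by
  match ε with
  | false => simpa using congrFun h (Fin.last m)
  | true => simpa using congrFun h k.castSucc

theorem contDiff_fibreVec (k : Fin m) (ε : Bool) (a : Fin (m + 1)) :
    ContDiff ℂ ω fun w => fibreVec k ε w a := by
  refine Fin.lastCases ?_ (fun l => ?_) a
  · simp only [fibreVec_last]
    split_ifs
    exacts [contDiff_apply ℂ ℂ k, contDiff_const]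
  · simp only [fibreVec_castSucc]
    split_ifs
    exacts [contDiff_const.mul (contDiff_dirVec k l),
      (contDiff_apply ℂ ℂ k).mul (contDiff_dirVec k l)]

theorem fibreVec_mul (k : Fin m) (ε : Bool) (w w' : Fin m → ℂ) :
    fibreVec k ε (w * w') = fibreVec k ε w * fibreVec k ε w' := by
  funext a
  refine Fin.lastCases ?_ (fun l => ?_) a
  · match ε with
    | false => simp
    | true => simp
  · match ε with
    | false => simpa [dirVec_mul] using mul_mul_mul_comm _ _ _ _
    | true => simp [dirVec_mul]

theorem fibreVec_one (k : Fin m) (ε : Bool) : fibreVec k ε 1 = 1 := by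
  funext a
  refine Fin.lastCases ?_ (fun l => ?_) a
  · match ε with
    | false => simp
    | true => simp
  · match ε with
    | false => simp [dirVec_one]
    | true => simp [dirVec_one]

/-- The monomials that give the homogeneous coordinates. -/
def homOf (x c : Fin (m + 1) → ℂ) (q : Fin m → ℂ) : ∀ r, Index m r → ℂ
  | none => q
  | some r => YSpace.homOf x c r

theorem homOf_none (x c : Fin (m + 1) → ℂ) (q : Fin m → ℂ) (l : Fin m) :
    homOf x c q none l = q l :=
  rfl

theorem homOf_base (x c : Fin (m + 1) → ℂ) (q : Fin m → ℂ) (a : Fin (m + 1)) :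
    homOf x c q (some false) a = x a :=
  rfl

theorem homOf_last (x c : Fin (m + 1) → ℂ) (q : Fin m → ℂ) :
    homOf x c q (some true) (none : Option (Fin (m + 1) × Fin m)) = c (Fin.last m) :=
  rfl

theorem homOf_some (x c : Fin (m + 1) → ℂ) (q : Fin m → ℂ) (a : Fin (m + 1)) (l : Fin m) :
    homOf x c q (some true) (some (a, l) : Option (Fin (m + 1) × Fin m)) = x a * c l.castSucc :=
  rfl

/-- The point of the blow-up with the given coordinates. -/
def ofCoord (i : Fin (m + 1)) (k : Fin m) (ε : Bool) (z w : Fin m → ℂ) : XSpace m where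
  pt := YSpace.ofCoord i ((CP.chart m i).symm z) ((CP.chart m i).map_target (Set.mem_univ _))
    (fibreVec k ε w) (fibreVec_ne_zero k ε w)
  dir := Projectivization.mk ℂ (dirVec k w) (dirVec_ne_zero k w)
  mem := by
    obtain ⟨a, ha⟩ := Projectivization.exists_smul_eq_mk_rep ℂ _
      (YSpace.untriv_ne_zero i ((CP.chart m i).symm z)
        ((CP.chart m i).map_target (Set.mem_univ _)) (fibreVec k ε w) (fibreVec_ne_zero k ε w))
    rw [Projectivization.submodule_mk]
    refine Submodule.mem_span_singleton.2 ⟨a * if ε then 1 else w k, ?_⟩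
    change _ = (Projectivization.mk ℂ (YSpace.untriv i _ (fibreVec k ε w)) _).rep.1
    rw [← ha]
    funext l
    simp only [YSpace.untriv, Units.smul_def, Prod.smul_fst, Pi.smul_apply, smul_eq_mul,
      fibreVec_castSucc]
    exact mul_assoc _ _ _

/-- The distinguished homogeneous coordinates of the coordinate systems. -/
def base (i : Fin (m + 1)) (k : Fin m) (ε : Bool) : ∀ r, Index m r
  | none => k
  | some false => i
  | some true => if ε then some (i, k) else (none : Option (Fin (m + 1) × Fin m))

/-- The numerators of the coordinates other than those of the base. -/
def numDir (i : Fin (m + 1)) (k : Fin m) (ε : Bool) (l : Fin m) : Σ r, Index m r :=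
  if l = k then ⟨some true, base i k (!ε) (some true)⟩ else ⟨none, l⟩

theorem numDir_self (i : Fin (m + 1)) (k : Fin m) (ε : Bool) :
    numDir i k ε k = ⟨some true, base i k (!ε) (some true)⟩ :=
  if_pos rfl

theorem numDir_of_ne (i : Fin (m + 1)) {k l : Fin m} (ε : Bool) (h : l ≠ k) :
    numDir i k ε l = ⟨none, l⟩ :=
  if_neg h

theorem homOf_numDir (i : Fin (m + 1)) (k : Fin m) (ε : Bool) (l : Fin m) (z w : Fin m → ℂ) :
    homOf (i.insertNth (1 : ℂ) z) (fibreVec k ε w) (dirVec k w) (numDir i k ε l).1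
      (numDir i k ε l).2 = w l := by
  by_cases hl : l = k
  · subst hl
    rw [numDir_self]
    match ε with
    | false =>
      refine (homOf_some _ _ _ _ _).trans ?_
      rw [Fin.insertNth_apply_same, fibreVec_castSucc, dirVec_self]
      simp
    | true => exact (homOf_last _ _ _).trans (fibreVec_last _ _ _)
  · rw [numDir_of_ne _ _ hl]
    exact (homOf_none _ _ _ _).trans (dirVec_of_ne hl _)

/-- The coordinate along the fibres over the product of projective spaces. -/
def fibreCoord (i : Fin (m + 1)) (k : Fin m) (ε : Bool) (x : XSpace m) : ℂ :=
  if ε then YSpace.last x.pt / (x.pt.base.rep i * x.pt.line.rep.1 k)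
  else x.pt.base.rep i * x.pt.line.rep.1 k / YSpace.last x.pt

/-- The coordinates of the direction, and the coordinate along the fibre in place of the trivial
one. -/
def dirCoord (i : Fin (m + 1)) (k : Fin m) (ε : Bool) (x : XSpace m) : Fin m → ℂ :=
  Function.update (fun l => x.dir.rep l / x.dir.rep k) k (fibreCoord i k ε x)

theorem ofCoord_coord {i : Fin (m + 1)} {k : Fin m} {ε : Bool} {x : XSpace m}
    (hx : ∀ r, hom x r (base i k ε r) ≠ 0) :
    ofCoord i k ε (CP.chart m i x.pt.base) (dirCoord i k ε x) = x := by
  have hi : x.pt.base.rep i ≠ 0 := hx (some false)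
  have hk : x.dir.rep k ≠ 0 := hx none
  have hε := hx (some true)
  have hdir : dirVec k (dirCoord i k ε x) = (x.dir.rep k)⁻¹ • x.dir.rep := by
    funext l
    by_cases h : l = k
    · subst h
      simp [hk]
    · rw [dirVec_of_ne h, dirCoord, Function.update_of_ne h, Pi.smul_apply, smul_eq_mul,
        div_eq_inv_mul]
  obtain ⟨a, ha⟩ := x.exists_smul
  refine ext_of ?_ ?_
  · refine Eq.trans ?_ (YSpace.ofCoord_coord i x.pt hi)
    have hself : dirCoord i k ε x k = fibreCoord i k ε x := Function.update_self _ _ _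
    match ε with
    | false =>
      have ht : YSpace.last x.pt ≠ 0 := hε
      refine YSpace.ofCoord_congr i ((CP.chart m i).map_target (Set.mem_univ _)) hi
        (fibreVec_ne_zero _ _ _) (YSpace.coord_ne_zero i x.pt hi) ((CP.chart m i).left_inv hi)
        -- The last coordinate is `t / x_i`; this factor normalizes it to 1.
        (x.pt.base.rep i / YSpace.last x.pt) ?_
      funext b
      refine Fin.lastCases ?_ (fun l => ?_) b
      · rw [Pi.smul_apply, smul_eq_mul, YSpace.coord_last, fibreVec_last]
        simp only [Bool.false_eq_true, if_false]
        field_simp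
      · rw [Pi.smul_apply, smul_eq_mul, YSpace.coord_castSucc, fibreVec_castSucc, hdir, hself]
        simp only [Bool.false_eq_true, if_false, fibreCoord, Pi.smul_apply, smul_eq_mul, ha]
        field_simp
    | true =>
      have hv : x.pt.base.rep i * x.pt.line.rep.1 k ≠ 0 := hε
      have hv' : x.pt.line.rep.1 k ≠ 0 := right_ne_zero_of_mul hv
      have ha0 : a ≠ 0 := fun h => hv' (by rw [ha, h, zero_mul])
      refine YSpace.ofCoord_congr i ((CP.chart m i).map_target (Set.mem_univ _)) hi
        (fibreVec_ne_zero _ _ _) (YSpace.coord_ne_zero i x.pt hi) ((CP.chart m i).left_inv hi)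
        -- Here the coordinate `v_k` is the one to be normalized to 1.
        (x.pt.line.rep.1 k)⁻¹ ?_
      funext b
      refine Fin.lastCases ?_ (fun l => ?_) b
      · rw [Pi.smul_apply, smul_eq_mul, YSpace.coord_last, fibreVec_last, hself]
        simp only [if_true, fibreCoord]
        field_simp
      · rw [Pi.smul_apply, smul_eq_mul, YSpace.coord_castSucc, fibreVec_castSucc, hdir]
        simp only [if_true, one_mul, Pi.smul_apply, smul_eq_mul, ha]
        field_simp
  · exact ((Projectivization.mk_eq_mk_iff' ℂ _ _ (dirVec_ne_zero _ _) x.dir.rep_nonzero).2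
      ⟨_, hdir.symm⟩).trans x.dir.mk_rep

/-- The indices `i` and `k` are taken where `‖x_i‖` and `‖q_k‖` are maximal, and `ε` records which
of `x_i v_k` and `t` is larger. All coordinates in the resulting chart then have norm at most 1, as
compactness requires. -/
theorem exists_base (x : XSpace m) : ∃ i k ε, (∀ r, hom x r (base i k ε r) ≠ 0) ∧
    (∀ a, ‖x.pt.base.rep a‖ ≤ ‖x.pt.base.rep i‖) ∧ (∀ l, ‖x.dir.rep l‖ ≤ ‖x.dir.rep k‖) ∧
    ‖fibreCoord i k ε x‖ ≤ 1 := by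
  obtain ⟨i, hi, hi'⟩ := YSpace.exists_norm_max x.pt.base.rep_nonzero
  obtain ⟨k, hk, hk'⟩ := YSpace.exists_norm_max x.dir.rep_nonzero
  by_cases hle : ‖x.pt.base.rep i * x.pt.line.rep.1 k‖ ≤ ‖YSpace.last x.pt‖
  · refine ⟨i, k, false, fun r => ?_, hi', hk', ?_⟩
    · match r with
      | none => exact hk
      | some false => exact hi
      | some true =>
        -- If `t = 0`, the inequality forces `v_k = 0`. Since `v` is a multiple of `q` and `q_k ≠
        -- 0`, all of `v` vanishes, so the line would have no non-zero coordinate.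
        intro h0
        have h0' : YSpace.last x.pt = 0 := h0
        rw [h0', norm_zero, norm_le_zero_iff] at hle
        have hv := (mul_eq_zero.1 hle).resolve_left hi
        obtain ⟨a, ha⟩ := x.exists_smul
        have ha0 : a = 0 := (mul_eq_zero.1 ((ha k).symm.trans hv)).resolve_right hk
        refine YSpace.coord_ne_zero i x.pt hi (funext fun b => ?_)
        refine Fin.lastCases ?_ (fun l => ?_) b
        · rw [YSpace.coord_last, h0', mul_zero]
          rfl
        · rw [YSpace.coord_castSucc, ha, ha0, zero_mul]
          rfl
    · simp only [fibreCoord, Bool.false_eq_true, if_false]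
      rw [norm_div]
      exact div_le_one_of_le₀ hle (norm_nonneg _)
  · have hlt := not_le.1 hle
    refine ⟨i, k, true, fun r => ?_, hi', hk', ?_⟩
    · match r with
      | none => exact hk
      | some false => exact hi
      | some true =>
        change x.pt.base.rep i * x.pt.line.rep.1 k ≠ 0
        exact norm_pos_iff.1 ((norm_nonneg _).trans_lt hlt)
    · simp only [fibreCoord, if_true]
      rw [norm_div]
      exact div_le_one_of_le₀ hlt.le (norm_nonneg _)

/-- The cover of the blow-up by affine spaces. -/
def cover (m : ℕ) : ToricCover (XSpace m) (Fin (m + 1) × Fin m × Bool) (Fin m ⊕ Fin m)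
    (Option Bool) (Index m) where
  s r x := hom x r
  β j := base j.1 j.2.1 j.2.2
  χ j z := ofCoord j.1 j.2.1 j.2.2 (fun k => z (Sum.inl k)) fun k => z (Sum.inr k)
  mon j r b z := homOf (j.1.insertNth (1 : ℂ) fun k => z (Sum.inl k))
    (fibreVec j.2.1 j.2.2 fun k => z (Sum.inr k)) (dirVec j.2.1 fun k => z (Sum.inr k)) r b
  contDiff_mon j r b := by
    have hr : ContDiff ℂ ω fun (z : Fin m ⊕ Fin m → ℂ) k => z (Sum.inr k) :=
      contDiff_pi.2 fun k => contDiff_apply ℂ ℂ _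
    match r with
    | none => exact (contDiff_dirVec _ _).comp hr
    | some r =>
      exact YSpace.contDiff_homOf
        (fun a => (contDiff_insertNth _ a).comp (contDiff_pi.2 fun k => contDiff_apply ℂ ℂ _))
        (fun a => (contDiff_fibreVec _ _ a).comp hr) r b
  mon_mul j r b z z' := by
    match r with
    | none => exact congrFun (dirVec_mul j.2.1 (fun k => z (Sum.inr k)) fun k => z' (Sum.inr k)) b
    | some r =>
      refine Eq.trans ?_ (YSpace.homOf_mul _ _ _ _ r b)
      rw [← YSpace.insertNth_mul, ← fibreVec_mul]
      rfl
  mon_one j r b := by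
    match r with
    | none => exact congrFun (dirVec_one j.2.1) b
    | some r =>
      refine Eq.trans ?_ (YSpace.homOf_one r b)
      change YSpace.homOf (j.1.insertNth (1 : ℂ) (1 : Fin m → ℂ)) (fibreVec j.2.1 j.2.2 1) r b = _
      rw [YSpace.insertNth_one, fibreVec_one]
  mon_β j r z := by
    obtain ⟨i, k, ε⟩ := j
    match r, ε with
    | none, _ => exact (homOf_none _ _ _ _).trans (dirVec_self _ _)
    | some false, _ => exact (homOf_base _ _ _ _).trans (Fin.insertNth_apply_same _ _ _)
    | some true, false => exact (homOf_last _ _ _).trans (fibreVec_last _ _ _)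
    | some true, true =>
      refine (homOf_some _ _ _ _ _).trans ?_
      rw [Fin.insertNth_apply_same, fibreVec_castSucc, dirVec_self]
      simp
  s_χ j z r := by
    match r with
    | none =>
      obtain ⟨a, ha⟩ := Projectivization.exists_smul_eq_mk_rep ℂ _
        (dirVec_ne_zero j.2.1 fun k => z (Sum.inr k))
      exact ⟨a, a.ne_zero, fun b => (congrFun ha b).symm⟩
    | some r =>
      exact YSpace.hom_ofCoord j.1 _ ((CP.chart m j.1).map_target (Set.mem_univ _)) _
        (fibreVec_ne_zero _ _ _) r
  num j
    | Sum.inl k => ⟨some false, j.1.succAbove k⟩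
    | Sum.inr l => numDir j.1 j.2.1 j.2.2 l
  mon_num j c z := by
    obtain ⟨i, k, ε⟩ := j
    match c with
    | Sum.inl k => exact (homOf_base _ _ _ _).trans (Fin.insertNth_apply_succAbove _ _ _ _)
    | Sum.inr l => exact homOf_numDir _ _ _ _ _ _
  surj j x hx := ⟨Sum.elim (CP.chart m j.1 x.pt.base) (dirCoord j.1 j.2.1 j.2.2 x),
    ofCoord_coord hx⟩
  cover x := by
    obtain ⟨i, k, ε, hx, hi, hk, hε⟩ := x.exists_base
    refine ⟨(i, k, ε), Sum.elim (CP.chart m i x.pt.base) (dirCoord i k ε x), ofCoord_coord hx,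
      (pi_norm_le_iff_of_nonneg zero_le_one).2 fun c => ?_⟩
    match c with
    | Sum.inl k => exact YSpace.norm_ratio_le_one hi _
    | Sum.inr l =>
      change ‖dirCoord i k ε x l‖ ≤ 1
      by_cases hl : l = k
      · subst hl
        rw [dirCoord, Function.update_self]
        exact hε
      · rw [dirCoord, Function.update_of_ne hl, norm_div]
        exact div_le_one_of_le₀ (hk l) (norm_nonneg _)

theorem cover_mon_none (i : Fin (m + 1)) (k : Fin m) (ε : Bool) (z : Fin m ⊕ Fin m → ℂ)
    (l : Fin m) : (cover m).mon (i, k, ε) none l z = dirVec k (fun k => z (Sum.inr k)) l :=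
  rfl

theorem cover_mon_base (i : Fin (m + 1)) (k : Fin m) (ε : Bool) (z : Fin m ⊕ Fin m → ℂ)
    (a : Fin (m + 1)) : (cover m).mon (i, k, ε) (some false) a z =
      (i.insertNth (1 : ℂ) (fun k => z (Sum.inl k)) : Fin (m + 1) → ℂ) a :=
  rfl

theorem cover_mon_last (i : Fin (m + 1)) (k : Fin m) (ε : Bool) (z : Fin m ⊕ Fin m → ℂ) :
    (cover m).mon (i, k, ε) (some true) (none : Option (Fin (m + 1) × Fin m)) z =
      fibreVec k ε (fun k => z (Sum.inr k)) (Fin.last m) :=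
  rfl

theorem cover_mon_some (i : Fin (m + 1)) (k : Fin m) (ε : Bool) (z : Fin m ⊕ Fin m → ℂ)
    (a : Fin (m + 1)) (l : Fin m) :
    (cover m).mon (i, k, ε) (some true) (some (a, l) : Option (Fin (m + 1) × Fin m)) z =
      (i.insertNth (1 : ℂ) (fun k => z (Sum.inl k)) : Fin (m + 1) → ℂ) a *
        fibreVec k ε (fun k => z (Sum.inr k)) l.castSucc :=
  rfl

end XSpace

instance (m : ℕ) : TopologicalSpace (XSpace m) :=
  ((XSpace.cover m).holAtlas (modelEquiv m)).core.toTopologicalSpace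

instance (m : ℕ) : ChartedSpace (YModel m) (XSpace m) :=
  ((XSpace.cover m).holAtlas (modelEquiv m)).core.toChartedSpace

instance (m : ℕ) : IsManifold 𝓘(ℂ, YModel m) ω (XSpace m) :=
  ((XSpace.cover m).holAtlas (modelEquiv m)).isManifold

/-! ### The anticanonical degree of the blow-up -/

namespace XSpace

variable {m : ℕ}

theorem isHolo (m : ℕ) : (cover m).IsHolo (YModel m) := (cover m).isHolo (modelEquiv m)

instance (m : ℕ) : T2Space (XSpace m) := (isHolo m).t2Space

/-- The anticanonical degree of the blow-up. -/
def degree (m : ℕ) : Option Bool → ℕ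
  | none => m - 1
  | some false => m
  | some true => 2

/-- With `v = a * q`, the expression equals `∏ x_b * (a * ∏ q_k) * t` in every chart. The coordinate
along the fibre times the square of its denominator is `x_i v_k t`, whichever of the two is the
denominator, whence degree 2. It uses one factor `x_i` and turns `v_k` into `a * q_k`, leaving
degrees `m` and `m - 1` for the other families. -/
theorem isAnticanonicalDegree (m : ℕ) : (cover m).IsAnticanonicalDegree (degree m) := by
  have key : ∀ j, ∀ x ∈ (cover m).U j, ∀ a : ℂ, (∀ k, x.pt.line.rep.1 k = a * x.dir.rep k) →
      (∏ c, (cover m).ψ j x c) * ∏ r, (cover m).s r x ((cover m).β j r) ^ degree m r =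
        (∏ b, x.pt.base.rep b) * (a * ∏ k, x.dir.rep k) * YSpace.last x.pt := by
    rintro ⟨i, k, ε⟩ x hx a ha
    have hi : x.pt.base.rep i ≠ 0 := hx (some false)
    have hk : x.dir.rep k ≠ 0 := hx none
    have h1 : (∏ c, (cover m).ψ (i, k, ε) x (Sum.inl c)) * x.pt.base.rep i ^ m =
        ∏ c, x.pt.base.rep (i.succAbove c) := by
      change (∏ c, x.pt.base.rep (i.succAbove c) / x.pt.base.rep i) * _ = _
      rw [Finset.prod_div_distrib, Finset.prod_const, Finset.card_univ, Fintype.card_fin]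
      field_simp
    have hself : (cover m).ψ (i, k, ε) x (Sum.inr k) *
        hom x (some true) (base i k ε (some true)) ^ 2 =
          x.pt.base.rep i * x.pt.line.rep.1 k * YSpace.last x.pt := by
      have h0 : hom x (some true) (base i k ε (some true)) ≠ 0 := hx (some true)
      have h2 : (cover m).ψ (i, k, ε) x (Sum.inr k) =
          hom x (some true) (base i k (!ε) (some true)) /
            hom x (some true) (base i k ε (some true)) := by
        have hnum : (cover m).num (i, k, ε) (Sum.inr k) =
          ⟨some true, base i k (!ε) (some true)⟩ := numDir_self i k ε
        rw [ToricCover.ψ, hnum]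
        rfl
      rw [h2]
      match ε with
      | false =>
        have ht : YSpace.last x.pt ≠ 0 := h0
        change x.pt.base.rep i * x.pt.line.rep.1 k / YSpace.last x.pt * YSpace.last x.pt ^ 2 = _
        field_simp
      | true =>
        have ht : x.pt.base.rep i * x.pt.line.rep.1 k ≠ 0 := h0
        change YSpace.last x.pt / (x.pt.base.rep i * x.pt.line.rep.1 k) *
          (x.pt.base.rep i * x.pt.line.rep.1 k) ^ 2 = _
        rw [div_mul_eq_mul_div, sq, ← mul_assoc, mul_div_cancel_right₀ _ ht, mul_comm]
    have h3 : (∏ l ∈ Finset.univ.erase k, (cover m).ψ (i, k, ε) x (Sum.inr l)) *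
        x.dir.rep k ^ (m - 1) = ∏ l ∈ Finset.univ.erase k, x.dir.rep l := by
      have h4 : ∏ l ∈ Finset.univ.erase k, (cover m).ψ (i, k, ε) x (Sum.inr l) =
          ∏ l ∈ Finset.univ.erase k, x.dir.rep l / x.dir.rep k := by
        refine Finset.prod_congr rfl fun l hl => ?_
        have hl' : l ≠ k := Finset.ne_of_mem_erase hl
        have hnum : (cover m).num (i, k, ε) (Sum.inr l) = ⟨none, l⟩ :=
          numDir_of_ne i ε hl'
        rw [ToricCover.ψ, hnum]
        rfl
      rw [h4, Finset.prod_div_distrib, Finset.prod_const,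
        Finset.card_erase_of_mem (Finset.mem_univ k), Finset.card_univ, Fintype.card_fin]
      field_simp
    rw [Fintype.prod_sum_type, Fintype.prod_option, Fintype.prod_bool,
      ← Finset.mul_prod_erase Finset.univ (fun l => (cover m).ψ (i, k, ε) x (Sum.inr l))
        (Finset.mem_univ k),
      ← Finset.mul_prod_erase Finset.univ (fun l => x.dir.rep l) (Finset.mem_univ k),
      Fin.prod_univ_succAbove _ i, ← h1, ← h3, ← mul_assoc a, ← ha k]
    change _ * _ * (x.dir.rep k ^ (m - 1) *
      (hom x (some true) (base i k ε (some true)) ^ 2 * x.pt.base.rep i ^ m)) = _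
    linear_combination (∏ c, (cover m).ψ (i, k, ε) x (Sum.inl c)) *
      (∏ l ∈ Finset.univ.erase k, (cover m).ψ (i, k, ε) x (Sum.inr l)) *
      x.dir.rep k ^ (m - 1) * x.pt.base.rep i ^ m * hself
  intro j j' x hx
  obtain ⟨a, ha⟩ := x.exists_smul
  exact (key j x hx.1 a ha).trans (key j' x hx.2 a ha).symm

end XSpace

/-! ### Transport along a biholomorphic map -/

namespace ToricCover

variable {M M' ι κ R : Type} {B : R → Type} [Fintype κ] (D : ToricCover M ι κ R B)

/-- The cover of a set in bijection with `M`. -/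
def transport (e : M' ≃ M) : ToricCover M' ι κ R B where
  s r x := D.s r (e x)
  β := D.β
  χ i z := e.symm (D.χ i z)
  mon := D.mon
  contDiff_mon := D.contDiff_mon
  mon_mul := D.mon_mul
  mon_one := D.mon_one
  mon_β := D.mon_β
  s_χ i z r := by
    rw [e.apply_symm_apply]
    exact D.s_χ i z r
  num := D.num
  mon_num := D.mon_num
  surj i x hx := by
    obtain ⟨z, hz⟩ := D.surj i (e x) hx
    exact ⟨z, by rw [hz, e.symm_apply_apply]⟩
  cover x := by
    obtain ⟨i, z, hz, hz'⟩ := D.cover (e x)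
    exact ⟨i, z, by rw [hz, e.symm_apply_apply], hz'⟩

variable {D}

theorem IsAnticanonicalDegree.transport [Fintype R] {n : R → ℕ} (h : D.IsAnticanonicalDegree n)
    (e : M' ≃ M) : (D.transport e).IsAnticanonicalDegree n :=
  fun i j x hx => h i j (e x) hx

variable {F F' : Type} [NormedAddCommGroup F] [NormedSpace ℂ F] [NormedAddCommGroup F']
  [NormedSpace ℂ F'] [TopologicalSpace M] [ChartedSpace F M] [TopologicalSpace M']
  [ChartedSpace F' M']

theorem IsHolo.transport (h : D.IsHolo F) (e : M' ≃ M)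
    (he : ContMDiff 𝓘(ℂ, F') 𝓘(ℂ, F) ω e) (he' : ContMDiff 𝓘(ℂ, F) 𝓘(ℂ, F') ω e.symm) :
    (D.transport e).IsHolo F' where
  contMDiff_χ i := he'.comp (h.contMDiff_χ i)
  isOpen_ne r b := (h.isOpen_ne r b).preimage he.continuous
  contMDiffOn_ratio r b b' := (h.contMDiffOn_ratio r b b').comp he.contMDiffOn fun _ hx => hx

end ToricCover

/-! ### The pseudo-index of the blow-up -/

namespace XSpace

variable {m : ℕ} {F X : Type} [NormedAddCommGroup F] [NormedSpace ℂ F]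
  [TopologicalSpace X] [ChartedSpace F X] (e : X ≃ XSpace m)
  (h : ((cover m).transport e).IsHolo F)
include h

theorem finrank_eq (hm : 0 < m) : Module.finrank ℂ F = 2 * m := by
  obtain ⟨A⟩ := h.exists_continuousLinearEquiv (0, ⟨0, hm⟩, false)
  rw [← A.toLinearEquiv.finrank_eq, Module.finrank_fintype_fun_eq_card, Fintype.card_sum,
    Fintype.card_fin, two_mul]

variable [FiniteDimensional ℂ F] [IsManifold 𝓘(ℂ, F) ω X]

theorem isFano (hm : 2 ≤ m) : IsFano F X :=
  h.isFano ((isAnticanonicalDegree m).transport e)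
    (fun r => by
      match r with
      | none => change 0 < m - 1; omega
      | some false => change 0 < m; omega
      | some true => exact two_pos) (0, ⟨0, by omega⟩, false)

/-- The curve is a fibre of the blow-up over `ℙ^m × ℙ^(m-1)`: base point and direction are fixed,
and only the fibre family, of degree 2, varies. -/
theorem two_mem_rationalCurveDegrees (hm : 0 < m) : (2 : ℤ) ∈ rationalCurveDegrees F X := by
  refine h.mem_rationalCurveDegrees ((isAnticanonicalDegree m).transport e)
    (0, ⟨0, hm⟩, false) (0, ⟨0, hm⟩, true) (Sum.inr ⟨0, hm⟩) (Sum.inr ⟨0, hm⟩) (some true)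
    ?_ ?_ ?_ ?_ ?_
  · intro r hr
    match r with
    | none => rfl
    | some false => rfl
    | some true => exact absurd rfl hr
  · intro u
    refine (cover_mon_some _ _ _ _ _ _).trans ?_
    rw [Fin.insertNth_apply_same, fibreVec_castSucc, dirVec_self]
    simp
  · intro u
    refine (cover_mon_last _ _ _ _).trans ?_
    rw [fibreVec_last]
    simp
  · intro r b u hb hb'
    match r, b with
    | none, b =>
      refine (cover_mon_none _ _ _ _ _).trans ((dirVec_of_ne hb' _).trans ?_)
      exact Pi.single_eq_of_ne (M := fun _ : Fin m ⊕ Fin m => ℂ) (Sum.inr_injective.ne hb') u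
    | some false, b =>
      refine (cover_mon_base _ _ _ _ _).trans ?_
      rw [YSpace.single_inr_comp_inl]
      exact YSpace.insertNth_zero_ne hb'
    | some true, none => exact absurd rfl hb'
    | some true, some (a, l) =>
      refine (cover_mon_some _ _ _ _ _ _).trans ?_
      rw [YSpace.single_inr_comp_inl, YSpace.single_inr_comp_inr, fibreVec_castSucc]
      by_cases ha : a = 0
      · have hl : l ≠ ⟨0, hm⟩ := fun hl => hb rfl (by subst ha hl; rfl)
        rw [dirVec_of_ne hl, Pi.single_eq_of_ne hl, mul_zero, mul_zero]
      · rw [YSpace.insertNth_zero_ne ha, zero_mul]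
  · intro r b u hb hb'
    match r, b with
    | none, b =>
      refine (cover_mon_none _ _ _ _ _).trans ((dirVec_of_ne hb' _).trans ?_)
      exact Pi.single_eq_of_ne (M := fun _ : Fin m ⊕ Fin m => ℂ) (Sum.inr_injective.ne hb') u
    | some false, b =>
      refine (cover_mon_base _ _ _ _ _).trans ?_
      rw [YSpace.single_inr_comp_inl]
      exact YSpace.insertNth_zero_ne hb'
    | some true, none => exact absurd rfl (hb rfl)
    | some true, some (a, l) =>
      refine (cover_mon_some _ _ _ _ _ _).trans ?_
      rw [YSpace.single_inr_comp_inl, YSpace.single_inr_comp_inr, fibreVec_castSucc]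
      by_cases ha : a = 0
      · have hl : l ≠ ⟨0, hm⟩ := fun hl => hb' (by subst ha hl; rfl)
        rw [dirVec_of_ne hl, Pi.single_eq_of_ne hl, mul_zero, mul_zero]
      · rw [YSpace.insertNth_zero_ne ha, zero_mul]

/-- The bound `3 ≤ m` is what makes the direction degree `m - 1` at least 2. -/
theorem hasPseudoIndex_two (hm : 3 ≤ m) : HasPseudoIndex F X 2 :=
  h.hasPseudoIndex_two ((isAnticanonicalDegree m).transport e)
    (fun r => by
      match r with
      | none => change 2 ≤ m - 1; omega
      | some false => change 2 ≤ m; omega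
      | some true => exact le_rfl) (0, ⟨0, by omega⟩, false)
    (two_mem_rationalCurveDegrees e h (by omega))

end XSpace

theorem XSpace.hasPseudoIndex_one {F X : Type} [NormedAddCommGroup F] [NormedSpace ℂ F]
    [FiniteDimensional ℂ F] [TopologicalSpace X] [ChartedSpace F X] [IsManifold 𝓘(ℂ, F) ω X]
    (e : X ≃ XSpace 2) (h : ((cover 2).transport e).IsHolo F) : HasPseudoIndex F X 1 := by
  refine h.hasPseudoIndex_one ((isAnticanonicalDegree 2).transport e)
    (fun r => by
      match r with
      | none => exact one_pos
      | some false => exact two_pos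
      | some true => exact two_pos) (0, 0, false) ?_
  -- For `m = 2` the directions form a `ℙ¹` and their degree `m - 1` is 1. The curve is the fibre of
  -- the exceptional divisor over a point of `Z`: with `ε = false` and vanishing exceptional
  -- coordinate, only the direction moves.
  refine h.mem_rationalCurveDegrees ((isAnticanonicalDegree 2).transport e)
    (0, 0, false) (0, 1, false) (Sum.inr 1) (Sum.inr 0) none ?_ ?_ ?_ ?_ ?_
  · intro r hr
    match r with
    | none => exact absurd rfl hr
    | some false => rfl
    | some true => rfl
  · intro u
    change dirVec (0 : Fin 2) (fun k => Pi.single (M := fun _ : Fin 2 ⊕ Fin 2 => ℂ) (Sum.inr 1) u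
      (Sum.inr k)) (1 : Fin 2) = u
    rw [dirVec_of_ne (by decide), Pi.single_eq_same]
  · intro u
    change dirVec (1 : Fin 2) (fun k => Pi.single (M := fun _ : Fin 2 ⊕ Fin 2 => ℂ) (Sum.inr 0) u
      (Sum.inr k)) (0 : Fin 2) = u
    rw [dirVec_of_ne (by decide), Pi.single_eq_same]
  · intro r b u hb hb'
    match r, b with
    | none, b => exact absurd ((by decide : ∀ b : Fin 2, b ≠ 1 → b = 0) b (hb rfl)) hb'
    | some false, b =>
      refine (cover_mon_base _ _ _ _ _).trans ?_
      rw [YSpace.single_inr_comp_inl]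
      exact YSpace.insertNth_zero_ne hb'
    | some true, none => exact absurd rfl hb'
    | some true, some (a, l) =>
      refine (cover_mon_some _ _ _ _ _ _).trans ?_
      rw [YSpace.single_inr_comp_inr, fibreVec_castSucc]
      simp
  · intro r b u hb hb'
    match r, b with
    | none, b => exact absurd ((by decide : ∀ b : Fin 2, b ≠ 0 → b = 1) b (hb rfl)) hb'
    | some false, b =>
      refine (cover_mon_base _ _ _ _ _).trans ?_
      rw [YSpace.single_inr_comp_inl]
      exact YSpace.insertNth_zero_ne hb'
    | some true, none => exact absurd rfl hb'
    | some true, some (a, l) =>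
      refine (cover_mon_some _ _ _ _ _ _).trans ?_
      rw [YSpace.single_inr_comp_inr, fibreVec_castSucc]
      simp

/-! ### Division of a holomorphic function by a linear form -/

section Division

variable {E : Type} [NormedAddCommGroup E] [NormedSpace ℂ E]

/-- The quotient of the `n + 1`-st homogeneous part of a power series by a linear form, where `P`
is the projection to the kernel of the form along the vector `e`. -/
def quotientSeries (p : FormalMultilinearSeries ℂ E ℂ) (e : E) (P : E →L[ℂ] E) :
    FormalMultilinearSeries ℂ E ℂ := fun n =>
  ∑ j : Fin (n + 1), ContinuousMultilinearMap.compContinuousLinearMap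
    ((p (n + 1)).curryMid j e) fun i : Fin n => if i.castSucc < j then P else .id ℂ E

theorem norm_quotientSeries_le (p : FormalMultilinearSeries ℂ E ℂ) (e : E) (P : E →L[ℂ] E)
    (n : ℕ) : ‖quotientSeries p e P n‖ ≤ (n + 1) * (‖p (n + 1)‖ * ‖e‖ * (1 + ‖P‖) ^ n) := by
  have h : ∀ j : Fin (n + 1), ‖ContinuousMultilinearMap.compContinuousLinearMap
      ((p (n + 1)).curryMid j e) fun i : Fin n => if i.castSucc < j then P else .id ℂ E‖ ≤
        ‖p (n + 1)‖ * ‖e‖ * (1 + ‖P‖) ^ n := fun j => by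
    refine (ContinuousMultilinearMap.norm_compContinuousLinearMap_le _ _).trans ?_
    have h1 : ‖(p (n + 1)).curryMid j e‖ ≤ ‖p (n + 1)‖ * ‖e‖ := by
      rw [← ContinuousMultilinearMap.norm_curryMid j]
      exact ContinuousLinearMap.le_opNorm _ _
    have h2 : ∏ i : Fin n, ‖if i.castSucc < j then P else .id ℂ E‖ ≤ (1 + ‖P‖) ^ n := by
      refine (Finset.prod_le_prod (fun _ _ => norm_nonneg _) fun i _ => ?_).trans_eq
        (by rw [Finset.prod_const, Finset.card_univ, Fintype.card_fin])
      split_ifs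
      · linarith
      · linarith [ContinuousLinearMap.norm_id_le (𝕜 := ℂ) (E := E), norm_nonneg P]
    exact mul_le_mul h1 h2 (Finset.prod_nonneg fun _ _ => norm_nonneg _) (by positivity)
  refine (norm_sum_le _ _).trans ((Finset.sum_le_sum fun j _ => h j).trans_eq ?_)
  rw [Finset.sum_const, Finset.card_univ, Fintype.card_fin, nsmul_eq_mul]
  push_cast
  rfl

/-- The coefficient bound loses a factor `n + 1` and a power of `1 + ‖P‖`. The latter is compensated
in the radius, together with a factor 2 that uses `n + 1 ≤ 2 ^ n`. -/
theorem radius_quotientSeries_pos (p : FormalMultilinearSeries ℂ E ℂ) (e : E) (P : E →L[ℂ] E)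
    (hp : 0 < p.radius) : 0 < (quotientSeries p e P).radius := by
  obtain ⟨ρ, hρ0, hρ⟩ := ENNReal.lt_iff_exists_nnreal_btwn.1 hp
  have hρ0' : 0 < (ρ : ℝ) := by exact_mod_cast hρ0
  obtain ⟨K, hK, hpK⟩ := p.norm_mul_pow_le_of_lt_radius hρ
  have hC : 0 < 1 + ‖P‖ := by positivity
  let r : NNReal := ⟨ρ / (2 * (1 + ‖P‖)), by positivity⟩
  have hr : (r : ℝ) = ρ / (2 * (1 + ‖P‖)) := rfl
  have hr0 : 0 < r := by
    rw [← NNReal.coe_pos, hr]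
    positivity
  refine lt_of_lt_of_le (by exact_mod_cast hr0)
    ((quotientSeries p e P).le_radius_of_bound (K * ‖e‖ / ρ) (r := r) fun n => ?_)
  have h1 := norm_quotientSeries_le p e P n
  have h2 := hpK (n + 1)
  have h3 : ((n : ℝ) + 1) ≤ 2 ^ n := by exact_mod_cast Nat.lt_two_pow_self (n := n)
  calc _ ≤ (n + 1) * (‖p (n + 1)‖ * ‖e‖ * (1 + ‖P‖) ^ n) * (r : ℝ) ^ n := by gcongr
    _ = ((n + 1) / 2 ^ n) * ((‖p (n + 1)‖ * ρ ^ (n + 1)) * ‖e‖ / ρ) := by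
      rw [hr, div_pow, mul_pow, pow_succ]
      field_simp
    _ ≤ 1 * (K * ‖e‖ / ρ) := by
      refine mul_le_mul ((div_le_one (by positivity)).2 h3) (by gcongr) (by positivity) zero_le_one
    _ = _ := one_mul _

/-- The arguments `y` of the multilinear map are replaced one at a time by `y - l y • e`. Each
replacement changes the value by `l y` times a term with `e` in one slot, and the differences
telescope; the sum of these terms is the quotient series. -/
theorem quotientSeries_apply (p : FormalMultilinearSeries ℂ E ℂ) (l : E →L[ℂ] ℂ) (e : E) (n : ℕ)
    (y : E) : l y * quotientSeries p e (.id ℂ E - l.smulRight e) n (fun _ => y) =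
      p (n + 1) (fun _ => y) - p (n + 1) fun _ => y - l y • e := by
  let v : ℕ → Fin (n + 1) → E := fun j i => if (i : ℕ) < j then y - l y • e else y
  have key : ∀ j : Fin (n + 1), p (n + 1) (v j) - p (n + 1) (v (j + 1)) = l y *
      ContinuousMultilinearMap.compContinuousLinearMap ((p (n + 1)).curryMid j e)
        (fun i : Fin n => if i.castSucc < j then .id ℂ E - l.smulRight e else .id ℂ E)
          (fun _ => y) := fun j => by
    have h1 : v j = Function.update (v j) j y := by
      rw [Function.eq_update_iff]
      exact ⟨if_neg (lt_irrefl _), fun _ _ => rfl⟩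
    have h2 : v (j + 1) = Function.update (v j) j (y - l y • e) := by
      rw [Function.eq_update_iff]
      refine ⟨if_pos (Nat.lt_succ_self _), fun i hi => ?_⟩
      have hi' : (i : ℕ) ≠ j := fun h => hi (Fin.ext h)
      have : (i : ℕ) < j + 1 ↔ (i : ℕ) < j := by omega
      simp only [v, this]
    have h3 : Function.update (v j) j e = j.insertNth e fun i : Fin n =>
        (if i.castSucc < j then .id ℂ E - l.smulRight e else .id ℂ E : E →L[ℂ] E) y := by
      funext i
      refine Fin.succAboveCases j ?_ (fun k => ?_) i
      · simp
      · rw [Function.update_of_ne (Fin.succAbove_ne j k), Fin.insertNth_apply_succAbove]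
        by_cases hk : k.castSucc < j
        · have : ((j.succAbove k : Fin (n + 1)) : ℕ) < j := by
            rw [Fin.succAbove_of_castSucc_lt j k hk]
            exact hk
          simp [v, this, hk]
        · have : ¬ ((j.succAbove k : Fin (n + 1)) : ℕ) < j := by
            rw [Fin.succAbove_of_le_castSucc j k (not_lt.1 hk)]
            have := Fin.le_def.1 (not_lt.1 hk)
            simp at this ⊢
            omega
          simp [v, this, hk]
    have h4 := (p (n + 1)).map_update_sub (v j) j y (y - l y • e)
    rw [sub_sub_cancel, ContinuousMultilinearMap.map_update_smul, h3, ← h1, ← h2] at h4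
    exact h4.symm
  have h0 : v 0 = fun _ => y := funext fun i => if_neg (Nat.not_lt_zero _)
  have hn : v (n + 1) = fun _ => y - l y • e := funext fun i => if_pos i.2
  rw [quotientSeries, sum_apply, Finset.mul_sum,
    ← Finset.sum_congr rfl fun j _ => key j,
    Fin.sum_univ_eq_sum_range (fun j => p (n + 1) (v j) - p (n + 1) (v (j + 1))),
    Finset.sum_range_sub', h0, hn]

/-- A holomorphic function that vanishes where a linear form vanishes is divisible by it. -/
theorem exists_eq_mul_of_forall_eq_zero {f : E → ℂ} {x : E} (hf : AnalyticAt ℂ f x)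
    (l : E →L[ℂ] ℂ) (hl : l ≠ 0) (h0 : ∀ᶠ y in 𝓝 x, l y = 0 → f y = 0) :
    ∃ a : E → ℂ, AnalyticAt ℂ a x ∧ ∀ᶠ y in 𝓝 x, f y = a y * l y := by
  by_cases hx : l x = 0
  · obtain ⟨e, he⟩ : ∃ e, l e = 1 := by
      obtain ⟨e, he⟩ := DFunLike.ne_iff.1 hl
      exact ⟨(l e)⁻¹ • e, by
        rw [map_smul, smul_eq_mul]
        exact inv_mul_cancel₀ he⟩
    obtain ⟨p, hp⟩ := hf
    have hr : 0 < p.radius := by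
      obtain ⟨r, hr⟩ := hp
      exact hr.r_pos.trans_le hr.r_le
    set q := quotientSeries p e (.id ℂ E - l.smulRight e) with hq
    have hqs := (q.hasFPowerSeriesOnBall (radius_quotientSeries_pos p e _ hr)).hasFPowerSeriesAt
    have hP : Filter.Tendsto (fun y => y - l y • e) (𝓝 0) (𝓝 0) := by
      have : Continuous fun y => y - l y • e := by fun_prop
      simpa using this.tendsto 0
    have hxt : Filter.Tendsto (fun y => x + y) (𝓝 0) (𝓝 x) := by
      have : Continuous fun y => x + y := by fun_prop
      simpa using this.tendsto 0
    -- The projected point lies on the zero set of `l`, where `f` vanishes. Subtracting its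
    -- expansion from that of `f (x + y)` changes nothing and makes every homogeneous part divisible
    -- by `l y`.
    have hev : ∀ᶠ y in 𝓝 (0 : E), f (x + y) = q.sum y * l y := by
      filter_upwards [hp.eventually_hasSum, hP.eventually hp.eventually_hasSum,
        hqs.eventually_hasSum, (hxt.comp hP).eventually h0] with y h1 h2 h3 h4
      have hz : f (x + (y - l y • e)) = 0 := h4 (by simp [hx, he])
      rw [hz] at h2
      have h5 := (hasSum_nat_add_iff' 1).2 (h1.sub h2)
      simp only [Finset.range_one, Finset.sum_singleton] at h5
      have h6 : p 0 (fun _ => y) = p 0 fun _ => y - l y • e := congrArg _ (Subsingleton.elim _ _)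
      rw [h6, sub_self, sub_zero, sub_zero] at h5
      simp_rw [← quotientSeries_apply] at h5
      rw [zero_add] at h3
      rw [mul_comm]
      exact h5.unique (h3.mul_left (l y))
    have hsub : Filter.Tendsto (fun y => y - x) (𝓝 x) (𝓝 0) := by
      have : Continuous fun y => y - x := by fun_prop
      simpa using this.tendsto x
    refine ⟨fun y => q.sum (y - x), ?_, ?_⟩
    · refine AnalyticAt.fun_comp (g := q.sum) (f := fun y => y - x) ?_
        (analyticAt_id.sub analyticAt_const)
      simpa using hqs.analyticAt
    · filter_upwards [hsub.eventually hev] with y hy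
      rw [add_sub_cancel] at hy
      rw [hy, map_sub, hx, sub_zero]
  · refine ⟨fun y => f y / l y, hf.div (l.analyticAt x) hx, ?_⟩
    filter_upwards [l.continuous.continuousAt.eventually_ne hx] with y hy
    rw [div_mul_cancel₀ _ hy]

end Division

/-! ### The ideal of the centre -/

namespace YSpace

variable {m : ℕ}

theorem mem_center_iff (y : YSpace m) : y ∈ center m ↔ y.line.rep.1 = 0 := by
  constructor
  · intro h
    refine h _ ?_
    rw [Projectivization.submodule_eq y.line]
    exact Submodule.mem_span_singleton_self _
  · intro h v hv
    rw [Projectivization.submodule_eq y.line] at hv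
    obtain ⟨a, rfl⟩ := Submodule.mem_span_singleton.1 hv
    rw [Prod.smul_fst, h, smul_zero]

/-- The coordinates of the trivial summand on the `(i, j)`-th coordinate system. -/
def fibreRatio (i j : Fin (m + 1)) (y : YSpace m) (l : Fin m) : ℂ :=
  hom y true (some (i, l) : Option (Fin (m + 1) × Fin m)) / hom y true (fibreIndex i j)

theorem fibreRatio_apply (i j : Fin (m + 1)) (y : YSpace m) (l : Fin m) : fibreRatio i j y l =
    y.base.rep i / hom y true (fibreIndex i j) * y.line.rep.1 l :=
  mul_div_right_comm _ _ _

theorem fibreRatio_factor_ne_zero {i j : Fin (m + 1)} {y : YSpace m}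
    (hy : y ∈ (cover m).U (i, j)) : y.base.rep i / hom y true (fibreIndex i j) ≠ 0 :=
  div_ne_zero (hy false) (hy true)

theorem fibreRatio_eq_zero_iff {i j : Fin (m + 1)} {y : YSpace m} (hy : y ∈ (cover m).U (i, j)) :
    fibreRatio i j y = 0 ↔ y ∈ center m := by
  simp only [mem_center_iff, funext_iff, fibreRatio_apply, Pi.zero_apply, mul_eq_zero,
    fibreRatio_factor_ne_zero hy, false_or]

theorem contMDiffAt_fibreRatio {i j : Fin (m + 1)} {y : YSpace m} (hy : y ∈ (cover m).U (i, j))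
    (l : Fin m) : ContMDiffAt 𝓘(ℂ, YModel m) 𝓘(ℂ) ω (fun y => fibreRatio i j y l) y :=
  (isHolo m).contMDiffAt_ratio (r := true) (hy true)

theorem fibreRatio_mem_idealAt {i j : Fin (m + 1)} {y : YSpace m} (hy : y ∈ (cover m).U (i, j))
    (l : Fin m) : (fun y => fibreRatio i j y l) ∈ idealAt (YModel m) (center m) y := by
  refine ⟨contMDiffAt_fibreRatio hy l, Filter.Eventually.of_forall fun y' hy' => ?_⟩
  simp only [fibreRatio_apply, (mem_center_iff y').1 hy', Pi.zero_apply, mul_zero]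

theorem ψ_inr (i : Fin (m + 1)) (y : YSpace m) (l : Fin m) :
    (cover m).ψ (i, Fin.last m) y (Sum.inr l) = fibreRatio i (Fin.last m) y l := by
  change hom y true (fibreIndex i ((Fin.last m).succAbove l)) / _ = _
  rw [Fin.succAbove_last, fibreIndex_castSucc]
  rfl

theorem last_ne_zero_of_mem_center {y : YSpace m} (hy : y ∈ center m) : last y ≠ 0 := fun h0 => by
  obtain ⟨i, hi⟩ := exists_rep_ne_zero y.base
  refine coord_ne_zero i y hi (funext fun b => ?_)
  refine Fin.lastCases ?_ (fun l => ?_) b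
  · rw [coord_last, h0, mul_zero]
    rfl
  · rw [coord_castSucc, (mem_center_iff y).1 hy]
    rfl

theorem eq_last_of_mem_center {i j : Fin (m + 1)} {y : YSpace m} (hy : y ∈ (cover m).U (i, j))
    (hc : y ∈ center m) : j = Fin.last m := by
  have h := ((mem_U_iff _ _).1 hy).2
  revert h
  refine Fin.lastCases (fun _ => rfl) (fun l h => ?_) j
  exact absurd ((coord_castSucc _ _ _).trans (congrFun ((mem_center_iff y).1 hc) l)) h

theorem isClosed_center : IsClosed (center m) := by
  have : (center m)ᶜ = ⋃ (a : Fin (m + 1)) (l : Fin m),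
      {y | hom y true (some (a, l) : Option (Fin (m + 1) × Fin m)) ≠ 0} := by
    ext y
    simp only [Set.mem_compl_iff, mem_center_iff, Set.mem_iUnion, Set.mem_ofPred_eq]
    constructor
    · intro h
      obtain ⟨l, hl⟩ := Function.ne_iff.1 h
      obtain ⟨a, ha⟩ := exists_rep_ne_zero y.base
      exact ⟨a, l, mul_ne_zero ha hl⟩
    · rintro ⟨a, l, hal⟩ h
      exact hal ((congrArg (y.base.rep a * ·) (congrFun h l)).trans (mul_zero _))
  rw [← isOpen_compl_iff, this]
  exact isOpen_iUnion fun a => isOpen_iUnion fun l => 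
    (isHolo m).isOpen_ne true (some (a, l) : Option (Fin (m + 1) × Fin m))

/-- A holomorphic function that vanishes on the centre is bounded by the coordinates of the
trivial summand. -/
theorem isBigO_of_mem_idealAt {i j : Fin (m + 1)} {y : YSpace m} (hy : y ∈ (cover m).U (i, j))
    {h : YSpace m → ℂ} (hh : h ∈ idealAt (YModel m) (center m) y) :
    h =O[𝓝 y] fibreRatio i j := by
  by_cases hc : y ∈ center m
  · obtain rfl := eq_last_of_mem_center hy hc
    set χ := (cover m).χ (i, Fin.last m)
    set ψ := (cover m).ψ (i, Fin.last m)
    have hχψ : χ (ψ y) = y := (cover m).χ_ψ hy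
    have hχ : ContMDiff 𝓘(ℂ, Fin m ⊕ Fin m → ℂ) 𝓘(ℂ, YModel m) ω χ := (isHolo m).contMDiff_χ _
    have hF : ContDiffAt ℂ ω (fun z => h (χ z)) (ψ y) := by
      rw [← contMDiffAt_iff_contDiffAt]
      exact ContMDiffAt.comp (ψ y) (by rw [hχψ]; exact hh.1) hχ.contMDiffAt
    -- A local Lipschitz constant suffices: comparing a point with its projection `P` to the centre,
    -- where the function vanishes, bounds the value by the norm of the fibre coordinates.
    obtain ⟨K, t, ht, hK⟩ := (hF.of_le (m := 1) (by simp)).exists_lipschitzOnWith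
    let P : (Fin m ⊕ Fin m → ℂ) → Fin m ⊕ Fin m → ℂ := fun z =>
      Sum.elim (fun k => z (Sum.inl k)) fun _ => 0
    have hP : Continuous P := continuous_pi fun c => by
      match c with
      | Sum.inl k => exact continuous_apply _
      | Sum.inr k => exact continuous_const
    have hψ0 : ∀ l, ψ y (Sum.inr l) = 0 := fun l =>
      (ψ_inr i y l).trans (congrFun ((fibreRatio_eq_zero_iff hy).2 hc) l)
    have hPψ : P (ψ y) = ψ y := funext fun c => by
      match c with
      | Sum.inl k => rfl
      | Sum.inr k => exact (hψ0 k).symm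
    have hPt : Filter.Tendsto P (𝓝 (ψ y)) (𝓝 (ψ y)) := by
      simpa only [hPψ] using hP.tendsto (ψ y)
    have hχt : Filter.Tendsto χ (𝓝 (ψ y)) (𝓝 y) := by
      simpa only [hχψ] using hχ.continuous.tendsto (ψ y)
    have hcenter : ∀ z, χ (P z) ∈ center m := fun z => by
      refine (fibreRatio_eq_zero_iff ((cover m).χ_mem _ _)).1 (funext fun l => ?_)
      rw [← ψ_inr, (cover m).ψ_χ]
      rfl
    have hbound : ∀ᶠ z in 𝓝 (ψ y), ‖h (χ z)‖ ≤ K * ‖fun l => z (Sum.inr l)‖ := by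
      filter_upwards [ht, hPt ht, (hχt.comp hPt).eventually hh.2] with z h1 h2 h3
      have h4 := hK.dist_le_mul z h1 (P z) h2
      have h5 : h (χ (P z)) = 0 := h3 (hcenter z)
      rw [dist_eq_norm, dist_eq_norm, h5, sub_zero] at h4
      refine h4.trans (mul_le_mul_of_nonneg_left ?_ K.2)
      refine (pi_norm_le_iff_of_nonneg (norm_nonneg _)).2 fun c => ?_
      match c with
      | Sum.inl k => simp [P]
      | Sum.inr k =>
        simp only [P, Pi.sub_apply, Sum.elim_inr, sub_zero]
        exact norm_le_pi_norm (fun l => z (Sum.inr l)) k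
    refine Asymptotics.IsBigO.of_bound K ?_
    have hψ : ContinuousAt ψ y := ((isHolo m).contMDiffAt_ψ hy).continuousAt
    filter_upwards [hψ.eventually hbound, ((isHolo m).isOpen_U _).mem_nhds hy] with y' h1 h2
    have h3 : χ (ψ y') = y' := (cover m).χ_ψ h2
    rw [h3] at h1
    refine h1.trans_eq (congrArg (fun v : Fin m → ℂ => (K : ℝ) * ‖v‖) (funext fun l => ψ_inr i y' l))
  · have hne : fibreRatio i j y ≠ 0 := fun h0 => hc ((fibreRatio_eq_zero_iff hy).1 h0)
    have hcont : ContinuousAt (fibreRatio i j) y :=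
      continuousAt_pi.2 fun l => (contMDiffAt_fibreRatio hy l).continuousAt
    have hpos : 0 < ‖fibreRatio i j y‖ / 2 := half_pos (norm_pos_iff.2 hne)
    -- Off the centre the fibre coordinates are bounded away from zero, so local boundedness is
    -- enough.
    refine (hh.1.continuousAt.isBigO_one ℝ).trans
      (Asymptotics.IsBigO.of_bound (‖fibreRatio i j y‖ / 2)⁻¹ ?_)
    filter_upwards [hcont.norm.eventually (lt_mem_nhds (half_lt_self (norm_pos_iff.2 hne)))]
      with y' hy'
    rw [norm_one, inv_mul_eq_div, one_le_div hpos]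
    exact hy'.le

end YSpace

/-! ### The universal property of the blow-up -/

namespace XSpace

variable {m : ℕ}

/-- Off the centre the vector `v` is non-zero, so it spans the only line that can contain it. -/
theorem eq_of_pt_eq {x x' : XSpace m} (h : x.pt = x'.pt) (hx : x.pt ∉ center m) : x = x' := by
  refine ext_of h ?_
  rw [YSpace.mem_center_iff] at hx
  have key : ∀ q : ℙ ℂ (Fin m → ℂ), x.pt.line.rep.1 ∈ q.submodule →
      q = Projectivization.mk ℂ x.pt.line.rep.1 hx := fun q hq => by
    rw [Projectivization.submodule_eq] at hq
    obtain ⟨a, ha⟩ := Submodule.mem_span_singleton.1 hq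
    conv_lhs => rw [← q.mk_rep]
    exact ((Projectivization.mk_eq_mk_iff' ℂ _ _ _ _).2 ⟨a, ha⟩).symm
  rw [key x.dir x.mem, key x'.dir (by rw [h]; exact x'.mem)]

theorem contMDiff_pt : ContMDiff 𝓘(ℂ, YModel m) 𝓘(ℂ, YModel m) ω (pt : XSpace m → YSpace m) := by
  intro x
  obtain ⟨ij, hij⟩ := (YSpace.cover m).exists_mem_U x.pt
  refine (YSpace.isHolo m).contMDiffAt_of_ratio ij ?_ fun r b => ?_
  · have : IsOpen {x : XSpace m | x.pt ∈ (YSpace.cover m).U ij} := by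
      have h1 : {x : XSpace m | x.pt ∈ (YSpace.cover m).U ij} =
          ⋂ r, {x | (cover m).s (some r) x ((YSpace.cover m).β ij r) ≠ 0} := by
        ext x
        simp only [Set.mem_iInter]
        rfl
      rw [h1]
      exact isOpen_iInter_of_finite fun r => (isHolo m).isOpen_ne _ _
    exact this.mem_nhds hij
  · exact (isHolo m).contMDiffAt_ratio (r := some r) (hij r)

/-- Holomorphy is tested on ratios, so the scalar relating the chosen representative of the
direction to the holomorphic vector `a` may vary arbitrarily with the point. -/
theorem contMDiffAt_of_dir {G W : Type} [NormedAddCommGroup G] [NormedSpace ℂ G]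
    [TopologicalSpace W] [ChartedSpace G W] {f : W → XSpace m} {g : W → YSpace m} {w : W}
    (hg : ContMDiffAt 𝓘(ℂ, G) 𝓘(ℂ, YModel m) ω g w) {a : W → Fin m → ℂ}
    (ha : ∀ l, ContMDiffAt 𝓘(ℂ, G) 𝓘(ℂ) ω (fun w => a w l) w)
    (hfg : ∀ᶠ w' in 𝓝 w, (f w').pt = g w')
    (hfa : ∀ᶠ w' in 𝓝 w, ∃ c : ℂ, c ≠ 0 ∧ ∀ l, (f w').dir.rep l = c * a w' l) :
    ContMDiffAt 𝓘(ℂ, G) 𝓘(ℂ, YModel m) ω f w := by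
  obtain ⟨⟨i, k, ε⟩, hi⟩ := (cover m).exists_mem_U (f w)
  have hak : a w k ≠ 0 := by
    obtain ⟨c, hc, hc'⟩ := hfa.self_of_nhds
    have : (f w).dir.rep k ≠ 0 := hi none
    rw [hc'] at this
    exact right_ne_zero_of_mul this
  have hgw : (f w).pt = g w := hfg.self_of_nhds
  have hsome : ∀ r, YSpace.hom (g w) r (base i k ε (some r)) ≠ 0 := fun r => by
    rw [← hgw]
    exact hi (some r)
  refine (isHolo m).contMDiffAt_of_ratio (i, k, ε) ?_ fun r b => ?_
  · have h1 : ∀ᶠ w' in 𝓝 w, ∀ r, YSpace.hom (g w') r (base i k ε (some r)) ≠ 0 :=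
      Filter.eventually_all.2 fun r =>
        hg.continuousAt.eventually (((YSpace.isHolo m).isOpen_ne r _).mem_nhds (hsome r))
    filter_upwards [hfg, hfa, h1, (ha k).continuousAt.eventually_ne hak] with w' h2 h3 h4 h5 r
    match r with
    | none =>
      obtain ⟨c, hc, hc'⟩ := h3
      exact (hc' k).trans_ne (mul_ne_zero hc h5)
    | some r =>
      change YSpace.hom (f w').pt r _ ≠ 0
      rw [h2]
      exact h4 r
  · match r, b with
    | none, b =>
      refine ((ha b).div₀ (ha k) hak).congr_of_eventuallyEq ?_
      filter_upwards [hfa] with w' h3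
      obtain ⟨c, hc, hc'⟩ := h3
      exact (congrArg₂ (· / ·) (hc' b) (hc' k)).trans (mul_div_mul_left _ _ hc)
    | some r, b =>
      have h1 := ((YSpace.isHolo m).contMDiffAt_ratio (b := b) (hsome r)).comp w hg
      refine h1.congr_of_eventuallyEq ?_
      filter_upwards [hfg] with w' h2
      change YSpace.hom (f w').pt r b / YSpace.hom (f w').pt r _ = _
      rw [h2]
      rfl

theorem ψ_inr_self (i : Fin (m + 1)) (k : Fin m) (x : XSpace m) :
    (cover m).ψ (i, k, false) x (Sum.inr k) = YSpace.fibreRatio i (Fin.last m) x.pt k := by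
  have hnum : (cover m).num (i, k, false) (Sum.inr k) =
      ⟨some true, base i k true (some true)⟩ := numDir_self i k false
  rw [ToricCover.ψ, hnum, YSpace.fibreRatio, YSpace.fibreIndex_last]
  rfl

/-- Over the centre, the coordinate `w_k` of a chart with `ε = false` is a generator. As `v` is a
multiple of `q`, the hyperplane `w_k = 0` maps into the centre, and a function vanishing on the
centre pulls back to a multiple of `w_k`. -/
theorem pullsBackToDivisor_pt :
    PullsBackToDivisor (YModel m) (YModel m) (center m) (pt : XSpace m → YSpace m) := by
  intro x
  by_cases hc : x.pt ∈ center m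
  · obtain ⟨i, hi⟩ := exists_rep_ne_zero x.pt.base
    obtain ⟨k, hk⟩ : ∃ k, x.dir.rep k ≠ 0 := Function.ne_iff.1 x.dir.rep_nonzero
    have hlast := YSpace.last_ne_zero_of_mem_center hc
    have hx : x ∈ (cover m).U (i, k, false) := fun r => by
      match r with
      | none => exact hk
      | some false => exact hi
      | some true => exact hlast
    have hU : ∀ x' ∈ (cover m).U (i, k, false), x'.pt ∈ (YSpace.cover m).U (i, Fin.last m) :=
      fun x' hx' r => by
        match r with
        | false => exact hx' (some false)
        | true =>
          change YSpace.hom _ true (YSpace.fibreIndex i (Fin.last m)) ≠ 0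
          rw [YSpace.fibreIndex_last]
          exact hx' (some true)
    set χ := (cover m).χ (i, k, false)
    set ψ := (cover m).ψ (i, k, false)
    have hχψ : χ (ψ x) = x := (cover m).χ_ψ hx
    have hψχ : ∀ z, ψ (χ z) = z := fun z => (cover m).ψ_χ _ z
    have hχ : ContMDiff 𝓘(ℂ, Fin m ⊕ Fin m → ℂ) 𝓘(ℂ, YModel m) ω χ := (isHolo m).contMDiff_χ _
    have hψ : ContMDiffAt 𝓘(ℂ, YModel m) 𝓘(ℂ, Fin m ⊕ Fin m → ℂ) ω ψ x :=
      (isHolo m).contMDiffAt_ψ hx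
    have hχt : Filter.Tendsto χ (𝓝 (ψ x)) (𝓝 x) := by
      simpa only [hχψ] using hχ.continuous.tendsto (ψ x)
    have hpt : Filter.Tendsto pt (𝓝 x) (𝓝 x.pt) := contMDiff_pt.continuous.tendsto x
    have hcoord : ∀ z, YSpace.fibreRatio i (Fin.last m) (χ z).pt k = z (Sum.inr k) := fun z => by
      rw [← ψ_inr_self]
      exact congrFun (hψχ z) _
    refine ⟨fun y => YSpace.fibreRatio i (Fin.last m) y k,
      YSpace.fibreRatio_mem_idealAt (hU x hx) k, fun h0 => ?_, fun h hh => ?_⟩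
    · have h1 : ∀ᶠ z in 𝓝 (ψ x), z (Sum.inr k) = 0 := by
        filter_upwards [hχt.eventually h0] with z hz
        exact (hcoord z).symm.trans hz
      -- Moving along the `k`-th axis shows that the generator is not identically zero near the
      -- point.
      have h2 : Filter.Tendsto (fun t : ℂ => Function.update (ψ x) (Sum.inr k) (ψ x (Sum.inr k) + t))
          (𝓝 0) (𝓝 (ψ x)) := by
        have : Continuous fun t : ℂ =>
            Function.update (ψ x) (Sum.inr k) (ψ x (Sum.inr k) + t) := by fun_prop
        simpa using this.tendsto 0
      have h3 : ∀ᶠ t : ℂ in 𝓝 0, t = 0 := by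
        filter_upwards [h2.eventually h1] with t ht
        rw [Function.update_self, h1.self_of_nhds, zero_add] at ht
        exact ht
      obtain ⟨t, ht, ht'⟩ := ((h3.filter_mono nhdsWithin_le_nhds).and
        (eventually_mem_nhdsWithin (a := (0 : ℂ)) (s := {0}ᶜ))).exists
      exact ht' ht
    · have hF : AnalyticAt ℂ (fun z => h (χ z).pt) (ψ x) := by
        refine ContDiffAt.analyticAt ?_
        rw [← contMDiffAt_iff_contDiffAt]
        refine ContMDiffAt.comp (g := fun x : XSpace m => h x.pt) (ψ x) ?_ hχ.contMDiffAt
        rw [hχψ]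
        exact ContMDiffAt.comp x hh.1 contMDiff_pt.contMDiffAt
      obtain ⟨a, ha, ha'⟩ := exists_eq_mul_of_forall_eq_zero hF
        (ContinuousLinearMap.proj (R := ℂ) (φ := fun _ : Fin m ⊕ Fin m => ℂ) (Sum.inr k))
        (fun h0 => by simpa using DFunLike.congr_fun h0 (Pi.single (Sum.inr k) 1)) (by
          filter_upwards [(hpt.comp hχt).eventually hh.2] with z h1 h2
          refine h1 ((YSpace.mem_center_iff _).2 (funext fun l => ?_))
          obtain ⟨b, hb⟩ := (χ z).exists_smul
          have h3 := hcoord z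
          have hdir : ¬ (χ z).dir.rep k = 0 := (cover m).χ_mem (i, k, false) z none
          have hz : z (Sum.inr k) = 0 := h2
          rw [hz, YSpace.fibreRatio_apply, hb, mul_eq_zero, mul_eq_zero,
            or_iff_right (YSpace.fibreRatio_factor_ne_zero (hU _ ((cover m).χ_mem _ z))),
            or_iff_left hdir] at h3
          exact (hb l).trans (by rw [h3, zero_mul]; rfl))
      refine ⟨fun x' => a (ψ x'), ?_, ?_⟩
      · exact ContMDiffAt.comp x (ha.contDiffAt (n := ω)).contMDiffAt hψ
      · filter_upwards [hψ.continuousAt.eventually ha', ((isHolo m).isOpen_U _).mem_nhds hx]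
          with x' h1 h2
        have h3 : χ (ψ x') = x' := (cover m).χ_ψ h2
        rw [h3] at h1
        rw [h1, ← ψ_inr_self]
        rfl
  -- Away from the closed centre the ideal is the unit ideal, generated by 1.
  · refine ⟨fun _ => 1, ⟨contMDiffAt_const, ?_⟩, fun h0 => one_ne_zero h0.self_of_nhds,
      fun h hh => ⟨fun x' => h x'.pt, ContMDiffAt.comp x hh.1 contMDiff_pt.contMDiffAt,
        Filter.Eventually.of_forall fun _ => (mul_one _).symm⟩⟩
    filter_upwards [YSpace.isClosed_center.isOpen_compl.mem_nhds hc] with y' h1 h2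
    exact absurd h2 h1

/-! ### Lifting holomorphic maps to the blow-up -/

section Lift

variable {G W : Type} [NormedAddCommGroup G] [NormedSpace ℂ G] [TopologicalSpace W]
  [ChartedSpace G W] {g : W → YSpace m}

/-- Otherwise the generator `h₀ ∘ g`, which vanishes over the centre, would vanish identically near
`w`. This density makes lifts unique. -/
theorem frequently_notMem_center (hg : ContMDiff 𝓘(ℂ, G) 𝓘(ℂ, YModel m) ω g)
    (hd : PullsBackToDivisor (YModel m) G (center m) g) (w : W) : ∃ᶠ w' in 𝓝 w, g w' ∉ center m := by
  obtain ⟨h₀, hh, hne, -⟩ := hd w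
  intro h
  refine hne ?_
  filter_upwards [h, (hg.continuous.tendsto w).eventually hh.2] with w' h1 h2
  exact h2 (not_not.1 h1)

/-- Two local lifts have the same value. -/
theorem lift_unique {w : W} (hw : ∃ᶠ w' in 𝓝 w, g w' ∉ center m) {f f' : W → XSpace m}
    (hf : ContinuousAt f w) (hf' : ContinuousAt f' w) (h : ∀ᶠ w' in 𝓝 w, (f w').pt = g w')
    (h' : ∀ᶠ w' in 𝓝 w, (f' w').pt = g w') : f w = f' w := by
  by_contra hne
  obtain ⟨w', h1, h2, h3, h4⟩ :=
    (hw.and_eventually (h.and (h'.and ((hf.ne_iff_eventually_ne hf').1 hne)))).exists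
  exact h4 (eq_of_pt_eq (h2.trans h3.symm) (by rwa [h2]))

/-- Near `w` the fibre coordinates of `g` are `a_l * h₀ ∘ g` with holomorphic `a_l`. If some `a_l`
is non-zero at `w`, the point `[a]` of `ℙ^(m-1)` is a direction containing `v`, also where `h₀ ∘ g`
vanishes. -/
theorem exists_local_lift (hg : ContMDiff 𝓘(ℂ, G) 𝓘(ℂ, YModel m) ω g)
    (hd : PullsBackToDivisor (YModel m) G (center m) g) (w : W) :
    ∃ f : W → XSpace m, ContMDiffAt 𝓘(ℂ, G) 𝓘(ℂ, YModel m) ω f w ∧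
      ∀ᶠ w' in 𝓝 w, (f w').pt = g w' := by
  classical
  obtain ⟨⟨i, j⟩, hij⟩ := (YSpace.cover m).exists_mem_U (g w)
  obtain ⟨h₀, hh, hne, hdiv⟩ := hd w
  choose a ha ha' using fun l => hdiv _ (YSpace.fibreRatio_mem_idealAt hij l)
  have hgt := hg.continuous.tendsto w
  -- As `h₀` lies in the ideal, `‖h₀ ∘ g‖ ≤ C * ‖a‖ * ‖h₀ ∘ g‖`. If `a` vanished at `w`, then `C *
  -- ‖a‖ < 1` nearby would force `h₀ ∘ g = 0` there.
  obtain ⟨k, hk⟩ : ∃ k, a k w ≠ 0 := by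
    by_contra! h0
    obtain ⟨C, hC⟩ := (YSpace.isBigO_of_mem_idealAt hij hh).bound
    refine hne ?_
    have hcont : ContinuousAt (fun w' l => a l w') w :=
      continuousAt_pi.2 fun l => (ha l).continuousAt
    have hlim : Filter.Tendsto (fun w' => C * ‖fun l => a l w'‖) (𝓝 w) (𝓝 0) := by
      have h1 := (hcont.norm).const_mul C
      have h2 : (fun l => a l w) = 0 := funext h0
      simpa [ContinuousAt, h2] using h1
    filter_upwards [hgt.eventually hC, Filter.eventually_all.2 ha',
      hlim.eventually (gt_mem_nhds one_pos)] with w' h1 h2 h3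
    have h4 : YSpace.fibreRatio i j (g w') = h₀ (g w') • fun l => a l w' :=
      funext fun l => (h2 l).trans (mul_comm _ _)
    rw [h4, norm_smul, mul_left_comm] at h1
    by_contra h5
    have h6 := norm_pos_iff.2 h5
    nlinarith
  have hgood : ∀ᶠ w' in 𝓝 w, a k w' ≠ 0 ∧ ∃ c : ℂ, (c • fun l => a l w') = (g w').line.rep.1 := by
    filter_upwards [(ha k).continuousAt.eventually_ne hk, Filter.eventually_all.2 ha',
      hgt.eventually (((YSpace.isHolo m).isOpen_U _).mem_nhds hij)] with w' h1 h2 h3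
    refine ⟨h1, ((g w').base.rep i / YSpace.hom (g w') true (YSpace.fibreIndex i j))⁻¹ *
      h₀ (g w'), funext fun l => ?_⟩
    have h4 := h2 l
    rw [YSpace.fibreRatio_apply] at h4
    rw [Pi.smul_apply, smul_eq_mul, mul_assoc, mul_comm (h₀ _), ← h4,
      inv_mul_cancel_left₀ (YSpace.fibreRatio_factor_ne_zero h3)]
  let f : W → XSpace m := fun w' =>
    if H : (fun l => a l w') ≠ 0 ∧ ∃ c : ℂ, (c • fun l => a l w') = (g w').line.rep.1 then
      ⟨g w', Projectivization.mk ℂ (fun l => a l w') H.1, by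
        rw [Projectivization.submodule_mk]
        exact Submodule.mem_span_singleton.2 H.2⟩
    -- An arbitrary value, taken only outside the neighbourhood of `w` that matters.
    else (cover m).χ (i, k, false) 0
  have hgood' : ∀ᶠ w' in 𝓝 w, (fun l => a l w') ≠ 0 ∧
      ∃ c : ℂ, (c • fun l => a l w') = (g w').line.rep.1 := by
    filter_upwards [hgood] with w' h1
    exact ⟨fun h0 => h1.1 (congrFun h0 k), h1.2⟩
  have hfg : ∀ᶠ w' in 𝓝 w, (f w').pt = g w' := by
    filter_upwards [hgood'] with w' h1
    simp only [f, dif_pos h1]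
  refine ⟨f, contMDiffAt_of_dir hg.contMDiffAt ha hfg ?_, hfg⟩
  filter_upwards [hgood'] with w' h1
  obtain ⟨c, hc⟩ := Projectivization.exists_smul_eq_mk_rep ℂ _ h1.1
  refine ⟨c, c.ne_zero, fun l => ?_⟩
  simp only [f, dif_pos h1, ← hc]
  rfl

end Lift

theorem isBlowUp_pt :
    IsBlowUp (YModel m) (YModel m) (center m) (pt : XSpace m → YSpace m) where
  holo := contMDiff_pt
  divisor := pullsBackToDivisor_pt
  universal G W _ _ _ _ _ _ _ g hg hd := by
    have hfreq := frequently_notMem_center hg hd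
    choose f hf hfg using exists_local_lift hg hd
    have hpt : ∀ w, (f w w).pt = g w := fun w => (hfg w).self_of_nhds
    -- The global lift takes at each point the value of the local lift made there. Near `w` it
    -- coincides with `f w` by uniqueness, so it is holomorphic.
    refine ⟨fun w => f w w, ⟨fun w => ?_, funext hpt⟩, fun f' hf' => funext fun w => ?_⟩
    · refine (hf w).congr_of_eventuallyEq ?_
      filter_upwards [(contMDiffAt_iff_contMDiffAt_nhds (by simp)).1 (hf w), (hfg w).eventually_nhds] with w' h1 h2
      exact lift_unique (hfreq w') (hf w').continuousAt h1.continuousAt (hfg w') h2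
    · exact lift_unique (hfreq w) hf'.1.continuous.continuousAt (hf w).continuousAt
        (Filter.Eventually.of_forall fun w' => congrFun hf'.2 w') (hfg w)

end XSpace

/-! ### Uniqueness of the blow-up -/

theorem IsBlowUp.exists_equiv {E F F' X X' Y : Type} [NormedAddCommGroup E] [NormedSpace ℂ E]
    [NormedAddCommGroup F] [NormedSpace ℂ F] [FiniteDimensional ℂ F] [NormedAddCommGroup F']
    [NormedSpace ℂ F'] [FiniteDimensional ℂ F'] [TopologicalSpace X] [T2Space X] [ChartedSpace F X]
    [IsManifold 𝓘(ℂ, F) ω X] [TopologicalSpace X'] [T2Space X'] [ChartedSpace F' X']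
    [IsManifold 𝓘(ℂ, F') ω X'] [TopologicalSpace Y] [ChartedSpace E Y] {Z : Set Y} {π : X → Y}
    {π' : X' → Y} (h : IsBlowUp E F Z π) (h' : IsBlowUp E F' Z π') :
    ∃ e : X ≃ X', ContMDiff 𝓘(ℂ, F) 𝓘(ℂ, F') ω e ∧ ContMDiff 𝓘(ℂ, F') 𝓘(ℂ, F) ω e.symm := by
  obtain ⟨f, ⟨hf, hf'⟩, -⟩ := h'.universal F X π h.holo h.divisor
  obtain ⟨f', ⟨hf₁, hf₁'⟩, -⟩ := h.universal F' X' π' h'.holo h'.divisor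
  have h1 : f' ∘ f = id := (h.universal F X π h.holo h.divisor).unique
    ⟨hf₁.comp hf, by rw [← Function.comp_assoc, hf₁', hf']⟩ ⟨contMDiff_id, rfl⟩
  have h2 : f ∘ f' = id := (h'.universal F' X' π' h'.holo h'.divisor).unique
    ⟨hf.comp hf₁, by rw [← Function.comp_assoc, hf', hf₁']⟩ ⟨contMDiff_id, rfl⟩
  exact ⟨⟨f, f', congrFun h1, congrFun h2⟩, hf, hf₁⟩

/-! ### The section with image the centre -/

namespace YSpace

variable {m : ℕ}

theorem eq_of_mem_center {y y' : YSpace m} (hy : y ∈ center m) (hy' : y' ∈ center m)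
    (h : y.base = y'.base) : y = y' := by
  refine (cover m).ext_of_smul fun r => ?_
  match r with
  | false =>
    refine ⟨1, fun b => ?_⟩
    rw [one_mul]
    change y.base.rep b = y'.base.rep b
    rw [h]
  | true =>
    refine ⟨last y / last y', fun b => ?_⟩
    match b with
    | none => exact (div_mul_cancel₀ _ (last_ne_zero_of_mem_center hy')).symm
    | some (a, k) =>
      change y.base.rep a * y.line.rep.1 k = _ * (y'.base.rep a * y'.line.rep.1 k)
      rw [(mem_center_iff y).1 hy, (mem_center_iff y').1 hy']
      simp

/-- The section of `Y → ℙ^m` given by the summand `𝒪(1)`. -/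
def zeroSection (p : CP m) : YSpace m :=
  ofCoord (exists_rep_ne_zero p).choose p (exists_rep_ne_zero p).choose_spec
    (Pi.single (Fin.last m) 1) fun h => by simpa using congrFun h (Fin.last m)

theorem zeroSection_base (p : CP m) : (zeroSection p).base = p := rfl

theorem zeroSection_mem (p : CP m) : zeroSection p ∈ center m := by
  intro v hv
  obtain ⟨a, rfl⟩ := Submodule.mem_span_singleton.1 hv
  funext k
  refine (congrArg (a * ·) (?_ : (Pi.single (Fin.last m) 1 : Fin (m + 1) → ℂ) k.castSucc = 0)).trans
    (mul_zero a)
  simp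

theorem zeroSection_base_of_mem {y : YSpace m} (hy : y ∈ center m) : zeroSection y.base = y :=
  eq_of_mem_center (zeroSection_mem _) hy rfl

theorem range_zeroSection : Set.range (zeroSection : CP m → YSpace m) = center m := by
  ext y
  constructor
  · rintro ⟨p, rfl⟩
    exact zeroSection_mem p
  · exact fun hy => ⟨y.base, zeroSection_base_of_mem hy⟩

theorem mem_U_of_mem_center {i : Fin (m + 1)} {y : YSpace m} (hy : y ∈ center m)
    (hi : y.base.rep i ≠ 0) : y ∈ (cover m).U (i, Fin.last m) := fun r => by
  match r with
  | false => exact hi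
  | true =>
    change hom y true (fibreIndex i (Fin.last m)) ≠ 0
    rw [fibreIndex_last]
    exact last_ne_zero_of_mem_center hy

theorem contMDiff_zeroSection :
    ContMDiff 𝓘(ℂ, Fin m → ℂ) 𝓘(ℂ, YModel m) ω (zeroSection : CP m → YSpace m) := by
  intro p
  obtain ⟨i, hi⟩ := exists_rep_ne_zero p
  refine (isHolo m).contMDiffAt_of_ratio (i, Fin.last m) ?_ fun r b => ?_
  · filter_upwards [(CP.isOpen_source i).mem_nhds hi] with p' hp'
    exact mem_U_of_mem_center (zeroSection_mem p') hp'
  · match r, b with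
    | false, b =>
      exact (CP.contMDiffOn_ratio b i).contMDiffAt ((CP.isOpen_source i).mem_nhds hi)
    | true, none =>
      refine (contMDiffAt_const (c := (1 : ℂ))).congr_of_eventuallyEq
        (Filter.Eventually.of_forall fun p' => ?_)
      change last (zeroSection p') / hom (zeroSection p') true (fibreIndex i (Fin.last m)) = 1
      rw [fibreIndex_last]
      exact div_self (last_ne_zero_of_mem_center (zeroSection_mem p'))
    | true, some (a, k) =>
      refine (contMDiffAt_const (c := (0 : ℂ))).congr_of_eventuallyEq
        (Filter.Eventually.of_forall fun p' => ?_)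
      change (zeroSection p').base.rep a * (zeroSection p').line.rep.1 k / _ = 0
      rw [(mem_center_iff _).1 (zeroSection_mem p'), Pi.zero_apply, mul_zero, zero_div]

theorem contMDiff_base :
    ContMDiff 𝓘(ℂ, YModel m) 𝓘(ℂ, Fin m → ℂ) ω (base : YSpace m → CP m) := by
  intro y
  obtain ⟨i, hi⟩ := exists_rep_ne_zero y.base
  refine (CP.isHolo m).contMDiffAt_of_ratio i ?_ fun _ a => ?_
  · filter_upwards [((isHolo m).isOpen_ne false i).mem_nhds hi] with y' hy' _
    exact hy'
  · exact (isHolo m).contMDiffAt_ratio (r := false) hi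

/-- The bundle projection is a holomorphic left inverse. It gives injectivity of the map and of its
differential; the image is closed since `ℙ^m` is compact and `Y` is Hausdorff. -/
theorem isHolEmbedding_zeroSection :
    IsHolEmbedding (Fin m → ℂ) (YModel m) (zeroSection : CP m → YSpace m) where
  holo := contMDiff_zeroSection
  isClosedEmbedding := by
    have := (isHolo m).t2Space
    exact contMDiff_zeroSection.continuous.isClosedEmbedding
      (Function.LeftInverse.injective zeroSection_base)
  immersion p := by
    have h := mfderiv_comp (I := 𝓘(ℂ, Fin m → ℂ)) (I' := 𝓘(ℂ, YModel m)) (I'' := 𝓘(ℂ, Fin m → ℂ)) p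
      ((contMDiff_base (m := m)).mdifferentiable (by simp) (zeroSection p))
      (contMDiff_zeroSection.mdifferentiable (by simp) p)
    have h' : (base ∘ zeroSection : CP m → CP m) = id := funext zeroSection_base
    rw [h', mfderiv_id] at h
    intro u v huv
    have hu := DFunLike.congr_fun h u
    have hv := DFunLike.congr_fun h v
    exact hu.trans ((congrArg _ huv).trans hv.symm)

/-! ### The normal bundle of the centre -/

/-- The morphism of `Y` near the centre to the sum of copies of `ℂ ^ (m + 1)`, with values in the
tautological lines: the trivial coordinates relative to the last one. -/
def normalMap (y : YSpace m) : Fin m → Fin (m + 1) → ℂ := fun k a =>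
  hom y true (some (a, k) : Option (Fin (m + 1) × Fin m)) /
    hom y true (none : Option (Fin (m + 1) × Fin m))

theorem normalMap_eq_zero {y : YSpace m} (hy : y ∈ center m) : normalMap y = 0 := by
  funext k a
  change y.base.rep a * y.line.rep.1 k / _ = 0
  rw [(mem_center_iff y).1 hy, Pi.zero_apply, mul_zero, zero_div]

theorem contMDiffAt_normalMap {y : YSpace m} (hy : y ∈ center m) :
    ContMDiffAt 𝓘(ℂ, YModel m) 𝓘(ℂ, Fin m → Fin (m + 1) → ℂ) ω normalMap y :=
  contMDiffAt_pi_space.2 fun _ => contMDiffAt_pi_space.2 fun _ =>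
    (isHolo m).contMDiffAt_ratio (r := true) (last_ne_zero_of_mem_center hy)

theorem normalMap_χ (i : Fin (m + 1)) (z : Fin m ⊕ Fin m → ℂ) (k : Fin m) (a : Fin (m + 1)) :
    normalMap ((cover m).χ (i, Fin.last m) z) k a =
      z (Sum.inr k) * (i.insertNth (1 : ℂ) (fun k => z (Sum.inl k)) : Fin (m + 1) → ℂ) a := by
  refine ((cover m).s_χ_div (i, Fin.last m) z true _ _).trans ?_
  change (i.insertNth (1 : ℂ) (fun k => z (Sum.inl k)) : Fin (m + 1) → ℂ) a *
    ((Fin.last m).insertNth (1 : ℂ) (fun k => z (Sum.inr k)) : Fin (m + 1) → ℂ) k.castSucc /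
    ((Fin.last m).insertNth (1 : ℂ) (fun k => z (Sum.inr k)) : Fin (m + 1) → ℂ) (Fin.last m) = _
  rw [Fin.insertNth_apply_same, div_one, ← Fin.succAbove_last_apply,
    Fin.insertNth_apply_succAbove, mul_comm]

theorem χ_mem_center_iff (i : Fin (m + 1)) (z : Fin m ⊕ Fin m → ℂ) :
    (cover m).χ (i, Fin.last m) z ∈ center m ↔ ∀ k, z (Sum.inr k) = 0 := by
  rw [← fibreRatio_eq_zero_iff ((cover m).χ_mem (i, Fin.last m) z), funext_iff]
  refine forall_congr' fun k => ?_
  rw [← ψ_inr, (cover m).ψ_χ]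
  rfl

/-- The projection to the coordinates of the base. -/
def basePart (m : ℕ) : (Fin m ⊕ Fin m → ℂ) →L[ℂ] (Fin m ⊕ Fin m → ℂ) :=
  ContinuousLinearMap.pi (Sum.elim (fun k => ContinuousLinearMap.proj (Sum.inl k)) fun _ => 0)

theorem zeroSection_base_χ (i : Fin (m + 1)) (z : Fin m ⊕ Fin m → ℂ) :
    zeroSection ((cover m).χ (i, Fin.last m) z).base =
      (cover m).χ (i, Fin.last m) (basePart m z) :=
  eq_of_mem_center (zeroSection_mem _) ((χ_mem_center_iff i _).2 fun _ => rfl) rfl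

section Chart

variable (i : Fin (m + 1)) (z : Fin m ⊕ Fin m → ℂ)

/-- The tangent vector at a point of a coordinate system with given coordinates. -/
abbrev tangentOfCoord : (Fin m ⊕ Fin m → ℂ) →L[ℂ] YModel m :=
  mfderiv 𝓘(ℂ, Fin m ⊕ Fin m → ℂ) 𝓘(ℂ, YModel m) ((cover m).χ (i, Fin.last m)) z

theorem hasMFDerivAt_χ : HasMFDerivAt 𝓘(ℂ, Fin m ⊕ Fin m → ℂ) 𝓘(ℂ, YModel m)
    ((cover m).χ (i, Fin.last m)) z (tangentOfCoord i z) :=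
  (((isHolo m).contMDiff_χ (i, Fin.last m)).mdifferentiable (by simp) z).hasMFDerivAt

theorem tangentOfCoord_surjective : Function.Surjective (tangentOfCoord i z) := by
  intro v
  have hψ := ((isHolo m).contMDiffAt_ψ ((cover m).χ_mem (i, Fin.last m) z)).mdifferentiableAt
    (by simp)
  have hχ := hasMFDerivAt_χ i ((cover m).ψ (i, Fin.last m) ((cover m).χ (i, Fin.last m) z))
  have h := hχ.comp _ hψ.hasMFDerivAt
  have hid : HasMFDerivAt 𝓘(ℂ, YModel m) 𝓘(ℂ, YModel m)
      ((cover m).χ (i, Fin.last m) ∘ (cover m).ψ (i, Fin.last m))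
      ((cover m).χ (i, Fin.last m) z) (ContinuousLinearMap.id ℂ _) := by
    refine (hasMFDerivAt_id _).congr_of_eventuallyEq ?_
    filter_upwards [((isHolo m).isOpen_U _).mem_nhds ((cover m).χ_mem (i, Fin.last m) z)]
      with y hy
    exact (cover m).χ_ψ hy
  have heq := hasMFDerivAt_unique h hid
  rw [(cover m).ψ_χ] at heq
  exact ⟨_, DFunLike.congr_fun heq v⟩

/-- The differential of `normalMap` in coordinates, at a point of the centre. -/
theorem mfderiv_normalMap_apply (hz : ∀ k, z (Sum.inr k) = 0) (u : Fin m ⊕ Fin m → ℂ) :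
    (mfderiv 𝓘(ℂ, YModel m) 𝓘(ℂ, Fin m → Fin (m + 1) → ℂ) normalMap
      ((cover m).χ (i, Fin.last m) z) (tangentOfCoord i z u) : Fin m → Fin (m + 1) → ℂ) =
        fun k => u (Sum.inr k) • i.insertNth (1 : ℂ) fun k => z (Sum.inl k) := by
  have h := (((contMDiffAt_normalMap ((χ_mem_center_iff i z).2 hz)).mdifferentiableAt
    (by simp)).hasMFDerivAt).comp z (hasMFDerivAt_χ i z)
  have h' : HasFDerivAt (normalMap ∘ (cover m).χ (i, Fin.last m)) _ z := h.hasFDerivAt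
  funext k a
  have h1 : HasFDerivAt (fun z => normalMap ((cover m).χ (i, Fin.last m) z) k a) _ z :=
    hasFDerivAt_pi'.1 (hasFDerivAt_pi'.1 h' k) a
  have hx : ContDiff ℂ ω fun z : Fin m ⊕ Fin m → ℂ =>
      (i.insertNth (1 : ℂ) (fun k => z (Sum.inl k)) : Fin (m + 1) → ℂ) a :=
    (contDiff_insertNth i a).comp (contDiff_pi.2 fun k => contDiff_apply ℂ ℂ _)
  have h2 := (hasFDerivAt_apply (𝕜 := ℂ) (Sum.inr k) z).mul
    ((hx.differentiable (by simp)) z).hasFDerivAt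
  simp only [normalMap_χ] at h1
  have h3 := DFunLike.congr_fun (h1.unique h2) u
  refine h3.trans ?_
  -- In the product rule the term with the derivative of `x_a` carries the factor `z (Sum.inr k)`,
  -- which is zero on the centre.
  simp [hz, mul_comm]

theorem mfderiv_zeroSection_base_apply (u : Fin m ⊕ Fin m → ℂ) :
    (mfderiv 𝓘(ℂ, YModel m) 𝓘(ℂ, YModel m) (fun y : YSpace m => zeroSection y.base)
      ((cover m).χ (i, Fin.last m) z) (tangentOfCoord i z u) : YModel m) =
        tangentOfCoord i (basePart m z) (basePart m u) := by
  have h1 := (((contMDiff_zeroSection (m := m)).comp contMDiff_base).mdifferentiable (by simp)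
    ((cover m).χ (i, Fin.last m) z)).hasMFDerivAt.comp z (hasMFDerivAt_χ i z)
  have h2 := (hasMFDerivAt_χ i (basePart m z)).comp z
    (basePart m).hasFDerivAt.hasMFDerivAt
  have h3 : (zeroSection ∘ base) ∘ (cover m).χ (i, Fin.last m) =
      (cover m).χ (i, Fin.last m) ∘ basePart m := funext (zeroSection_base_χ i)
  rw [h3] at h1
  exact DFunLike.congr_fun (hasMFDerivAt_unique h1 h2) u

end Chart

theorem exists_χ_eq {y : YSpace m} (hy : y ∈ center m) : ∃ i z, (∀ k, z (Sum.inr k) = 0) ∧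
    (cover m).χ (i, Fin.last m) z = y := by
  obtain ⟨i, hi⟩ := exists_rep_ne_zero y.base
  obtain ⟨z, rfl⟩ := (cover m).surj (i, Fin.last m) y (mem_U_of_mem_center hy hi)
  exact ⟨i, z, (χ_mem_center_iff i z).1 hy, rfl⟩

theorem range_mfderiv_normalMap {y : YSpace m} (hy : y ∈ center m) :
    Set.range (mfderiv 𝓘(ℂ, YModel m) 𝓘(ℂ, Fin m → Fin (m + 1) → ℂ) normalMap y) =
      {A : Fin m → Fin (m + 1) → ℂ | ∀ k, A k ∈ y.base.submodule} := by
  obtain ⟨i, z, hz, rfl⟩ := exists_χ_eq hy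
  have hsub : ((cover m).χ (i, Fin.last m) z).base.submodule =
      Submodule.span ℂ {i.insertNth (1 : ℂ) fun k => z (Sum.inl k)} := rfl
  rw [hsub]
  refine Set.ext fun A => ⟨?_, fun hA => ?_⟩
  · rintro ⟨v, rfl⟩ k
    obtain ⟨u, rfl⟩ := tangentOfCoord_surjective i z v
    refine Set.mem_of_eq_of_mem (congrFun (mfderiv_normalMap_apply i z hz u) k) ?_
    exact Submodule.smul_mem _ _ (Submodule.mem_span_singleton_self _)
  · choose c hc using fun k => Submodule.mem_span_singleton.1 (hA k)
    exact ⟨tangentOfCoord i z (Sum.elim 0 c),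
      (mfderiv_normalMap_apply i z hz _).trans (funext hc)⟩

/-- The map `y ↦ zeroSection y.base` is a retraction of `Y` onto the centre that forgets the fibre
coordinates. A vector killed by the differential of `normalMap` has none, so it is fixed and hence
tangent to the centre. -/
theorem mfderiv_zeroSection_base {y : YSpace m} (hy : y ∈ center m) (v : YModel m)
    (hv : mfderiv 𝓘(ℂ, YModel m) 𝓘(ℂ, Fin m → Fin (m + 1) → ℂ) normalMap y v = 0) :
    mfderiv 𝓘(ℂ, YModel m) 𝓘(ℂ, YModel m) (fun y : YSpace m => zeroSection y.base) y v = v := by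
  obtain ⟨i, z, hz, rfl⟩ := exists_χ_eq hy
  obtain ⟨u, rfl⟩ := tangentOfCoord_surjective i z v
  have hu : ∀ k, u (Sum.inr k) = 0 := fun k => by
    have h := congrFun (congrFun ((mfderiv_normalMap_apply i z hz u).symm.trans hv) k) i
    simpa using h.trans (Pi.zero_apply (M := fun _ => ℂ) i)
  have hP : ∀ u : Fin m ⊕ Fin m → ℂ, (∀ k, u (Sum.inr k) = 0) → basePart m u = u :=
    fun u hu => funext fun c => by
      match c with
      | Sum.inl k => rfl
      | Sum.inr k => exact (hu k).symm
  refine (mfderiv_zeroSection_base_apply i z u).trans ?_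
  rw [hP z hz, hP u hu]

/-- The morphism is the differential of `normalMap` along the centre. Its kernel contains the
tangent vectors of the centre because `normalMap` vanishes there, and equals them by the retraction.
-/
theorem normalBundleIsTautSum_zeroSection :
    NormalBundleIsTautSum (E := YModel m) (zeroSection : CP m → YSpace m) := by
  have hσ := contMDiff_zeroSection (m := m)
  have hzero : (fun p : CP m => normalMap (zeroSection p)) = fun _ => 0 :=
    funext fun p => normalMap_eq_zero (zeroSection_mem p)
  refine ⟨fun p => mfderiv 𝓘(ℂ, YModel m) 𝓘(ℂ, Fin m → Fin (m + 1) → ℂ) normalMap (zeroSection p),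
    fun p => range_mfderiv_normalMap (zeroSection_mem p), fun p v => ⟨fun hv => ?_, ?_⟩,
    fun p => ?_⟩
  · have h := mfderiv_comp (zeroSection p) (hσ.mdifferentiable (by simp) (zeroSection p).base)
      (contMDiff_base.mdifferentiable (by simp) (zeroSection p))
    exact ⟨_, (DFunLike.congr_fun h v).symm.trans
      (mfderiv_zeroSection_base (zeroSection_mem p) v hv)⟩
  · rintro ⟨u, rfl⟩
    have h := mfderiv_comp p
      ((contMDiffAt_normalMap (zeroSection_mem p)).mdifferentiableAt (by simp))
      (hσ.mdifferentiable (by simp) p)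
    have h' : mfderiv 𝓘(ℂ, Fin m → ℂ) 𝓘(ℂ, Fin m → Fin (m + 1) → ℂ)
        (normalMap ∘ (zeroSection : CP m → YSpace m)) p = 0 := by
      have : normalMap ∘ (zeroSection : CP m → YSpace m) = fun _ => 0 := hzero
      rw [this]
      exact mfderiv_const
    exact (DFunLike.congr_fun (h.symm.trans h') u)
  · have h := ContMDiffAt.mfderiv (n := ω) (m := ω) (x₀ := p) (J := 𝓘(ℂ, Fin m → ℂ))
      (fun (_ : CP m) => (normalMap : YSpace m → _)) zeroSection
      ((contMDiffAt_normalMap (zeroSection_mem p)).comp (p, zeroSection p) contMDiffAt_snd)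
      hσ.contMDiffAt (by simp)
    -- The base-point map in the target is `normalMap ∘ zeroSection`, which is constantly zero.
    rw [hzero] at h
    exact h

end YSpace

end FanoBlowUp

end

/-! ### The theorem -/

theorem proposition1 (m n : ℕ) (hn : n = 2 * m) :
    Module.finrank ℂ (YModel m) = n ∧
    (∃ σ : CP m → YSpace m, IsHolEmbedding (Fin m → ℂ) (YModel m) σ ∧ Set.range σ = center m ∧
      (∀ p, (σ p).base = p) ∧ NormalBundleIsTautSum (E := YModel m) σ) ∧
    (∃ (X : Type) (_ : TopologicalSpace X) (_ : T2Space X) (_ : ChartedSpace (YModel m) X)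
      (_ : IsManifold 𝓘(ℂ, YModel m) ω X) (π : X → YSpace m),
      IsBlowUp (YModel m) (YModel m) (center m) π) ∧
    (4 ≤ n → IsFano (YModel m) (YSpace m) ∧ HasPseudoIndex (YModel m) (YSpace m) 1) ∧
    ∀ (F X : Type) [NormedAddCommGroup F] [NormedSpace ℂ F] [FiniteDimensional ℂ F]
      [TopologicalSpace X] [T2Space X] [ChartedSpace F X] [IsManifold 𝓘(ℂ, F) ω X]
      (π : X → YSpace m), IsBlowUp (YModel m) F (center m) π →
      (4 ≤ n → Module.finrank ℂ F = n ∧ IsFano F X) ∧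
      (n = 4 → HasPseudoIndex F X 1) ∧
      (6 ≤ n → HasPseudoIndex F X 2 ∧
        ∃ iX iY : ℤ, HasPseudoIndex F X iX ∧ HasPseudoIndex (YModel m) (YSpace m) iY ∧
          2 * (Module.finrank ℂ (Fin m → ℂ) : ℤ) = n ∧
          2 * (Module.finrank ℂ (Fin m → ℂ) : ℤ) = n + iY - 1 ∧ iY < iX) := by
  subst hn
  refine ⟨by simp [two_mul], ⟨YSpace.zeroSection, YSpace.isHolEmbedding_zeroSection,
    YSpace.range_zeroSection, YSpace.zeroSection_base,
    YSpace.normalBundleIsTautSum_zeroSection⟩,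
    ⟨XSpace m, inferInstance, inferInstance, inferInstance, inferInstance, XSpace.pt,
      XSpace.isBlowUp_pt⟩,
    fun h => ⟨YSpace.isFano m, YSpace.hasPseudoIndex (by omega)⟩, ?_⟩
  intro F X _ _ _ _ _ _ _ π hπ
  -- Every blow-up of the centre is biholomorphic to `XSpace m`, whose monomial cover is transported
  -- to it.
  obtain ⟨e, he, he'⟩ := hπ.exists_equiv (XSpace.isBlowUp_pt (m := m))
  have h := (XSpace.isHolo m).transport e he he'
  refine ⟨fun hm => ⟨XSpace.finrank_eq e h (by omega), XSpace.isFano e h (by omega)⟩,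
    fun hm => ?_, fun hm => ?_⟩
  · obtain rfl : m = 2 := by omega
    exact XSpace.hasPseudoIndex_one e h
  · have h2 := XSpace.hasPseudoIndex_two e h (by omega)
    exact ⟨h2, 2, 1, h2, YSpace.hasPseudoIndex (by omega), by simp, by simp, by norm_num⟩
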